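/- Let $d\ge 1$ be an integer. For $f\in L^1(\mathbb{R}^d)\cap L^2(\mathbb{R}^d)$ let $\widehat f(\xi)=\int_{\mathbb{R}^d}f(x)e^{2i\pi\langle x,\xi\rangle}\,dx$, extended by continuity to $L^2(\mathbb{R}^d)$. Write $|E|$ for the Lebesgue measure of $E$. Let $\nu_d$ be the normalized Haar measure on the rotation group $SO(d)$ and, for $\rho\in SO(d)$, let $P_\rho$ be the orthogonal projection of $\mathbb{R}^d$ onto the line spanned by $\rho(1,0,\ldots,0)$. The mean width of $E\subset\mathbb{R}^d$ is $$w(E)=\int_{SO(d)}|P_\rho(E)|\,d\nu_d(\rho)\in[0,\infty],$$ where $|P_\rho(E)|$ is the one-dimensional Lebesgue measure of $P_\rho(E)$ (if $E$ is Lebesgue measurable but not Borel, $|\cdot|$ stands here for the outer measure and the integral for the lower integral, in case measurability fails). Theorem. For every integer $d\ge1$ there is a constant $C=C(d)>0$ such that for all Lebesgue measurable sets $S,\Sigma\subset\mathbb{R}^d$ of finite measure and all $f\in L^2(\mathbb{R}^d)$, $$\int_{\mathbb{R}^d}|f(x)|^2\,dx\le C\,e^{C\min\left(|S||\Sigma|,\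 |S|^{1/d}w(\Sigma),\ w(S)|\Sigma|^{1/d}\right)}\left(\int_{\mathbb{R}^d\setminus S}|f(x)|^2\,dx+\int_{\mathbb{R}^d\setminus\Sigma}|\widehat f(\xi)|^2\,d\xi\right),$$ where the products are computed in $[0,\infty]$ with $0\cdot\infty=0$ (the minimum is always finite). -/

import Mathlib

open MeasureTheory
open scoped FourierTransform ENNReal

namespace MeanWidth

/-- The rotation group `SO(d)`, with the topology induced by the space of matrices. -/
abbrev SO (d : ℕ) : Type := Matrix.specialOrthogonalGroup (Fin d) ℝ

instance instTopGroupSO (d : ℕ) : IsTopologicalGroup (SO d) where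
  continuous_mul := continuous_mul
  continuous_inv :=
    Continuous.subtype_mk (continuous_star.comp continuous_subtype_val) _

instance instCompactSO (d : ℕ) : CompactSpace (SO d) := by
  refine isCompact_iff_compactSpace.mp ?_
  have hcl : IsClosed
      ((Matrix.specialOrthogonalGroup (Fin d) ℝ : Set (Matrix (Fin d) (Fin d) ℝ))) := by
    have h : (Matrix.specialOrthogonalGroup (Fin d) ℝ : Set (Matrix (Fin d) (Fin d) ℝ)) =
        {A | A * star A = 1} ∩ {A | A.det = 1} := by
      ext A
      simp [Matrix.mem_specialOrthogonalGroup_iff, Matrix.mem_orthogonalGroup_iff,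
        Matrix.star_eq_conjTranspose]
    rw [h]
    exact (isClosed_eq (continuous_id.mul continuous_star) continuous_const).inter
      (isClosed_eq continuous_id.matrix_det continuous_const)
  have hK : IsCompact (Set.univ.pi fun _ : Fin d => Set.univ.pi fun _ : Fin d =>
      Set.Icc (-1 : ℝ) 1) :=
    isCompact_univ_pi fun _ => isCompact_univ_pi fun _ => isCompact_Icc
  refine IsCompact.of_isClosed_subset hK hcl ?_
  intro A hA i _ j _
  have h := entry_norm_bound_of_unitary (Matrix.mem_specialOrthogonalGroup_iff.mp hA).1 i j
  rw [Real.norm_eq_abs] at h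
  exact abs_le.mp h

instance instMeasSO (d : ℕ) : MeasurableSpace (SO d) := borel _

instance instBorelSO (d : ℕ) : BorelSpace (SO d) := ⟨rfl⟩

/-- The normalized Haar measure on `SO(d)`: the Haar measure of total mass `1`. -/
noncomputable def haarSO (d : ℕ) : Measure (SO d) :=
  Measure.haarMeasure ⊤

/-- The vector `ρ(1, 0, …, 0)`, a unit vector of `ℝ^d`. -/
noncomputable def axis {d : ℕ} [NeZero d] (ρ : SO d) : EuclideanSpace ℝ (Fin d) :=
  Matrix.toEuclideanLin (ρ : Matrix (Fin d) (Fin d) ℝ) (EuclideanSpace.single 0 1)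

/-- The length `|P_ρ(E)|` of the orthogonal projection `P_ρ(E)` of `E` on the line spanned by the
unit vector `ρ(1, 0, …, 0)`. The line is identified with `ℝ` through `t ↦ t ρ(1, 0, …, 0)`, so that
the projection of `x` has the coordinate `⟪ρ(1, 0, …, 0), x⟫`. -/
noncomputable def projLength {d : ℕ} [NeZero d] (ρ : SO d) (E : Set (EuclideanSpace ℝ (Fin d))) :
    ℝ≥0∞ :=
  volume ((fun x => inner ℝ (axis ρ) x) '' E)

/-- The mean width `w(E) ∈ [0, ∞]`: the average over `SO(d)` of the lengths `|P_ρ(E)|`. -/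
noncomputable def meanWidth {d : ℕ} [NeZero d] (E : Set (EuclideanSpace ℝ (Fin d))) : ℝ≥0∞ :=
  ∫⁻ ρ, projLength ρ E ∂(haarSO d)

/-- The quantity `min (|S||Σ|, |S|^{1/d} w(Σ), w(S) |Σ|^{1/d})`, computed in `[0, ∞]` (with
`0 · ∞ = 0`), as a mean width may be infinite. -/
noncomputable def exponent {d : ℕ} [NeZero d] (S T : Set (EuclideanSpace ℝ (Fin d))) : ℝ≥0∞ :=
  min (volume S * volume T)
    (min (volume S ^ (1 / (d : ℝ)) * meanWidth T) (meanWidth S * volume T ^ (1 / (d : ℝ))))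

/-- The Fourier transform on `L²(ℝ^d)` with the kernel `e^{2iπ⟨x, ξ⟩}`, extended from nice functions
by continuity. Mathlib denotes the transform with the positive sign in the exponential by `𝓕⁻`. -/
noncomputable def fourierL2 {d : ℕ} (f : Lp ℂ 2 (volume : Measure (EuclideanSpace ℝ (Fin d)))) :
    Lp ℂ 2 (volume : Measure (EuclideanSpace ℝ (Fin d))) :=
  𝓕⁻ f

end MeanWidth

/-! The method is Nazarov's, run on a random lattice. Suppose first that f is supported in a compact
set S, and fix a point y. Fold f, modulated by y, along a rotated lattice whose scale c satisfies
c^d |S| ≤ 1/2: the folded function vanishes on at least half of the unit cell, and its Fourier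
coefficients are, up to a constant factor, the samples of the transform at y - cρk, k ∈ ℤ^d. Let s
consist of k = 0 and of those k whose sample point lies in T (the set Σ of the statement). If the
remaining coefficients have ℓ² norm at most M, Chebyshev's inequality leaves a quarter of the cell
where the folded function is zero and the trigonometric polynomial with frequencies in s is at most
2M. The Turán inequality `sum_norm_le_of_norm_trigPoly_le` then bounds its coefficient at 0, that is
the transform at y, by 16^r · 2M, where r is a rank of s.

That inequality follows from ∫ log(Σ|c|/|p|) ≤ r log 2. A normalized derivative of p in one variable
kills an extreme slice of frequencies; by Mahler's inequality `mahlerMeasure_derivative_le` it does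
not increase ∫ log|p|, and one of the two possible normalizations keeps half of Σ|c|. Any quantity
that drops with each removed slice can serve as the rank.

The lattice comes from averaging over rotations and over dilations in (1, 2]. By
`lintegral_lattice_le`, a lattice sum without the origin is on average at most a constant times |S|
times the integral. This controls M², and also the rank card - 1, by |S||T|. The rank that counts
distinct values of each coordinate needs only one-dimensional averages over projections
(`lintegral_coord_le`), which give |S|^{1/d} w(T). Integrating the pointwise bound over T costs a
factor |S||T|, absorbed by the exponential; in the second case through |T| ≤ (d w(T))^d.

A general f is cut along S and its complement, the third exponent follows by exchanging the roles of
f and its transform, and inner approximation by compact sets gives arbitrary sets, since the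
exponent is monotone. -/

namespace MeanWidth

/-! ### Mahler's inequality for the derivative -/

section Mahler

open Polynomial ComplexConjugate

/-- The monic polynomial with a given multiset of roots. -/
noncomputable def rootProd (s : Multiset ℂ) : ℂ[X] := (s.map fun a => X - C a).prod

/-- The reflection of a point outside of the closed unit disc at the unit circle. -/
noncomputable def reflectIn (a : ℂ) : ℂ := if ‖a‖ ≤ 1 then a else (conj a)⁻¹

theorem rootProd_cons (a : ℂ) (s : Multiset ℂ) :
    rootProd (a ::ₘ s) = (X - C a) * rootProd s := by simp [rootProd]

theorem norm_reflectIn_le (a : ℂ) : ‖reflectIn a‖ ≤ 1 := by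
  unfold reflectIn
  split_ifs with h
  · exact h
  · rw [norm_inv, RCLike.norm_conj]
    exact inv_le_one_of_one_le₀ (not_le.mp h).le

theorem norm_sub_reflectIn {z : ℂ} (hz : ‖z‖ = 1) (a : ℂ) :
    ‖z - a‖ = max 1 ‖a‖ * ‖z - reflectIn a‖ := by
  unfold reflectIn
  split_ifs with h
  · rw [max_eq_left h, one_mul]
  · have h1 := (not_le.mp h).le
    have ha : conj a ≠ 0 := by
      intro h0
      rw [map_eq_zero] at h0
      simp [h0] at h
    have hzz : z * conj z = 1 := by
      rw [Complex.mul_conj, Complex.normSq_eq_norm_sq, hz]; simp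
    have e : conj a * (z - (conj a)⁻¹) = - z * conj (z - a) := by
      rw [map_sub, mul_sub, mul_inv_cancel₀ ha]
      linear_combination hzz
    rw [max_eq_right h1, ← RCLike.norm_conj a, ← norm_mul, e, norm_mul, norm_neg, hz,
      RCLike.norm_conj, one_mul]

theorem norm_eval_rootProd {z : ℂ} (hz : ‖z‖ = 1) (s : Multiset ℂ) :
    ‖(rootProd s).eval z‖ =
      (s.map fun a => max 1 ‖a‖).prod * ‖(rootProd (s.map reflectIn)).eval z‖ := by
  induction s using Multiset.induction with
  | empty => simp [rootProd]
  | cons a s ih =>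
    rw [Multiset.map_cons, Multiset.map_cons, rootProd_cons, rootProd_cons, Multiset.prod_cons,
      eval_mul, eval_mul, norm_mul, norm_mul, ih]
    simp only [eval_sub, eval_X, eval_C]
    rw [norm_sub_reflectIn hz a]
    ring

/-- For w = z / (z - a) with a outside the disc, reflection replaces w by 1 - conj w. The imaginary
part survives, and since Re w ≤ 1/2 there, the new real part 1 - Re w dominates |Re w|. -/
theorem re_im_div_sub_reflectIn {z a : ℂ} (hz : ‖z‖ = 1) (ha : z ≠ a) :
    (z / (z - a)).im = (z / (z - reflectIn a)).im ∧
      |(z / (z - a)).re| ≤ (z / (z - reflectIn a)).re := by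
  have hzz : z * conj z = 1 := by
    rw [Complex.mul_conj, Complex.normSq_eq_norm_sq, hz]; simp
  have hz0 : z ≠ 0 := by rintro rfl; simp at hz
  have hza : z - a ≠ 0 := sub_ne_zero.mpr ha
  have re_half : 0 < Complex.normSq (z - a) := Complex.normSq_pos.mpr hza
  have hre : (z / (z - a)).re = 1 / 2 + (1 - ‖a‖ ^ 2) / (2 * Complex.normSq (z - a)) := by
    have h1 : Complex.normSq z = 1 := by rw [Complex.normSq_eq_norm_sq, hz]; simp
    rw [Complex.div_re, ← Complex.normSq_eq_norm_sq]
    have h2 : Complex.normSq (z - a) = Complex.normSq z + Complex.normSq a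
      - 2 * (z.re * a.re + z.im * a.im) := by
      simp only [Complex.normSq_apply, Complex.sub_re, Complex.sub_im]; ring
    field_simp
    rw [h2]
    simp only [Complex.normSq_apply, Complex.sub_re, Complex.sub_im] at h1 ⊢
    linear_combination (-1) * h1 + 2 * h1
  unfold reflectIn
  split_ifs with h
  · refine ⟨rfl, le_of_eq (abs_of_nonneg ?_)⟩
    rw [hre]
    have : 0 ≤ 1 - ‖a‖ ^ 2 := by nlinarith [norm_nonneg a]
    positivity
  · have h1 := not_le.mp h
    have ha0 : conj a ≠ 0 := by
      intro h0
      rw [map_eq_zero] at h0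
      simp [h0] at h
    have hw : z - (conj a)⁻¹ ≠ 0 := by
      intro h0
      have h2 : ‖(conj a)⁻¹‖ = 1 := by rw [← hz, sub_eq_zero.mp h0]
      rw [norm_inv, RCLike.norm_conj, inv_eq_one] at h2
      exact h1.ne' h2
    have key : z / (z - (conj a)⁻¹) = 1 - conj (z / (z - a)) := by
      have h3 : conj (z - a) ≠ 0 := by rwa [Ne, map_eq_zero]
      rw [map_div₀, div_eq_iff hw, sub_mul, div_mul_eq_mul_div, eq_sub_iff_add_eq,
        ← eq_sub_iff_add_eq', div_eq_iff h3]
      rw [map_sub]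
      field_simp
      linear_combination conj a * hzz
    rw [key]
    simp only [Complex.sub_im, Complex.one_im, Complex.conj_im, Complex.sub_re, Complex.one_re,
      Complex.conj_re]
    refine ⟨by ring, ?_⟩
    have h4 : (z / (z - a)).re ≤ 1 / 2 := by
      rw [hre]
      have : (1 - ‖a‖ ^ 2) / (2 * Complex.normSq (z - a)) ≤ 0 :=
        div_nonpos_of_nonpos_of_nonneg (by nlinarith) (by positivity)
      linarith
    rw [abs_le]
    constructor <;> linarith

theorem eval_rootProd_eq_zero_iff {z : ℂ} {s : Multiset ℂ} :
    (rootProd s).eval z = 0 ↔ z ∈ s := by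
  induction s using Multiset.induction with
  | empty => simp [rootProd]
  | cons a s ih => simp [rootProd_cons, ih, sub_eq_zero]

/-- z P'/P is the sum of z / (z - a) over the roots. Comparing real and imaginary parts separately,
rather than moduli, is what survives the summation. -/
theorem re_im_logDeriv_rootProd {z : ℂ} (hz : ‖z‖ = 1) (s : Multiset ℂ) (hs : z ∉ s) :
    (z * (rootProd s).derivative.eval z / (rootProd s).eval z).im =
      (z * (rootProd (s.map reflectIn)).derivative.eval z /
        (rootProd (s.map reflectIn)).eval z).im ∧
    |(z * (rootProd s).derivative.eval z / (rootProd s).eval z).re| ≤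
      (z * (rootProd (s.map reflectIn)).derivative.eval z /
        (rootProd (s.map reflectIn)).eval z).re := by
  have step : ∀ (a : ℂ) (t : Multiset ℂ), z - a ≠ 0 → (rootProd t).eval z ≠ 0 →
      z * (rootProd (a ::ₘ t)).derivative.eval z / (rootProd (a ::ₘ t)).eval z =
      z / (z - a) + z * (rootProd t).derivative.eval z / (rootProd t).eval z := by
    intro a t h1 h2
    simp only [rootProd_cons, derivative_mul, derivative_sub, derivative_X, derivative_C, sub_zero,
      one_mul, eval_add, eval_mul, eval_sub, eval_X, eval_C]
    field_simp
  induction s using Multiset.induction with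
  | empty => simp [rootProd]
  | cons a s ih =>
    rw [Multiset.mem_cons, not_or] at hs
    obtain ⟨h1, h2⟩ := ih hs.2
    obtain ⟨h3, h4⟩ := re_im_div_sub_reflectIn hz hs.1
    have e1 : z - a ≠ 0 := sub_ne_zero.mpr hs.1
    have e2 : (rootProd s).eval z ≠ 0 := fun h => hs.2 (eval_rootProd_eq_zero_iff.mp h)
    have e3 : z - reflectIn a ≠ 0 := by
      intro h
      have := norm_sub_reflectIn hz a
      rw [h, norm_zero, mul_zero, norm_eq_zero] at this
      exact e1 this
    have e4 : (rootProd (s.map reflectIn)).eval z ≠ 0 := by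
      intro h
      have := norm_eval_rootProd hz s
      rw [h, norm_zero, mul_zero, norm_eq_zero] at this
      exact e2 this
    rw [Multiset.map_cons, step a s e1 e2, step _ _ e3 e4]
    simp only [Complex.add_re, Complex.add_im]
    exact ⟨by rw [h1, h3], (abs_add_le _ _).trans (add_le_add h4 h2)⟩

/-- Away from the roots, multiply the comparison of logarithmic derivatives by that of |P|. A root
on the circle is fixed by the reflection, and there the derivative is the product of the other
factors. -/
theorem norm_eval_derivative_rootProd_le {z : ℂ} (hz : ‖z‖ = 1) (s : Multiset ℂ) :
    ‖(rootProd s).derivative.eval z‖ ≤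
      (s.map fun a => max 1 ‖a‖).prod * ‖(rootProd (s.map reflectIn)).derivative.eval z‖ := by
  by_cases hs : z ∈ s
  · obtain ⟨t, rfl⟩ := Multiset.exists_cons_of_mem hs
    have hr : reflectIn z = z := by simp [reflectIn, hz]
    have h1 : ∀ t, (rootProd (z ::ₘ t)).derivative.eval z = (rootProd t).eval z := by
      intro t
      simp [rootProd_cons, derivative_mul]
    rw [Multiset.map_cons, Multiset.map_cons, hr, h1, h1, norm_eval_rootProd hz t, hz]
    simp
  · obtain ⟨h1, h2⟩ := re_im_logDeriv_rootProd hz s hs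
    have e2 : (rootProd s).eval z ≠ 0 := fun h => hs (eval_rootProd_eq_zero_iff.mp h)
    have e4 : (rootProd (s.map reflectIn)).eval z ≠ 0 := by
      intro h
      have := norm_eval_rootProd hz s
      rw [h, norm_zero, mul_zero, norm_eq_zero] at this
      exact e2 this
    have h3 : ‖z * (rootProd s).derivative.eval z / (rootProd s).eval z‖ ≤
        ‖z * (rootProd (s.map reflectIn)).derivative.eval z /
        (rootProd (s.map reflectIn)).eval z‖ := by
      rw [← sq_le_sq₀ (norm_nonneg _) (norm_nonneg _), ← Complex.normSq_eq_norm_sq,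
        ← Complex.normSq_eq_norm_sq, Complex.normSq_apply, Complex.normSq_apply, h1]
      have := sq_le_sq' (by linarith [neg_abs_le (z * (rootProd s).derivative.eval z /
        (rootProd s).eval z).re]) ((le_abs_self _).trans h2)
      nlinarith
    rw [norm_div, norm_div, norm_mul, norm_mul, hz, one_mul, one_mul,
      div_le_div_iff₀ (norm_pos_iff.mpr e2) (norm_pos_iff.mpr e4), norm_eval_rootProd hz s] at h3
    refine le_of_mul_le_mul_right ?_ (norm_pos_iff.mpr e4)
    linarith

theorem rootProd_monic (s : Multiset ℂ) : (rootProd s).Monic :=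
  monic_multiset_prod_of_monic _ _ fun a _ => monic_X_sub_C a

theorem natDegree_rootProd (s : Multiset ℂ) : (rootProd s).natDegree = s.card := by
  simp [rootProd, natDegree_multiset_prod_X_sub_C_eq_card]

/-- By Gauss–Lucas the critical points stay in the disc, so the Mahler measure of the derivative is
just its leading coefficient. -/
theorem mahlerMeasure_derivative_rootProd_le {s : Multiset ℂ} (hs : ∀ a ∈ s, ‖a‖ ≤ 1) :
    (rootProd s).derivative.mahlerMeasure ≤ s.card := by
  rcases Nat.eq_zero_or_pos s.card with h0 | h0
  · rw [Multiset.card_eq_zero] at h0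
    simp [h0, rootProd]
  have hdeg : 0 < (rootProd s).degree := by
    rw [← natDegree_pos_iff_degree_pos, natDegree_rootProd]; exact h0
  have hroots : ∀ a ∈ (rootProd s).derivative.roots, max 1 ‖a‖ = 1 := by
    intro a ha
    have hne : (rootProd s).derivative ≠ 0 := ne_zero_of_mem_roots ha
    have h1 : a ∈ (rootProd s).derivative.rootSet ℂ := by
      rw [mem_rootSet]
      exact ⟨hne, by simpa using (isRoot_of_mem_roots ha)⟩
    have h2 := rootSet_derivative_subset_convexHull_rootSet hdeg h1
    have h3 : convexHull ℝ ((rootProd s).rootSet ℂ) ⊆ Metric.closedBall 0 1 := by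
      refine convexHull_min ?_ (convex_closedBall _ _)
      intro b hb
      rw [mem_rootSet, coe_aeval_eq_eval, eval_rootProd_eq_zero_iff] at hb
      simpa using hs b hb.2
    simpa using h3 h2
  rw [mahlerMeasure_eq_leadingCoeff_mul_prod_roots, Multiset.map_congr rfl hroots]
  have hlead : (rootProd s).derivative.leadingCoeff = s.card := by
    rw [leadingCoeff, natDegree_derivative, coeff_derivative, natDegree_rootProd,
      Nat.sub_add_cancel h0, ← natDegree_rootProd s, (rootProd_monic s).coeff_natDegree]
    rw [natDegree_rootProd, one_mul]
    norm_cast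
    omega
  simp [hlead]

/-- **Mahler's inequality** for the derivative of a polynomial. -/
theorem mahlerMeasure_derivative_le (p : ℂ[X]) :
    p.derivative.mahlerMeasure ≤ p.natDegree * p.mahlerMeasure := by
  have hp : p = C p.leadingCoeff * rootProd p.roots := (IsAlgClosed.splits p).eq_prod_roots
  have hcard : Multiset.card p.roots = p.natDegree :=
    (IsAlgClosed.splits p).natDegree_eq_card_roots.symm
  have key : (rootProd p.roots).derivative.mahlerMeasure ≤
      (p.roots.map fun a => max 1 ‖a‖).prod * p.natDegree := by
    set W := (p.roots.map fun a => max 1 ‖a‖).prod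
    have hW : 1 ≤ W := one_le_prod_max_one_norm_roots p
    have h2 : (rootProd (p.roots.map reflectIn)).derivative.mahlerMeasure ≤ p.natDegree := by
      refine (mahlerMeasure_derivative_rootProd_le ?_).trans (by simp [hcard])
      intro a ha
      obtain ⟨b, -, rfl⟩ := Multiset.mem_map.mp ha
      exact norm_reflectIn_le b
    by_cases h0 : (rootProd p.roots).derivative = 0
    · rw [h0, mahlerMeasure_zero]; positivity
    have hle : ∀ z : ℂ, ‖z‖ = 1 → ‖(rootProd p.roots).derivative.eval z‖ ≤
        ‖(C (W : ℂ) * (rootProd (p.roots.map reflectIn)).derivative).eval z‖ := by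
      intro z hz
      rw [eval_mul, eval_C, norm_mul, Complex.norm_real, Real.norm_of_nonneg (by linarith)]
      exact norm_eval_derivative_rootProd_le hz _
    set Q := C (W : ℂ) * (rootProd (p.roots.map reflectIn)).derivative with hQ
    -- If Q vanished, the domination on the circle would give the derivative infinitely many zeros.
    have hQ0 : Q ≠ 0 := by
      intro hQ0
      apply h0
      have : Set.Infinite {z : ℂ | ‖z‖ = 1} := by
        refine Set.infinite_of_injOn_mapsTo (s := Set.Ico (0 : ℝ) 1) (f := circleMap 0 1) ?_ ?_
          (Set.Ico_infinite one_pos)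
        · exact injOn_circleMap_of_abs_sub_le' one_ne_zero (by linarith [Real.pi_gt_three])
        · intro x _
          simp
      refine eq_zero_of_infinite_isRoot _ (this.mono fun z hz => ?_)
      have := hle z hz
      rw [hQ0, eval_zero, norm_zero] at this
      exact norm_le_zero_iff.mp this
    calc _ ≤ Q.mahlerMeasure := by
          rw [mahlerMeasure_def_of_ne_zero h0, mahlerMeasure_def_of_ne_zero hQ0]
          gcongr
          refine intervalIntegral.integral_mono_ae Real.two_pi_pos.le
            (intervalIntegrable_mahlerMeasure _) (intervalIntegrable_mahlerMeasure _) ?_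
          have hc : (circleMap 0 1 ⁻¹'
              {z | (rootProd p.roots).derivative.eval z = 0}).Countable := by
            refine Set.Countable.preimage_circleMap ?_ 0 one_ne_zero
            exact ((rootProd p.roots).derivative.rootSet_finite ℂ).countable.mono
              fun z hz => (mem_rootSet_of_ne h0).mpr (by simpa using hz)
          filter_upwards [compl_mem_ae_iff.mpr (hc.measure_zero volume)] with x hx
          exact Real.log_le_log (norm_pos_iff.mpr hx) (hle _ (by simp))
      _ = W * (rootProd (p.roots.map reflectIn)).derivative.mahlerMeasure := by
          rw [hQ, mahlerMeasure_mul, mahlerMeasure_const, Complex.norm_real,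
            Real.norm_of_nonneg (by linarith)]
      _ ≤ _ := by gcongr
  have h1 : p.derivative.mahlerMeasure =
      ‖p.leadingCoeff‖ * (rootProd p.roots).derivative.mahlerMeasure := by
    conv_lhs => rw [hp]
    rw [derivative_C_mul, mahlerMeasure_mul, mahlerMeasure_const]
  rw [h1, mahlerMeasure_eq_leadingCoeff_mul_prod_roots p]
  nlinarith [mul_le_mul_of_nonneg_left key (norm_nonneg p.leadingCoeff)]

end Mahler

/-! ### Logarithmic integrals of one-variable trigonometric sums -/

section TrigSum

open Polynomial ComplexConjugate

/-- The nonnegative quantity `log (W / ‖z‖)`, for `‖z‖ ≤ W`, which is infinite at `z = 0`. -/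
noncomputable def negLog (W : ℝ) (z : ℂ) : ℝ≥0∞ :=
  if z = 0 then ⊤ else ENNReal.ofReal (Real.log (W / ‖z‖))

theorem negLog_congr {W : ℝ} {z w : ℂ} (h : ‖z‖ = ‖w‖) : negLog W z = negLog W w := by
  have : z = 0 ↔ w = 0 := by rw [← norm_eq_zero, h, norm_eq_zero]
  simp [negLog, this, h]

theorem measurable_negLog (W : ℝ) : Measurable (negLog W) := by
  unfold negLog
  exact Measurable.ite (measurableSet_singleton 0) measurable_const (by fun_prop)

/-- The character `t ↦ e^{2πi t}`. -/
noncomputable def cexp (t : ℝ) : ℂ := Complex.exp (2 * Real.pi * Complex.I * t)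

theorem cexp_eq_circleMap (t : ℝ) : cexp t = circleMap 0 1 (2 * Real.pi * t) := by
  simp only [cexp, circleMap, Complex.ofReal_mul, Complex.ofReal_ofNat, zero_add,
    Complex.ofReal_one, one_mul]
  ring_nf

theorem cexp_add (s t : ℝ) : cexp (s + t) = cexp s * cexp t := by
  simp only [cexp, ← Complex.exp_add]
  push_cast
  ring_nf

@[simp] theorem norm_cexp (t : ℝ) : ‖cexp t‖ = 1 := by simp [cexp_eq_circleMap]

theorem cexp_neg (t : ℝ) : cexp (-t) = conj (cexp t) := by
  simp only [cexp, ← Complex.exp_conj]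
  simp [map_ofNat]

theorem cexp_nat_mul (n : ℕ) (t : ℝ) : cexp (n * t) = cexp t ^ n := by
  simp only [cexp, ← Complex.exp_nat_mul]
  push_cast
  ring_nf

@[simp] theorem cexp_zero : cexp 0 = 1 := by simp [cexp]

theorem cexp_intCast (n : ℤ) : cexp n = 1 := by
  rw [cexp, Complex.exp_eq_one_iff]
  exact ⟨n, by push_cast; ring⟩

theorem continuous_cexp : Continuous cexp := by unfold cexp; fun_prop

/-- Off the countably many zeros the integrand is log W - log|P|, nonnegative because of `h`, so the
Mahler integral can be handled in [0, ∞], where Tonelli needs no integrability. -/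
theorem lintegral_negLog_eval {P : ℂ[X]} (hP : P ≠ 0) {W : ℝ} (hW : 0 < W)
    (h : ∀ t, ‖P.eval (cexp t)‖ ≤ W) :
    ∫⁻ t in Set.Ioc (0 : ℝ) 1, negLog W (P.eval (cexp t)) =
      ENNReal.ofReal (Real.log W - P.logMahlerMeasure) := by
  have hc : (circleMap 0 1 ⁻¹' {z | P.eval z = 0}).Countable := by
    refine Set.Countable.preimage_circleMap ?_ 0 one_ne_zero
    exact (P.rootSet_finite ℂ).countable.mono
      fun z hz => (mem_rootSet_of_ne hP).mpr (by simpa using hz)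
  have hc' : {t : ℝ | P.eval (cexp t) = 0}.Countable := by
    have := hc.preimage_of_injOn (f := fun t : ℝ => 2 * Real.pi * t)
      (fun x _ y _ h => by simpa [Real.pi_ne_zero] using h)
    refine this.mono fun t ht => ?_
    simpa [cexp_eq_circleMap] using ht
  have hae : ∀ᵐ t : ℝ, P.eval (cexp t) ≠ 0 := compl_mem_ae_iff.mpr (hc'.measure_zero volume)
  have hint0 : IntervalIntegrable (fun t : ℝ => Real.log ‖P.eval (cexp t)‖) volume 0 1 := by
    have h1 := P.intervalIntegrable_mahlerMeasure
    have h2 := h1.comp_mul_left (c := 2 * Real.pi)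
    simpa [cexp_eq_circleMap, Real.pi_ne_zero] using h2
  have hint : IntegrableOn (fun t : ℝ => Real.log W - Real.log ‖P.eval (cexp t)‖)
      (Set.Ioc 0 1) := by
    rw [← intervalIntegrable_iff_integrableOn_Ioc_of_le zero_le_one]
    exact (intervalIntegrable_const (c := Real.log W)).sub hint0
  have heq : ∫ t in Set.Ioc (0 : ℝ) 1, (Real.log W - Real.log ‖P.eval (cexp t)‖) =
      Real.log W - P.logMahlerMeasure := by
    rw [← intervalIntegral.integral_of_le zero_le_one, intervalIntegral.integral_sub
      intervalIntegrable_const hint0, logMahlerMeasure_def, Real.circleAverage_def]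
    simp only [cexp_eq_circleMap]
    rw [intervalIntegral.integral_comp_mul_left
      (fun x => Real.log ‖P.eval (circleMap 0 1 x)‖) Real.two_pi_pos.ne']
    simp
  rw [← heq, ofReal_integral_eq_lintegral_ofReal hint]
  · refine lintegral_congr_ae ?_
    filter_upwards [ae_restrict_of_ae hae] with t ht
    rw [negLog, if_neg ht, Real.log_div hW.ne' (norm_ne_zero_iff.mpr ht)]
  · filter_upwards [ae_restrict_of_ae hae] with t ht
    have := Real.log_le_log (norm_pos_iff.mpr ht) (h t)
    simpa using this

/-- Shifting the frequencies by `a` gives a polynomial P of degree at most b - a, and the weighted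
sum is X P' / (b - a). Mahler's inequality says that its Mahler measure is no larger. If it vanishes
identically, the right side is infinite. -/
theorem lintegral_negLog_trigSum_le_sub_left {ι : Type*} (s : Finset ι) (n : ι → ℤ) (c : ι → ℂ)
    {a b : ℤ} (hab : a < b) (ha : ∀ i ∈ s, a ≤ n i) (hb : ∀ i ∈ s, n i ≤ b)
    {W : ℝ} (hW : 0 < W) (hp : ∀ t : ℝ, ‖∑ i ∈ s, c i * cexp (n i * t)‖ ≤ W)
    (hq : ∀ t : ℝ, ‖∑ i ∈ s, c i * ((n i - a) / (b - a)) * cexp (n i * t)‖ ≤ W) :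
    ∫⁻ t in Set.Ioc (0 : ℝ) 1, negLog W (∑ i ∈ s, c i * cexp (n i * t)) ≤
      ∫⁻ t in Set.Ioc (0 : ℝ) 1,
        negLog W (∑ i ∈ s, c i * ((n i - a) / (b - a)) * cexp (n i * t)) := by
  set P : ℂ[X] := ∑ i ∈ s, C (c i) * X ^ (n i - a).toNat with hPdef
  have hab' : (0 : ℝ) < b - a := by exact_mod_cast sub_pos.mpr hab
  have habC : ((b : ℂ) - a) ≠ 0 := by exact_mod_cast hab'.ne'
  have hfreq : ∀ i ∈ s, ∀ t : ℝ, cexp t ^ (n i - a).toNat = cexp (-(a * t)) * cexp (n i * t) := by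
    intro i hi t
    rw [← cexp_nat_mul, ← cexp_add]
    have : (((n i - a).toNat : ℤ) : ℝ) = n i - a := by
      rw [Int.toNat_of_nonneg (sub_nonneg.mpr (ha i hi))]; push_cast; ring
    rw [← Int.cast_natCast, this]
    ring_nf
  have hPe : ∀ t : ℝ, P.eval (cexp t) = cexp (-(a * t)) * ∑ i ∈ s, c i * cexp (n i * t) := by
    intro t
    simp only [hPdef, eval_finsetSum, eval_mul, eval_C, eval_pow, eval_X, Finset.mul_sum]
    refine Finset.sum_congr rfl fun i hi => ?_
    rw [hfreq i hi]; ring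
  set Q : ℂ[X] := C (((b : ℂ) - a)⁻¹) * (X * P.derivative) with hQdef
  have hQe : ∀ t : ℝ, Q.eval (cexp t) =
      cexp (-(a * t)) * ∑ i ∈ s, c i * ((n i - a) / (b - a)) * cexp (n i * t) := by
    intro t
    have h1 : X * P.derivative =
        ∑ i ∈ s, C (c i) * (C ((n i : ℂ) - a) * X ^ (n i - a).toNat) := by
      rw [hPdef, derivative_sum, Finset.mul_sum]
      refine Finset.sum_congr rfl fun i hi => ?_
      have h3 : (((n i - a).toNat : ℤ) : ℂ) = n i - a := by
        rw [Int.toNat_of_nonneg (sub_nonneg.mpr (ha i hi))]; push_cast; ring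
      rw [derivative_C_mul, derivative_X_pow, ← h3]
      rcases Nat.eq_zero_or_pos (n i - a).toNat with h2 | h2
      · simp [h2]
      · rw [Int.cast_natCast]
        obtain ⟨m, hm⟩ := Nat.exists_eq_succ_of_ne_zero h2.ne'
        rw [hm]
        simp only [Nat.succ_eq_add_one, Nat.add_sub_cancel]
        ring
    rw [hQdef, eval_mul, eval_C, h1]
    simp only [eval_finsetSum, eval_mul, eval_C, eval_pow, eval_X, Finset.mul_sum]
    refine Finset.sum_congr rfl fun i hi => ?_
    rw [hfreq i hi]
    field_simp
  have hPn : ∀ t, ‖P.eval (cexp t)‖ = ‖∑ i ∈ s, c i * cexp (n i * t)‖ := by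
    intro t; rw [hPe, norm_mul, norm_cexp, one_mul]
  have hQn : ∀ t, ‖Q.eval (cexp t)‖ =
      ‖∑ i ∈ s, c i * ((n i - a) / (b - a)) * cexp (n i * t)‖ := by
    intro t; rw [hQe, norm_mul, norm_cexp, one_mul]
  simp_rw [fun t => (negLog_congr (W := W) (hPn t)).symm,
    fun t => (negLog_congr (W := W) (hQn t)).symm]
  by_cases hQ0 : Q = 0
  · simp [hQ0, negLog]
  have hP0 : P ≠ 0 := by
    intro h; apply hQ0; simp [hQdef, h]
  rw [lintegral_negLog_eval hP0 hW (fun t => (hPn t).trans_le (hp t)),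
    lintegral_negLog_eval hQ0 hW (fun t => (hQn t).trans_le (hq t))]
  gcongr
  rw [logMahlerMeasure_eq_log_MahlerMeasure, logMahlerMeasure_eq_log_MahlerMeasure]
  refine Real.log_le_log (mahlerMeasure_pos_of_ne_zero hQ0) ?_
  have hX : (X : ℂ[X]).mahlerMeasure = 1 := by simpa using mahlerMeasure_X_sub_C 0
  rw [hQdef, mahlerMeasure_mul, mahlerMeasure_mul, mahlerMeasure_const, hX, one_mul, norm_inv]
  have hn : ‖(b : ℂ) - a‖ = b - a := by
    rw [← Int.cast_sub, Complex.norm_intCast]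
    push_cast
    exact abs_of_pos hab'
  rw [hn, inv_mul_le_iff₀ hab']
  refine (mahlerMeasure_derivative_le P).trans ?_
  have hdeg : (P.natDegree : ℝ) ≤ b - a := by
    have h1 : P.natDegree ≤ (b - a).toNat := by
      refine natDegree_sum_le_of_forall_le _ _ fun i hi => ?_
      refine (natDegree_C_mul_X_pow_le _ _).trans ?_
      have := hb i hi
      omega
    have h2 : (((b - a).toNat : ℤ) : ℝ) = b - a := by
      rw [Int.toNat_of_nonneg (by omega)]; push_cast; ring
    rw [← h2, Int.cast_natCast]
    exact_mod_cast h1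
  exact mul_le_mul_of_nonneg_right hdeg P.mahlerMeasure_nonneg

/-- Complex conjugation negates the frequencies and exchanges the two ends, without changing the
moduli. -/
theorem lintegral_negLog_trigSum_le_sub_right {ι : Type*} (s : Finset ι) (n : ι → ℤ) (c : ι → ℂ)
    {a b : ℤ} (hab : a < b) (ha : ∀ i ∈ s, a ≤ n i) (hb : ∀ i ∈ s, n i ≤ b)
    {W : ℝ} (hW : 0 < W) (hp : ∀ t : ℝ, ‖∑ i ∈ s, c i * cexp (n i * t)‖ ≤ W)
    (hq : ∀ t : ℝ, ‖∑ i ∈ s, c i * ((b - n i) / (b - a)) * cexp (n i * t)‖ ≤ W) :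
    ∫⁻ t in Set.Ioc (0 : ℝ) 1, negLog W (∑ i ∈ s, c i * cexp (n i * t)) ≤
      ∫⁻ t in Set.Ioc (0 : ℝ) 1,
        negLog W (∑ i ∈ s, c i * ((b - n i) / (b - a)) * cexp (n i * t)) := by
  have h1 : ∀ t : ℝ, ‖∑ i ∈ s, conj (c i) * cexp (((-n i : ℤ) : ℝ) * t)‖ =
      ‖∑ i ∈ s, c i * cexp (n i * t)‖ := by
    intro t
    rw [← RCLike.norm_conj, map_sum]
    simp [← cexp_neg]
  have h2 : ∀ t : ℝ, ‖∑ i ∈ s, conj (c i) * ((((-n i : ℤ) : ℂ) - ((-b : ℤ) : ℂ)) /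
      (((-a : ℤ) : ℂ) - ((-b : ℤ) : ℂ))) * cexp (((-n i : ℤ) : ℝ) * t)‖ =
      ‖∑ i ∈ s, c i * ((b - n i) / (b - a)) * cexp (n i * t)‖ := by
    intro t
    rw [← RCLike.norm_conj, map_sum]
    congr 1
    refine Finset.sum_congr rfl fun i _ => ?_
    simp only [map_mul, map_div₀, map_sub, Int.cast_neg, neg_mul, map_neg, cexp_neg,
      Complex.conj_conj, map_intCast]
    ring_nf
  have := lintegral_negLog_trigSum_le_sub_left s (fun i => -n i) (fun i => conj (c i))
    (neg_lt_neg hab) (fun i hi => neg_le_neg (hb i hi)) (fun i hi => neg_le_neg (ha i hi)) hW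
    (fun t => (h1 t).trans_le (hp t)) (fun t => (h2 t).trans_le (hq t))
  simpa only [fun t => negLog_congr (W := W) (h1 t), fun t => negLog_congr (W := W) (h2 t)]
    using this

end TrigSum

/-! ### A Turán inequality in several variables -/

section Turan

variable {ι : Type*} [Fintype ι]

/-- The half-open unit cube. -/
def unitCube (ι : Type*) : Set (ι → ℝ) := {x | ∀ i, x i ∈ Set.Ioc (0 : ℝ) (0 + 1)}

theorem unitCube_eq_pi {ι : Type*} : unitCube ι = Set.univ.pi fun _ => Set.Ioc (0 : ℝ) 1 := by
  ext x; simp [unitCube]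

theorem measurableSet_unitCube : MeasurableSet (unitCube ι) := by
  rw [unitCube_eq_pi]
  exact MeasurableSet.univ_pi fun _ => measurableSet_Ioc

theorem volume_unitCube : volume (unitCube ι) = 1 := by
  rw [unitCube_eq_pi, volume_pi_pi]; simp

theorem volume_restrict_unitCube :
    (volume : Measure (ι → ℝ)).restrict (unitCube ι) =
      Measure.pi fun _ => (volume : Measure ℝ).restrict (Set.Ioc 0 1) := by
  rw [unitCube_eq_pi, volume_pi, Measure.restrict_pi_pi]

/-- The trigonometric polynomial with frequencies in `s` and coefficients `c`. -/
noncomputable def trigPoly (s : Finset (ι → ℤ)) (c : (ι → ℤ) → ℂ) (x : ι → ℝ) : ℂ :=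
  ∑ k ∈ s, c k * cexp (∑ i, k i * x i)

theorem continuous_trigPoly (s : Finset (ι → ℤ)) (c : (ι → ℤ) → ℂ) :
    Continuous (trigPoly s c) := by
  unfold trigPoly
  have := continuous_cexp
  fun_prop

theorem norm_trigPoly_le (s : Finset (ι → ℤ)) (c : (ι → ℤ) → ℂ) (x : ι → ℝ) :
    ‖trigPoly s c x‖ ≤ ∑ k ∈ s, ‖c k‖ :=
  (norm_sum_le _ _).trans (by simp)

theorem trigPoly_update [DecidableEq ι] (s : Finset (ι → ℤ)) (c : (ι → ℤ) → ℂ) (x : ι → ℝ) (j : ι)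
    (t : ℝ) : trigPoly s c (Function.update x j t) =
      ∑ k ∈ s, c k * cexp (∑ i ∈ Finset.univ.erase j, k i * x i) * cexp (k j * t) := by
  unfold trigPoly
  refine Finset.sum_congr rfl fun k _ => ?_
  rw [← Finset.sum_erase_add _ _ (Finset.mem_univ j), cexp_add, Function.update_self, mul_assoc]
  congr 3
  refine Finset.sum_congr rfl fun i hi => ?_
  rw [Function.update_of_ne (Finset.ne_of_mem_erase hi)]

theorem lintegral_unitCube_le_of_update [DecidableEq ι] (j : ι) {f g : (ι → ℝ) → ℝ≥0∞}
    (hf : Measurable f)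
    (hg : Measurable g) (h : ∀ x, ∫⁻ t in Set.Ioc (0 : ℝ) 1, f (Function.update x j t) ≤
      ∫⁻ t in Set.Ioc (0 : ℝ) 1, g (Function.update x j t)) :
    ∫⁻ x in unitCube ι, f x ≤ ∫⁻ x in unitCube ι, g x := by
  rw [volume_restrict_unitCube]
  refine lintegral_le_of_lmarginal_le {j} hf hg ?_
  rw [lmarginal_singleton, lmarginal_singleton]
  exact h

theorem measurable_negLog_trigPoly (W : ℝ) (s : Finset (ι → ℤ)) (c : (ι → ℤ) → ℂ) :
    Measurable fun x => negLog W (trigPoly s c x) :=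
  (measurable_negLog W).comp (continuous_trigPoly s c).measurable

theorem norm_div_sub_le_one {a b n : ℤ} (ha : a ≤ n) (hb : n ≤ b) (hab : a < b) :
    ‖((n : ℂ) - a) / (b - a)‖ = (n - a) / (b - a) ∧
    ‖((b : ℂ) - n) / (b - a)‖ = (b - n) / (b - a) := by
  have h : ∀ m n : ℤ, m ≤ n → ‖(n : ℂ) - m‖ = n - m := by
    intro m n hmn
    rw [← Int.cast_sub, Complex.norm_intCast]
    push_cast
    rw [abs_of_nonneg]
    exact sub_nonneg.mpr (by exact_mod_cast hmn)
  rw [norm_div, norm_div, h a n ha, h n b hb, h a b hab.le]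
  exact ⟨rfl, rfl⟩

/-- A function on finite sets of frequencies which decreases strictly when a slice is removed. -/
def IsSliceRank {ι : Type*} (r : Finset (ι → ℤ) → ℕ) : Prop :=
  ∀ (s : Finset (ι → ℤ)) (j : ι) (a : ℤ), (∃ k ∈ s, k j = a) → (∃ k ∈ s, k j ≠ a) →
    r (s.filter fun k => k j ≠ a) < r s

/-- If the frequencies differ in coordinate j, with extremes a < b, the weights (k j - a)/(b - a)
and (b - k j)/(b - a) add up to 1, so one of them keeps half of Σ‖c k‖. Applying it removes a slice,
lowers the rank and does not decrease the integral; each step costs a factor 2. A single frequency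
has constant modulus. -/
theorem lintegral_negLog_trigPoly_le [DecidableEq ι] {r : Finset (ι → ℤ) → ℕ} (hr : IsSliceRank r)
    {W : ℝ} (hW : 0 < W) (N : ℕ) (s : Finset (ι → ℤ)) (c : (ι → ℤ) → ℂ) (hN : r s ≤ N)
    (hpos : 0 < ∑ k ∈ s, ‖c k‖) (hle : ∑ k ∈ s, ‖c k‖ ≤ W) :
    ∫⁻ x in unitCube ι, negLog W (trigPoly s c x) ≤
      ENNReal.ofReal (Real.log (W * 2 ^ N / ∑ k ∈ s, ‖c k‖)) := by
  induction N generalizing s c with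
  | zero | succ M ih => ?_
  all_goals
    by_cases hconst : ∀ j, ∀ k ∈ s, ∀ k' ∈ s, k j = k' j
    · obtain ⟨k, hk⟩ : s.Nonempty := by
        rw [Finset.nonempty_iff_ne_empty]; rintro rfl; simp at hpos
      have hs : s = {k} := by
        ext k'
        rw [Finset.mem_singleton]
        exact ⟨fun h => funext fun j => hconst j k' h k hk, fun h => h ▸ hk⟩
      subst hs
      have h1 : ∀ x, negLog W (trigPoly {k} c x) = ENNReal.ofReal (Real.log (W / ‖c k‖)) := by
        intro x
        have hck : c k ≠ 0 := by
          rintro h; simp [h] at hpos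
        rw [negLog_congr (w := c k) (by simp [trigPoly]), negLog, if_neg hck]
      simp only [h1, lintegral_const, Measure.restrict_apply MeasurableSet.univ, Set.univ_inter,
        volume_unitCube, mul_one, Finset.sum_singleton]
      rw [Finset.sum_singleton] at hpos
      gcongr
      exact le_mul_of_one_le_right hW.le (one_le_pow₀ one_le_two)
    · push Not at hconst
      obtain ⟨j, k₁, hk₁, k₂, hk₂, hne⟩ := hconst
      have hlt : ∀ a, (∃ k ∈ s, k j = a) → r (s.filter fun k => k j ≠ a) < r s := by
        intro a ha
        refine hr s j a ha ?_
        by_contra! hall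
        exact hne ((hall k₁ hk₁).trans (hall k₂ hk₂).symm)
      -- In the base case the rank is 0 and cannot drop, so the frequencies do not differ; the other
      -- alternative is the induction step.
      first
      | exact absurd ((hlt _ ⟨k₁, hk₁, rfl⟩).trans_le hN) (Nat.not_lt_zero _)
      | have himg : (s.image fun k => k j).Nonempty := ⟨_, Finset.mem_image_of_mem _ hk₁⟩
        set a := (s.image fun k => k j).min' himg with ha_def
        set b := (s.image fun k => k j).max' himg with hb_def
        have ha : ∀ k ∈ s, a ≤ k j := fun k hk =>
          Finset.min'_le _ _ (Finset.mem_image_of_mem (fun k : ι → ℤ => k j) hk)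
        have hb : ∀ k ∈ s, k j ≤ b := fun k hk =>
          Finset.le_max' _ _ (Finset.mem_image_of_mem (fun k : ι → ℤ => k j) hk)
        have hab : a < b := by
          have := ha k₁ hk₁; have := ha k₂ hk₂; have := hb k₁ hk₁; have := hb k₂ hk₂
          omega
        have hab' : (0 : ℝ) < b - a := by exact_mod_cast sub_pos.mpr hab
        have ha_mem : ∃ k ∈ s, k j = a := by
          simpa using Finset.min'_mem _ himg
        have hb_mem : ∃ k ∈ s, k j = b := by
          simpa using Finset.max'_mem _ himg
        -- Common end of the two cases: `w` is the chosen weight and `e` the extreme value where it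
        -- vanishes.
        have finish : ∀ (e : ℤ) (w : (ι → ℤ) → ℂ), (∃ k ∈ s, k j = e) →
            (∀ k ∈ s, ‖w k‖ ≤ 1) → (∀ k, k j = e → w k = 0) →
            ∑ k ∈ s, ‖c k‖ ≤ 2 * ∑ k ∈ s, ‖c k * w k‖ →
            (∀ x : ι → ℝ, ∫⁻ t in Set.Ioc (0 : ℝ) 1,
              negLog W (trigPoly s c (Function.update x j t)) ≤
              ∫⁻ t in Set.Ioc (0 : ℝ) 1, negLog W (trigPoly s (fun k => c k * w k)
                (Function.update x j t))) →
            ∫⁻ x in unitCube ι, negLog W (trigPoly s c x) ≤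
              ENNReal.ofReal (Real.log (W * 2 ^ (M + 1) / ∑ k ∈ s, ‖c k‖)) := by
          intro e w he hw1 hw0 hsum hint
          refine (lintegral_unitCube_le_of_update j (measurable_negLog_trigPoly _ _ _)
            (measurable_negLog_trigPoly _ _ _) hint).trans ?_
          have h1 : ∀ x, trigPoly s (fun k => c k * w k) x =
              trigPoly (s.filter fun k => k j ≠ e) (fun k => c k * w k) x := by
            intro x
            unfold trigPoly
            rw [Finset.sum_filter]
            refine Finset.sum_congr rfl fun k _ => ?_
            split_ifs with h
            · rfl
            · simp [hw0 k (not_not.mp h)]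
          have h2 : ∑ k ∈ s.filter (fun k => k j ≠ e), ‖c k * w k‖ = ∑ k ∈ s, ‖c k * w k‖ := by
            rw [Finset.sum_filter]
            refine Finset.sum_congr rfl fun k _ => ?_
            split_ifs with h
            · rfl
            · simp [hw0 k (not_not.mp h)]
          have h3 : ∑ k ∈ s, ‖c k * w k‖ ≤ ∑ k ∈ s, ‖c k‖ := by
            refine Finset.sum_le_sum fun k hk => ?_
            rw [norm_mul]
            exact mul_le_of_le_one_right (norm_nonneg _) (hw1 k hk)
          have h4 : 0 < ∑ k ∈ s, ‖c k * w k‖ := by linarith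
          simp_rw [h1]
          refine (ih (s.filter fun k => k j ≠ e) (fun k => c k * w k)
            (Nat.lt_succ_iff.mp ((hlt e he).trans_le hN)) (by rwa [h2])
            (by rw [h2]; exact h3.trans hle)).trans ?_
          rw [h2]
          refine ENNReal.ofReal_le_ofReal (Real.log_le_log (by positivity) ?_)
          rw [div_le_div_iff₀ h4 hpos, pow_succ]
          have : 0 ≤ W * 2 ^ M := by positivity
          nlinarith
        have hcoef : ∑ k ∈ s, ‖c k‖ = ∑ k ∈ s, ‖c k * (((k j : ℂ) - a) / (b - a))‖ +
            ∑ k ∈ s, ‖c k * (((b : ℂ) - k j) / (b - a))‖ := by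
          rw [← Finset.sum_add_distrib]
          refine Finset.sum_congr rfl fun k hk => ?_
          obtain ⟨e1, e2⟩ := norm_div_sub_le_one (ha k hk) (hb k hk) hab
          rw [norm_mul, norm_mul, e1, e2]
          field_simp
          ring
        have hbound : ∀ (w : (ι → ℤ) → ℂ), (∀ k ∈ s, ‖w k‖ ≤ 1) → ∀ x,
            ‖trigPoly s (fun k => c k * w k) x‖ ≤ W := by
          intro w hw x
          refine ((norm_trigPoly_le _ _ _).trans (Finset.sum_le_sum fun k hk => ?_)).trans hle
          rw [norm_mul]
          exact mul_le_of_le_one_right (norm_nonneg _) (hw k hk)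
        have hwl : ∀ k ∈ s, ‖((k j : ℂ) - a) / (b - a)‖ ≤ 1 := by
          intro k hk
          rw [(norm_div_sub_le_one (ha k hk) (hb k hk) hab).1, div_le_one hab']
          have : (k j : ℝ) ≤ b := by exact_mod_cast hb k hk
          linarith
        have hwr : ∀ k ∈ s, ‖((b : ℂ) - k j) / (b - a)‖ ≤ 1 := by
          intro k hk
          rw [(norm_div_sub_le_one (ha k hk) (hb k hk) hab).2, div_le_one hab']
          have : (a : ℝ) ≤ k j := by exact_mod_cast ha k hk
          linarith
        have hp0 : ∀ x, ‖trigPoly s c x‖ ≤ W := fun x => (norm_trigPoly_le _ _ _).trans hle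
        rcases le_total (∑ k ∈ s, ‖c k * (((b : ℂ) - k j) / (b - a))‖)
          (∑ k ∈ s, ‖c k * (((k j : ℂ) - a) / (b - a))‖) with hcase | hcase
        · refine finish a (fun k => ((k j : ℂ) - a) / (b - a)) ha_mem hwl
            (fun k hk => by simp [hk]) (by linarith) fun x => ?_
          have hp' := fun t => hp0 (Function.update x j t)
          have hq' := fun t => hbound _ hwl (Function.update x j t)
          simp only [trigPoly_update] at hp' hq' ⊢
          simp only [mul_right_comm (c _) (_ / _) (cexp _)] at hq' ⊢
          exact lintegral_negLog_trigSum_le_sub_left s (fun k => k j) _ hab ha hb hW hp' hq'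
        · refine finish b (fun k => ((b : ℂ) - k j) / (b - a)) hb_mem hwr
            (fun k hk => by simp [hk]) (by linarith) fun x => ?_
          have hp' := fun t => hp0 (Function.update x j t)
          have hq' := fun t => hbound _ hwr (Function.update x j t)
          simp only [trigPoly_update] at hp' hq' ⊢
          simp only [mul_right_comm (c _) (_ / _) (cexp _)] at hq' ⊢
          exact lintegral_negLog_trigSum_le_sub_right s (fun k => k j) _ hab ha hb hW hp' hq'

/-- A **Turán-type inequality** on sets of measure at least `1 / 4`. -/
theorem sum_norm_le_of_norm_trigPoly_le {r : Finset (ι → ℤ) → ℕ} (hr : IsSliceRank r)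
    (s : Finset (ι → ℤ)) (c : (ι → ℤ) → ℂ) {E : Set (ι → ℝ)} (hE : MeasurableSet E)
    (hEc : E ⊆ unitCube ι) (hvol : 1 / 4 ≤ volume E) {M : ℝ} (hM : 0 < M)
    (h : ∀ x ∈ E, ‖trigPoly s c x‖ ≤ M) : ∑ k ∈ s, ‖c k‖ ≤ 16 ^ r s * M := by
  classical
  set σ := ∑ k ∈ s, ‖c k‖ with hσ
  by_contra! hcon
  have h16 : (1 : ℝ) ≤ 16 ^ r s := one_le_pow₀ (by norm_num)
  have hMσ : M < σ := by nlinarith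
  have hσ0 : 0 < σ := hM.trans hMσ
  have h1 := lintegral_negLog_trigPoly_le hr hσ0 (r s) s c le_rfl hσ0 le_rfl
  rw [← hσ, mul_div_cancel_left₀ _ hσ0.ne', Real.log_pow] at h1
  -- On E the integrand is at least log(σ/M). As E has measure at least 1/4, the bound r log 2
  -- becomes 4r log 2, whence 16 = 2^4.
  have h2 : ENNReal.ofReal (Real.log (σ / M)) * volume E ≤
      ∫⁻ x in unitCube ι, negLog σ (trigPoly s c x) := by
    calc _ = ∫⁻ x in E, ENNReal.ofReal (Real.log (σ / M)) := by simp
      _ ≤ ∫⁻ x in E, negLog σ (trigPoly s c x) := by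
        refine setLIntegral_mono' hE fun x hx => ?_
        unfold negLog
        split_ifs with h0
        · exact le_top
        · have := h x hx
          have h00 := norm_pos_iff.mpr h0
          gcongr
      _ ≤ _ := lintegral_mono_set hEc
  have h3 : ENNReal.ofReal (Real.log (σ / M)) * (1 / 4) ≤ ENNReal.ofReal (r s * Real.log 2) :=
    (by gcongr : _ ≤ ENNReal.ofReal (Real.log (σ / M)) * volume E).trans (h2.trans h1)
  have h4 : (1 / 4 : ℝ≥0∞) = ENNReal.ofReal (1 / 4) := by
    rw [ENNReal.ofReal_div_of_pos (by norm_num)]; simp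
  have hlog : 0 ≤ Real.log 2 := Real.log_nonneg one_le_two
  rw [h4, ← ENNReal.ofReal_mul' (by norm_num), ENNReal.ofReal_le_ofReal_iff (by positivity)] at h3
  have h5 : Real.log (σ / M) ≤ Real.log (16 ^ r s) := by
    rw [Real.log_pow, show (16 : ℝ) = 2 ^ 4 by norm_num, Real.log_pow]
    push_cast
    linarith
  rw [Real.log_le_log_iff (by positivity) (by positivity), div_le_iff₀ hM] at h5
  linarith

/-- Some frequency remains, so the truncated subtraction does not hide the loss. This rank leads to
the exponent |S||T|. -/
theorem isSliceRank_card_sub_one {ι : Type*} : IsSliceRank fun s : Finset (ι → ℤ) => s.card - 1 := by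
  rintro s j a ⟨k, hk, hka⟩ ⟨k', hk', hka'⟩
  have h1 : (s.filter fun k => k j ≠ a).card < s.card :=
    Finset.card_lt_card (Finset.filter_ssubset.mpr ⟨k, hk, by simpa using hka⟩)
  have h2 : 0 < (s.filter fun k => k j ≠ a).card :=
    Finset.card_pos.mpr ⟨k', by simp [hk', hka']⟩
  simp only
  omega

/-- The slice takes the value `a` away from coordinate j and adds nothing to the others. This rank
sees only the coordinate projections of the frequencies, and is the origin of the mean width. -/
theorem isSliceRank_sum_card_image_sub_one :
    IsSliceRank fun s : Finset (ι → ℤ) => ∑ j, ((s.image fun k => k j).card - 1) := by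
  rintro s j a ⟨k, hk, hka⟩ ⟨k', hk', hka'⟩
  refine Finset.sum_lt_sum (fun i _ => ?_) ⟨j, Finset.mem_univ j, ?_⟩
  · exact Nat.sub_le_sub_right
      (Finset.card_le_card (Finset.image_subset_image (Finset.filter_subset _ _))) 1
  · have h1 : ((s.filter fun k => k j ≠ a).image fun k => k j).card <
        (s.image fun k => k j).card := by
      refine Finset.card_lt_card ((Finset.ssubset_iff_of_subset
        (Finset.image_subset_image (Finset.filter_subset _ _))).mpr ⟨a, ?_, ?_⟩)
      · exact Finset.mem_image.mpr ⟨k, hk, hka⟩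
      · simp
    have h2 : 0 < ((s.filter fun k => k j ≠ a).image fun k => k j).card :=
      Finset.card_pos.mpr ⟨k' j, Finset.mem_image.mpr ⟨k', by simp [hk', hka'], rfl⟩⟩
    omega

end Turan

/-! ### Periodization and Parseval on the unit cube -/

section Periodization

/-- The integer vector `m`, as a real vector. -/
def intVec {ι : Type*} (m : ι → ℤ) : ι → ℝ := fun i => m i

variable {ι : Type*} [Fintype ι]

theorem tsum_sq_fourierCoeff_unitCube {G : (ι → ℝ) → ℂ}
    (hG : MemLp G 2 (volume.restrict (unitCube ι))) :
    ∑' k : ι → ℤ, ‖∫ x in unitCube ι, cexp (-∑ i, k i * x i) * G x‖ₑ ^ 2 =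
      ∫⁻ x in unitCube ι, ‖G x‖ₑ ^ 2 := by
  let : MeasureSpace UnitAddCircle := ⟨AddCircle.haarAddCircle⟩
  set e := UnitAddTorus.measurableEquivPiIoc (fun _ : ι => (0 : ℝ)) with he
  have hmp : MeasurePreserving (fun θ => (e θ).1) (volume : Measure (UnitAddTorus ι))
      (volume.restrict (unitCube ι)) :=
    (measurePreserving_subtype_coe measurableSet_unitCube).comp
      (UnitAddTorus.measurePreserving_equivPiIoc _)
  have hF := hG.comp_measurePreserving hmp
  set F : UnitAddTorus ι → ℂ := G ∘ fun θ => (e θ).1 with hFdef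
  have hFx : ∀ x ∈ unitCube ι, F (fun i => (x i : UnitAddCircle)) = G x := by
    intro x hx
    have : e (e.symm ⟨x, hx⟩) = ⟨x, hx⟩ := e.apply_symm_apply _
    rw [hFdef, Function.comp_apply]
    change G (e (e.symm ⟨x, hx⟩)).1 = _
    rw [this]
  have hcoef : ∀ k : ι → ℤ, UnitAddTorus.mFourierCoeff (hF.toLp F) k =
      ∫ x in unitCube ι, cexp (-∑ i, k i * x i) * G x := by
    intro k
    have h1 : UnitAddTorus.mFourierCoeff (hF.toLp F) k = UnitAddTorus.mFourierCoeff F k :=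
      integral_congr_ae (by
        filter_upwards [hF.coeFn_toLp] with θ hθ
        rw [hθ])
    rw [h1, UnitAddTorus.mFourierCoeff_eq_integral _ _ (fun _ => 0)]
    refine setIntegral_congr_fun measurableSet_unitCube fun x hx => ?_
    rw [hFx x hx, smul_eq_mul]
    congr 1
    simp only [UnitAddTorus.mFourier, ContinuousMap.coe_mk, cexp, fourier_coe_apply]
    rw [← Complex.exp_sum]
    congr 1
    push_cast
    rw [← Finset.sum_neg_distrib, Finset.mul_sum]
    refine Finset.sum_congr rfl fun i _ => ?_
    simp
    ring
  have hsum := UnitAddTorus.hasSum_sq_mFourierCoeff (hF.toLp F)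
  have hint : ∫⁻ x in unitCube ι, ‖G x‖ₑ ^ 2 = ENNReal.ofReal (∫ θ, ‖hF.toLp F θ‖ ^ 2) := by
    have h1 : Integrable (fun θ => ‖hF.toLp F θ‖ ^ 2) (volume : Measure (UnitAddTorus ι)) :=
      (Lp.memLp (hF.toLp F)).integrable_norm_pow (by norm_num)
    rw [ofReal_integral_eq_lintegral_ofReal h1 (ae_of_all _ fun _ => by positivity)]
    have h2 : ∫⁻ x in unitCube ι, ‖G x‖ₑ ^ 2 = ∫⁻ θ : UnitAddTorus ι, ‖F θ‖ₑ ^ 2 := by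
      rw [UnitAddTorus.lintegral_preimage _ (fun _ => 0)]
      refine setLIntegral_congr_fun measurableSet_unitCube fun x hx => ?_
      rw [hFx x hx]
    rw [h2]
    refine lintegral_congr_ae ?_
    filter_upwards [hF.coeFn_toLp] with θ hθ
    rw [hθ, ENNReal.ofReal_pow (norm_nonneg _), ofReal_norm]
  rw [hint, ← hsum.tsum_eq, ENNReal.ofReal_tsum_of_nonneg (fun _ => by positivity) hsum.summable]
  refine tsum_congr fun k => ?_
  rw [hcoef, ENNReal.ofReal_pow (norm_nonneg _), ofReal_norm]

theorem iUnion_preimage_unitCube {ι : Type*} :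
    ⋃ m : ι → ℤ, (fun x => x + -intVec m) ⁻¹' unitCube ι = Set.univ := by
  refine Set.eq_univ_of_forall fun x => Set.mem_iUnion.mpr ⟨fun i => ⌈x i⌉ - 1, fun i => ?_⟩
  have h1 := Int.le_ceil (x i)
  have h2 := Int.ceil_lt_add_one (x i)
  simp only [Pi.add_apply, Pi.neg_apply, intVec, Int.cast_sub, Int.cast_one, Set.mem_Ioc]
  constructor <;> linarith

theorem pairwise_disjoint_preimage_unitCube {ι : Type*} :
    Pairwise (Function.onFun Disjoint
      fun m : ι → ℤ => (fun x => x + -intVec m) ⁻¹' unitCube ι) := by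
  intro m n hmn
  refine Set.disjoint_left.mpr fun x hm hn => hmn (funext fun i => ?_)
  have h1 := hm i
  have h2 := hn i
  simp only [Pi.add_apply, Pi.neg_apply, intVec, Set.mem_Ioc] at h1 h2
  have h3 : (m i : ℝ) < n i + 1 := by linarith
  have h4 : (n i : ℝ) < m i + 1 := by linarith
  norm_cast at h3 h4
  omega

theorem measurableSet_preimage_unitCube (m : ι → ℤ) :
    MeasurableSet ((fun x => x + -intVec m) ⁻¹' unitCube ι) :=
  (measurable_add_const _) measurableSet_unitCube

theorem lintegral_eq_tsum_unitCube (h : (ι → ℝ) → ℝ≥0∞) :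
    ∫⁻ x, h x = ∑' m : ι → ℤ, ∫⁻ x in unitCube ι, h (x + intVec m) := by
  rw [← setLIntegral_univ, ← iUnion_preimage_unitCube (ι := ι),
    lintegral_iUnion measurableSet_preimage_unitCube pairwise_disjoint_preimage_unitCube]
  refine tsum_congr fun m => ?_
  rw [← (measurePreserving_add_right volume (-intVec m)).setLIntegral_comp_preimage_emb
    (measurableEmbedding_addRight _) (fun x => h (x + intVec m)) (unitCube ι)]
  simp

theorem integral_eq_tsum_unitCube {h : (ι → ℝ) → ℂ} (hi : Integrable h) :
    ∫ x, h x = ∑' m : ι → ℤ, ∫ x in unitCube ι, h (x + intVec m) := by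
  rw [← setIntegral_univ, ← iUnion_preimage_unitCube (ι := ι),
    integral_iUnion measurableSet_preimage_unitCube pairwise_disjoint_preimage_unitCube
      hi.integrableOn]
  refine tsum_congr fun m => ?_
  rw [← (measurePreserving_add_right volume (-intVec m)).setIntegral_preimage_emb
    (measurableEmbedding_addRight _) (fun x => h (x + intVec m)) (unitCube ι)]
  simp

theorem cexp_sum_intVec (k m : ι → ℤ) : cexp (∑ i, k i * intVec m i) = 1 := by
  have : ∑ i, (k i : ℝ) * intVec m i = ((∑ i, k i * m i : ℤ) : ℝ) := by
    push_cast; rfl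
  rw [this, cexp_intCast]

theorem integral_cexp_int_mul (n : ℤ) :
    ∫ t in Set.Ioc (0 : ℝ) 1, cexp (n * t) = if n = 0 then 1 else 0 := by
  rw [← intervalIntegral.integral_of_le zero_le_one]
  split_ifs with h
  · simp [h]
  · have h1 : ∀ t : ℝ, cexp (n * t) = Complex.exp ((2 * Real.pi * Complex.I * n) * t) := by
      intro t; simp only [cexp]; push_cast; ring_nf
    have h2 : (2 * Real.pi * Complex.I * n : ℂ) ≠ 0 := by
      simp [h, Real.pi_ne_zero]
    simp_rw [h1]
    rw [integral_exp_mul_complex h2]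
    have h3 : Complex.exp (2 * Real.pi * Complex.I * n) = 1 := by
      rw [Complex.exp_eq_one_iff]; exact ⟨n, by ring⟩
    simp [h3]

theorem integral_unitCube_cexp (k : ι → ℤ) :
    ∫ x in unitCube ι, cexp (∑ i, k i * x i) = if k = 0 then 1 else 0 := by
  have h1 : ∀ x : ι → ℝ, cexp (∑ i, k i * x i) = ∏ i, cexp (k i * x i) := by
    intro x
    simp only [cexp]
    rw [← Complex.exp_sum]
    push_cast
    rw [Finset.mul_sum]
  simp_rw [h1]
  rw [volume_restrict_unitCube,
    integral_fintype_prod_eq_prod (f := fun i (t : ℝ) => cexp (k i * t))]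
  simp_rw [integral_cexp_int_mul]
  rw [Finset.prod_ite_zero]
  simp [funext_iff]

/-- The Fourier coefficients of the periodization of `g`. -/
noncomputable def latticeCoeff (g : (ι → ℝ) → ℂ) (k : ι → ℤ) : ℂ :=
  ∫ x : ι → ℝ, cexp (-∑ i, k i * x i) * g x

/-- Unfolding: the characters are invariant under integer shifts, and only the translates indexed by
`B` contribute. -/
theorem integral_unitCube_periodization {g : (ι → ℝ) → ℂ} (hg : Integrable g)
    (B : Finset (ι → ℤ)) (hB : ∀ m ∉ B, ∀ x ∈ unitCube ι, g (x + intVec m) = 0) (k : ι → ℤ) :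
    ∫ x in unitCube ι, cexp (-∑ i, k i * x i) * ∑ m ∈ B, g (x + intVec m) = latticeCoeff g k := by
  have hbd : ∀ x : ι → ℝ, ‖cexp (-∑ i, k i * x i)‖ ≤ 1 := fun x => by simp
  have hcont : Continuous fun x : ι → ℝ => cexp (-∑ i, k i * x i) :=
    continuous_cexp.comp (by fun_prop)
  have hint : Integrable fun x : ι → ℝ => cexp (-∑ i, k i * x i) * g x :=
    hg.bdd_mul hcont.aestronglyMeasurable (ae_of_all _ hbd)
  have hshift : ∀ (m : ι → ℤ) (x : ι → ℝ),
      cexp (-∑ i, k i * (x + intVec m) i) = cexp (-∑ i, k i * x i) := by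
    intro m x
    simp only [Pi.add_apply, mul_add, Finset.sum_add_distrib, neg_add]
    rw [cexp_add, cexp_neg (∑ i, (k i : ℝ) * intVec m i), cexp_sum_intVec]
    simp
  rw [latticeCoeff, integral_eq_tsum_unitCube hint, tsum_eq_sum (s := B)]
  · simp_rw [Finset.mul_sum]
    rw [integral_finsetSum]
    · refine Finset.sum_congr rfl fun m _ => ?_
      simp_rw [hshift]
    · intro m _
      have := (hint.comp_add_right (intVec m)).integrableOn (s := unitCube ι)
      simp only [hshift] at this
      exact this
  · intro m hm
    rw [setIntegral_congr_fun (g := fun _ => (0 : ℂ)) measurableSet_unitCube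
      fun x hx => by simp [hB m hm x hx]]
    simp

/-- The value at `0` of the Fourier transform of a function with a small support is controlled by
the values at the other lattice points, except for finitely many of them. -/
theorem norm_latticeCoeff_zero_le {r : Finset (ι → ℤ) → ℕ} (hr : IsSliceRank r)
    {g : (ι → ℝ) → ℂ} (hgm : Measurable g) (hg1 : Integrable g) (hg2 : MemLp g 2)
    {K : Set (ι → ℝ)} (hK : MeasurableSet K) (hKv : volume K ≤ 1 / 2) (hgK : ∀ x ∉ K, g x = 0)
    (B : Finset (ι → ℤ)) (hB : ∀ m ∉ B, ∀ x ∈ unitCube ι, g (x + intVec m) = 0)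
    (s : Finset (ι → ℤ)) (h0 : 0 ∈ s) {M : ℝ} (hM : 0 < M)
    (hsum : ∑' k, (if k ∈ s then 0 else ‖latticeCoeff g k‖ₑ ^ 2) ≤ ENNReal.ofReal (M ^ 2)) :
    ‖latticeCoeff g 0‖ ≤ 16 ^ r s * (2 * M) := by
  set G : (ι → ℝ) → ℂ := fun x => ∑ m ∈ B, g (x + intVec m) with hG
  set p := trigPoly s (latticeCoeff g) with hp
  have hGm : Measurable G := by
    refine Finset.measurable_sum _ fun m _ => hgm.comp (measurable_add_const _)
  have hpm : Measurable p := (continuous_trigPoly _ _).measurable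
  have hG2 : MemLp G 2 (volume.restrict (unitCube ι)) := by
    refine memLp_finsetSum _ fun m _ => ?_
    exact (hg2.comp_measurePreserving (measurePreserving_add_right volume (intVec m))).restrict _
  have hfin : IsFiniteMeasure ((volume : Measure (ι → ℝ)).restrict (unitCube ι)) :=
    ⟨by simp [volume_unitCube]⟩
  have hp2 : MemLp p 2 (volume.restrict (unitCube ι)) :=
    MemLp.of_bound hpm.aestronglyMeasurable _ (ae_of_all _ fun x => norm_trigPoly_le _ _ x)
  have hpars := tsum_sq_fourierCoeff_unitCube (hG2.sub hp2)
  have hcoef : ∀ k : ι → ℤ, ∫ x in unitCube ι, cexp (-∑ i, k i * x i) * (G - p) x =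
      if k ∈ s then 0 else latticeCoeff g k := by
    intro k
    have hcont : Continuous fun x : ι → ℝ => cexp (-∑ i, k i * x i) :=
      continuous_cexp.comp (by fun_prop)
    have hbd : ∀ x : ι → ℝ, ‖cexp (-∑ i, k i * x i)‖ ≤ 1 := fun x => by simp
    have i1 := (hG2.integrable one_le_two).bdd_mul hcont.aestronglyMeasurable (ae_of_all _ hbd)
    have i2 := (hp2.integrable one_le_two).bdd_mul hcont.aestronglyMeasurable (ae_of_all _ hbd)
    simp only [Pi.sub_apply, mul_sub]
    rw [integral_sub i1 i2, hG, integral_unitCube_periodization hg1 B hB]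
    have h1 : ∫ x in unitCube ι, cexp (-∑ i, k i * x i) * p x =
        ∑ l ∈ s, latticeCoeff g l * (if l - k = 0 then 1 else 0) := by
      simp only [hp, trigPoly, Finset.mul_sum]
      rw [integral_finsetSum]
      · refine Finset.sum_congr rfl fun l _ => ?_
        rw [← integral_unitCube_cexp, ← integral_const_mul]
        refine integral_congr_ae (ae_of_all _ fun x => ?_)
        have h2 : ∑ i, ((l - k) i : ℝ) * x i = -∑ i, k i * x i + ∑ i, l i * x i := by
          simp only [Pi.sub_apply, Int.cast_sub, sub_mul, Finset.sum_sub_distrib]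
          ring
        simp only [h2, cexp_add]
        ring
      · intro l _
        refine Integrable.bdd_mul (c := 1) ?_ hcont.aestronglyMeasurable (ae_of_all _ hbd)
        refine Integrable.const_mul ?_ _
        refine Integrable.of_bound (C := 1) ?_ (ae_of_all _ fun x => by simp)
        exact (continuous_cexp.comp (by fun_prop)).aestronglyMeasurable
    rw [h1]
    by_cases hk : k ∈ s <;> simp [sub_eq_zero, hk]
  -- Parseval: G - p carries exactly the coefficients outside s.
  have hR : ∫⁻ x in unitCube ι, ‖(G - p) x‖ₑ ^ 2 ≤ ENNReal.ofReal (M ^ 2) := by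
    rw [← hpars]
    refine le_trans (le_of_eq (tsum_congr fun k => ?_)) hsum
    rw [hcoef]
    split_ifs <;> simp
  -- Folding K into the cube does not increase its measure, and G vanishes off Z.
  set Z : Set (ι → ℝ) := {x | ∃ m ∈ B, x + intVec m ∈ K} with hZ
  have hZm : MeasurableSet Z := by
    have : Z = ⋃ m ∈ B, (fun x => x + intVec m) ⁻¹' K := by ext x; simp [hZ]
    rw [this]
    exact Finset.measurableSet_biUnion _ fun m _ => (measurable_add_const _) hK
  have hZv : volume.restrict (unitCube ι) Z ≤ 1 / 2 := by
    refine le_trans ?_ hKv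
    have h1 := lintegral_eq_tsum_unitCube (K.indicator (1 : (ι → ℝ) → ℝ≥0∞))
    rw [lintegral_indicator_one hK] at h1
    rw [h1, ← lintegral_indicator_one hZm]
    refine le_trans ?_ (ENNReal.sum_le_tsum B)
    rw [← lintegral_finsetSum]
    · refine lintegral_mono fun x => ?_
      by_cases hx : x ∈ Z
      · obtain ⟨m, hm, hmK⟩ := hx
        refine le_trans ?_ (Finset.single_le_sum (fun _ _ => zero_le) hm)
        rw [Set.indicator_of_mem hmK]
        exact Set.indicator_le_self _ _ _
      · rw [Set.indicator_of_notMem hx]; exact zero_le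
    · intro m _
      exact (measurable_one.indicator hK).comp (measurable_add_const _)
  -- The threshold 2M makes the Chebyshev bound M² / (2M)² = 1/4, which leaves 1 - 1/2 - 1/4 of the
  -- cube.
  set Y : Set (ι → ℝ) := {x | 2 * M ≤ ‖(G - p) x‖} with hY
  have hYm : MeasurableSet Y := measurableSet_le measurable_const (hGm.sub hpm).norm
  have hYv : volume.restrict (unitCube ι) Y ≤ 1 / 4 := by
    have h1 := mul_meas_ge_le_lintegral (μ := volume.restrict (unitCube ι))
      (f := fun x => ‖(G - p) x‖ₑ ^ 2) ((hGm.sub hpm).enorm.pow_const 2)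
      (ENNReal.ofReal ((2 * M) ^ 2))
    have h2 : Y ⊆ {x | ENNReal.ofReal ((2 * M) ^ 2) ≤ ‖(G - p) x‖ₑ ^ 2} := by
      intro x hx
      rw [Set.mem_ofPred_eq, ← ofReal_norm, ← ENNReal.ofReal_pow (norm_nonneg _)]
      have hx' : 2 * M ≤ ‖(G - p) x‖ := hx
      gcongr
    have h3 : ENNReal.ofReal ((2 * M) ^ 2) * volume.restrict (unitCube ι) Y ≤
        ENNReal.ofReal ((2 * M) ^ 2) * (1 / 4) := by
      refine ((mul_le_mul_right (measure_mono h2) _).trans (h1.trans hR)).trans (le_of_eq ?_)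
      rw [show (1 / 4 : ℝ≥0∞) = ENNReal.ofReal (1 / 4) by
        rw [ENNReal.ofReal_div_of_pos (by norm_num)]; simp, ← ENNReal.ofReal_mul (by positivity)]
      congr 1
      ring
    rwa [ENNReal.mul_le_mul_iff_right (by simpa using hM.ne') ENNReal.ofReal_ne_top] at h3
  have hEv : 1 / 4 ≤ volume (unitCube ι \ (Z ∪ Y)) := by
    have h1 : (1 : ℝ≥0∞) ≤ volume (unitCube ι \ (Z ∪ Y)) + (1 / 2 + 1 / 4) := by
      calc (1 : ℝ≥0∞) = volume (unitCube ι) := volume_unitCube.symm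
        _ ≤ volume (unitCube ι \ (Z ∪ Y)) + volume ((Z ∪ Y) ∩ unitCube ι) := by
          refine (measure_mono ?_).trans (measure_union_le _ _)
          intro x hx
          by_cases h : x ∈ Z ∪ Y
          · exact Or.inr ⟨h, hx⟩
          · exact Or.inl ⟨hx, h⟩
        _ ≤ _ := by
          gcongr
          rw [← Measure.restrict_apply (hZm.union hYm)]
          exact (measure_union_le _ _).trans (add_le_add hZv hYv)
    have h2 : (1 / 2 + 1 / 4 : ℝ≥0∞) = ENNReal.ofReal (3 / 4) := by
      rw [show (1 / 4 : ℝ≥0∞) = ENNReal.ofReal (1 / 4) by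
        rw [ENNReal.ofReal_div_of_pos (by norm_num)]; simp,
        show (1 / 2 : ℝ≥0∞) = ENNReal.ofReal (1 / 2) by
        rw [ENNReal.ofReal_div_of_pos (by norm_num)]; simp,
        ← ENNReal.ofReal_add (by norm_num) (by norm_num)]
      norm_num
    rw [h2] at h1
    have h3 := tsub_le_iff_right.mpr h1
    rw [← ENNReal.ofReal_one, ← ENNReal.ofReal_sub _ (by norm_num)] at h3
    refine le_trans (le_of_eq ?_) h3
    norm_num [ENNReal.ofReal_div_of_pos]
  refine le_trans ?_ (sum_norm_le_of_norm_trigPoly_le hr s (latticeCoeff g)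
    (measurableSet_unitCube.diff (hZm.union hYm)) Set.sdiff_subset hEv (by positivity)
    (M := 2 * M) ?_)
  · exact Finset.single_le_sum (f := fun k => ‖latticeCoeff g k‖)
      (fun _ _ => norm_nonneg _) h0
  · rintro x ⟨-, hx⟩
    rw [Set.mem_union, not_or] at hx
    have h1 : G x = 0 := Finset.sum_eq_zero fun m hm => hgK _ fun h => hx.1 ⟨m, hm, h⟩
    have h2 : ‖(G - p) x‖ < 2 * M := not_le.mp fun h => hx.2 h
    rw [Pi.sub_apply, h1, zero_sub, norm_neg] at h2
    exact h2.le

end Periodization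

/-! ### Haar measure and the action of rotations -/

section Rotations

variable {d : ℕ}

/-- The space `ℝ^d`. -/
abbrev Space (d : ℕ) : Type := EuclideanSpace ℝ (Fin d)

instance secondCountable_SO (d : ℕ) : SecondCountableTopology (SO d) :=
  haveI : SecondCountableTopology (Matrix (Fin d) (Fin d) ℝ) :=
    inferInstanceAs (SecondCountableTopology (Fin d → Fin d → ℝ))
  TopologicalSpace.Subtype.secondCountableTopology _

instance isHaarMeasure_haarSO (d : ℕ) : (haarSO d).IsHaarMeasure := by
  unfold haarSO; infer_instance

instance isProbabilityMeasure_haarSO (d : ℕ) : IsProbabilityMeasure (haarSO d) :=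
  ⟨by unfold haarSO; exact Measure.haarMeasure_self⟩

/-- A right translate is again a Haar measure of mass one, hence the same measure by uniqueness. -/
instance isMulRightInvariant_haarSO (d : ℕ) : (haarSO d).IsMulRightInvariant := by
  refine ⟨fun g => ?_⟩
  have : IsProbabilityMeasure (Measure.map (· * g) (haarSO d)) :=
    Measure.isProbabilityMeasure_map (measurable_mul_const g).aemeasurable
  exact Measure.isHaarMeasure_eq_of_isProbabilityMeasure _ _

/-- The action of a rotation matrix on `ℝ^d`. -/
noncomputable def rot (ρ : SO d) : Space d →ₗ[ℝ] Space d :=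
  Matrix.toEuclideanLin (ρ : Matrix (Fin d) (Fin d) ℝ)

theorem rot_mul (ρ σ : SO d) (x : Space d) : rot (ρ * σ) x = rot ρ (rot σ x) := by
  simp [rot]

theorem rot_one (x : Space d) : rot 1 x = x := by
  simp [rot]

theorem inner_rot (ρ : SO d) (x y : Space d) : inner ℝ (rot ρ x) (rot ρ y) = inner ℝ x y := by
  have h : (ρ : Matrix (Fin d) (Fin d) ℝ).transpose * (ρ : Matrix (Fin d) (Fin d) ℝ) = 1 := by
    have := (Matrix.mem_orthogonalGroup_iff' (Fin d) ℝ).mp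
      (Matrix.mem_specialOrthogonalGroup_iff.mp ρ.2).1
    simpa [Matrix.star_eq_conjTranspose] using this
  simp only [rot, Matrix.toLpLin_apply, EuclideanSpace.inner_eq_star_dotProduct, star_trivial]
  rw [Matrix.dotProduct_mulVec, ← Matrix.mulVec_transpose, Matrix.mulVec_mulVec, h,
    Matrix.one_mulVec]

/-- The linear isometry given by a rotation matrix. -/
noncomputable def rotIso (ρ : SO d) : Space d ≃ₗᵢ[ℝ] Space d :=
  ((rot ρ).isometryOfInner (inner_rot ρ)).toLinearIsometryEquiv rfl

theorem norm_rot (ρ : SO d) (x : Space d) : ‖rot ρ x‖ = ‖x‖ := (rotIso ρ).norm_map x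

theorem measurePreserving_rot (ρ : SO d) : MeasurePreserving (rot ρ) :=
  (rotIso ρ).measurePreserving

theorem continuous_rot : Continuous fun p : SO d × Space d => rot p.1 p.2 := by
  simp only [rot, Matrix.toLpLin_apply]
  refine (PiLp.continuous_toLp 2 _).comp ?_
  refine Continuous.matrix_mulVec (continuous_subtype_val.comp continuous_fst) ?_
  exact (PiLp.continuous_ofLp 2 _).comp continuous_snd

theorem exists_rot_eq_of_det {f : Space d ≃ₗᵢ[ℝ] Space d}
    (hf : LinearMap.det f.toLinearEquiv.toLinearMap = 1) : ∃ σ : SO d, ∀ x, rot σ x = f x := by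
  set b := EuclideanSpace.basisFun (Fin d) ℝ
  refine ⟨⟨LinearMap.toMatrix b.toBasis b.toBasis f.toLinearEquiv.toLinearMap, ?_⟩, fun x => ?_⟩
  · rw [Matrix.mem_specialOrthogonalGroup_iff]
    exact ⟨f.toMatrix_mem_unitaryGroup b b, by rw [LinearMap.det_toMatrix]; exact hf⟩
  · rw [rot, Matrix.toEuclideanLin_eq_toLin_orthonormal, Matrix.toLin_toMatrix]
    rfl

/-- Rotations act transitively on spheres, up to a sign. -/
theorem exists_rot_eq_or_eq_neg {x y : Space d} (h : ‖x‖ = ‖y‖) :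
    ∃ σ : SO d, rot σ x = y ∨ rot σ x = -y := by
  by_cases hxy : x + y = 0
  · exact ⟨1, Or.inr (by rw [rot_one]; exact eq_neg_of_add_eq_zero_left hxy)⟩
  have hy : y ≠ 0 := by
    rintro rfl
    rw [norm_zero, norm_eq_zero] at h
    simp [h] at hxy
  have hdet : ∀ u : Space d, u ≠ 0 →
      LinearMap.det (ℝ ∙ u)ᗮ.reflection.toLinearEquiv.toLinearMap = -1 := by
    intro u hu
    have := (ℝ ∙ u)ᗮ.det_reflection
    rw [Submodule.orthogonal_orthogonal, finrank_span_singleton hu, pow_one] at this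
    exact this
  -- The first reflection takes x to -y and the second takes -y to y; two reflections compose to
  -- determinant 1. The sign cannot be avoided when d = 1, where the group is trivial.
  obtain ⟨σ, hσ⟩ := exists_rot_eq_of_det
    (f := (ℝ ∙ (x - -y))ᗮ.reflection.trans (ℝ ∙ y)ᗮ.reflection) (by
      have h1 := LinearMap.det_comp (ℝ ∙ y)ᗮ.reflection.toLinearEquiv.toLinearMap
        (ℝ ∙ (x - -y))ᗮ.reflection.toLinearEquiv.toLinearMap
      rw [hdet y hy, hdet _ (by rwa [sub_neg_eq_add])] at h1
      rw [← show (-1 : ℝ) * -1 = 1 by norm_num, ← h1]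
      rfl)
  refine ⟨σ, Or.inl ?_⟩
  rw [hσ, LinearIsometryEquiv.trans_apply, Submodule.reflection_sub (by rwa [norm_neg]), map_neg,
    Submodule.reflection_orthogonalComplement_singleton_eq_neg, neg_neg]

end Rotations

/-! ### Averages over random dilations and rotations -/

section Averages

theorem lintegral_Ioc_comp_mul {N : ℝ} (hN : 0 < N) {g : ℝ → ℝ≥0∞} (hg : Measurable g) :
    ∫⁻ v in Set.Ioc (1 : ℝ) 2, g (v * N) =
      ENNReal.ofReal N⁻¹ * ∫⁻ r in Set.Ioc N (2 * N), g r := by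
  rw [← lintegral_indicator measurableSet_Ioc, ← lintegral_indicator measurableSet_Ioc]
  have h1 : ∀ v : ℝ, (Set.Ioc (1 : ℝ) 2).indicator (fun v => g (v * N)) v =
      (Set.Ioc N (2 * N)).indicator g (v * N) := by
    intro v
    have : v ∈ Set.Ioc (1 : ℝ) 2 ↔ v * N ∈ Set.Ioc N (2 * N) := by
      simp only [Set.mem_Ioc]
      rw [lt_mul_iff_one_lt_left hN, mul_le_mul_iff_left₀ hN]
    by_cases hv : v ∈ Set.Ioc (1 : ℝ) 2
    · rw [Set.indicator_of_mem hv, Set.indicator_of_mem (this.mp hv)]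
    · rw [Set.indicator_of_notMem hv, Set.indicator_of_notMem (fun h => hv (this.mpr h))]
  simp_rw [h1]
  rw [← lintegral_map (hg.indicator measurableSet_Ioc) (measurable_mul_const N),
    Real.map_volume_mul_right hN.ne', lintegral_smul_measure, abs_of_pos (inv_pos.mpr hN),
    smul_eq_mul]

/-- The i-th term is the mean of g over (N i, 2 N i], where 1 / N i ≤ 2 / r. After exchanging sum
and integral, r is counted at most A r^(n+1) times, and 2 / r lowers the power to n. Below r = 1
nothing is counted. -/
theorem tsum_lintegral_dilation_le {I : Type*} [Countable I] (N : I → ℝ) (hN : ∀ i, 1 ≤ N i)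
    (n : ℕ) (A : ℝ≥0∞)
    (hcount : ∀ r : ℝ, 1 ≤ r → ∑' i, (if N i ≤ r then 1 else 0) ≤ A * ENNReal.ofReal (r ^ (n + 1)))
    {g : ℝ → ℝ≥0∞} (hg : Measurable g) :
    ∑' i, ∫⁻ v in Set.Ioc (1 : ℝ) 2, g (v * N i) ≤
      2 * A * ∫⁻ r in Set.Ioi (0 : ℝ), ENNReal.ofReal (r ^ n) * g r := by
  have h1 : ∀ i, ∫⁻ v in Set.Ioc (1 : ℝ) 2, g (v * N i) ≤
      ∫⁻ r in Set.Ioi (0 : ℝ), (if N i ≤ r then 1 else 0) * (ENNReal.ofReal (2 / r) * g r) := by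
    intro i
    have hpos : 0 < N i := one_pos.trans_le (hN i)
    rw [lintegral_Ioc_comp_mul hpos hg, ← lintegral_const_mul _ hg]
    refine le_trans ?_ (lintegral_mono_set (s := Set.Ioc (N i) (2 * N i))
      fun r hr => hpos.trans hr.1)
    refine setLIntegral_mono' measurableSet_Ioc fun r hr => ?_
    have hr0 : 0 < r := hpos.trans hr.1
    rw [if_pos hr.1.le, one_mul]
    gcongr
    rw [inv_eq_one_div, div_le_div_iff₀ hpos hr0]
    linarith [hr.2]
  refine (ENNReal.tsum_le_tsum h1).trans ?_
  have hgm : Measurable fun r : ℝ => ENNReal.ofReal (r ^ n) * g r :=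
    Measurable.mul (by fun_prop) hg
  rw [← lintegral_tsum, ← lintegral_const_mul _ hgm]
  · refine setLIntegral_mono' measurableSet_Ioi fun r hr => ?_
    rw [ENNReal.tsum_mul_right]
    by_cases hr1 : 1 ≤ r
    · have hr0 : (0 : ℝ) < r := hr
      calc _ ≤ A * ENNReal.ofReal (r ^ (n + 1)) * (ENNReal.ofReal (2 / r) * g r) := by
            gcongr
            exact hcount r hr1
        _ = A * (ENNReal.ofReal (r ^ (n + 1)) * ENNReal.ofReal (2 / r)) * g r := by ring
        _ = A * (2 * ENNReal.ofReal (r ^ n)) * g r := by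
            rw [← ENNReal.ofReal_mul (by positivity),
              show r ^ (n + 1) * (2 / r) = 2 * r ^ n by rw [pow_succ]; field_simp,
              ENNReal.ofReal_mul (by norm_num)]
            simp
        _ = _ := by ring
    · have : ∀ i, ¬ N i ≤ r := fun i h => hr1 ((hN i).trans h)
      simp [this]
  · intro i
    refine (Measurable.mul ?_ (Measurable.mul (by fun_prop) hg)).aemeasurable
    exact Measurable.ite measurableSet_Ici measurable_const measurable_const

theorem tsum_ite_le_card {I : Type*} (p : I → Prop) [DecidablePred p] (s : Finset I)
    (h : ∀ i, p i → i ∈ s) : ∑' i, (if p i then (1 : ℝ≥0∞) else 0) ≤ s.card := by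
  rw [tsum_eq_sum (s := s) fun i hi => if_neg fun hp => hi (h i hp)]
  refine (Finset.sum_le_sum (g := fun _ => (1 : ℝ≥0∞)) fun i _ => ?_).trans (by simp)
  split_ifs <;> simp

theorem card_Icc_floor_le {r : ℝ} (hr : 1 ≤ r) : ((Finset.Icc (-⌊r⌋) ⌊r⌋).card : ℝ) ≤ 3 * r := by
  have h0 : 0 ≤ ⌊r⌋ := Int.floor_nonneg.mpr (by linarith)
  have h1 := Int.floor_le r
  have h2 : ((Finset.Icc (-⌊r⌋) ⌊r⌋).card : ℤ) = 2 * ⌊r⌋ + 1 := by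
    rw [Int.card_Icc, Int.toNat_of_nonneg (by omega)]; ring
  have h3 : ((Finset.Icc (-⌊r⌋) ⌊r⌋).card : ℝ) = 2 * ⌊r⌋ + 1 := by exact_mod_cast h2
  rw [h3]
  linarith

theorem mem_Icc_floor_of_abs_le {m : ℤ} {r : ℝ} (h : |(m : ℝ)| ≤ r) :
    m ∈ Finset.Icc (-⌊r⌋) ⌊r⌋ := by
  rw [abs_le] at h
  rw [Finset.mem_Icc, neg_le, Int.le_floor, Int.le_floor]
  push_cast
  constructor <;> linarith

/-- The average number of nonzero integers in a dilation of a subset of the line. -/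
theorem lintegral_tsum_int_dilation_le {h : ℝ → ℝ≥0∞} (hh : Measurable h) :
    ∫⁻ v in Set.Ioc (1 : ℝ) 2, ∑' m : {m : ℤ // m ≠ 0}, h (v * m.1) ≤ 12 * ∫⁻ r, h r := by
  have hneg : Measurable fun r => h (-r) := hh.comp measurable_neg
  have hg : Measurable fun r => h r + h (-r) := hh.add hneg
  have hm : ∀ m : {m : ℤ // m ≠ 0}, Measurable fun v : ℝ => h (v * m.1) :=
    fun m => hh.comp (measurable_mul_const _)
  rw [lintegral_tsum fun m => (hm m).aemeasurable]
  have h1 : ∀ m : {m : ℤ // m ≠ 0}, ∫⁻ v in Set.Ioc (1 : ℝ) 2, h (v * m.1) ≤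
      ∫⁻ v in Set.Ioc (1 : ℝ) 2, (fun r => h r + h (-r)) (v * |(m.1 : ℝ)|) := by
    intro m
    refine lintegral_mono fun v => ?_
    rcases abs_choice (m.1 : ℝ) with e | e
    · simp only [e]; exact le_self_add
    · simp only [e, mul_neg, neg_neg]; exact le_add_self
  -- 12 = 2 · 3 · 2: the general bound, the count 3r of integers in [-r, r], and the symmetrization
  -- of h.
  refine (ENNReal.tsum_le_tsum h1).trans ((tsum_lintegral_dilation_le _ ?_ 0 3 ?_ hg).trans ?_)
  · intro m
    have := Int.one_le_abs m.2
    exact_mod_cast this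
  · intro r hr
    refine (ENNReal.tsum_comp_le_tsum_of_injective Subtype.val_injective
      fun m : ℤ => if |(m : ℝ)| ≤ r then (1 : ℝ≥0∞) else 0).trans ?_
    refine (tsum_ite_le_card _ (Finset.Icc (-⌊r⌋) ⌊r⌋) fun m => mem_Icc_floor_of_abs_le).trans ?_
    rw [zero_add, pow_one, ← ENNReal.ofReal_natCast]
    refine (ENNReal.ofReal_le_ofReal (card_Icc_floor_le hr)).trans (le_of_eq ?_)
    rw [ENNReal.ofReal_mul (by norm_num)]; simp
  · have h2 : ∫⁻ r in Set.Ioi (0 : ℝ), ENNReal.ofReal (r ^ 0) * (h r + h (-r)) ≤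
        2 * ∫⁻ r, h r := by
      simp only [pow_zero, ENNReal.ofReal_one, one_mul]
      rw [lintegral_add_left hh, two_mul]
      refine add_le_add (setLIntegral_le_lintegral _ _)
        ((setLIntegral_le_lintegral _ _).trans (le_of_eq ?_))
      exact (Measure.measurePreserving_neg volume).lintegral_comp hh
    refine (mul_le_mul_right h2 _).trans (le_of_eq ?_)
    ring

variable {d : ℕ}

/-- The point of the lattice `ℤ^d` with given coordinates. -/
noncomputable def latticePoint (k : Fin d → ℤ) : Space d := WithLp.toLp 2 (intVec k)

theorem abs_le_norm_latticePoint (k : Fin d → ℤ) (i : Fin d) :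
    |(k i : ℝ)| ≤ ‖latticePoint k‖ := by
  have := PiLp.norm_apply_le (latticePoint k) i
  simpa [latticePoint, intVec] using this

theorem one_le_norm_latticePoint {k : Fin d → ℤ} (hk : k ≠ 0) : 1 ≤ ‖latticePoint k‖ := by
  obtain ⟨i, hi⟩ := Function.ne_iff.mp hk
  refine le_trans ?_ (abs_le_norm_latticePoint k i)
  have := Int.one_le_abs hi
  exact_mod_cast this

theorem tsum_norm_latticePoint_le {r : ℝ} (hr : 1 ≤ r) :
    ∑' k : Fin d → ℤ, (if ‖latticePoint k‖ ≤ r then (1 : ℝ≥0∞) else 0) ≤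
      3 ^ d * ENNReal.ofReal (r ^ d) := by
  refine (tsum_ite_le_card _ (Fintype.piFinset fun _ : Fin d => Finset.Icc (-⌊r⌋) ⌊r⌋)
    fun k hk => ?_).trans ?_
  · rw [Fintype.mem_piFinset]
    exact fun i => mem_Icc_floor_of_abs_le ((abs_le_norm_latticePoint k i).trans hk)
  · rw [Fintype.card_piFinset_const, ← ENNReal.ofReal_natCast]
    have h3 : (3 : ℝ≥0∞) ^ d = ENNReal.ofReal (3 ^ d) := by
      rw [ENNReal.ofReal_pow (by norm_num)]; simp
    rw [h3, ← ENNReal.ofReal_mul (by positivity), ← mul_pow]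
    refine ENNReal.ofReal_le_ofReal ?_
    push_cast
    exact pow_le_pow_left₀ (by positivity) (card_Icc_floor_le hr) d

theorem lintegral_fun_norm [NeZero d] {g : ℝ → ℝ≥0∞} (hg : Measurable g) :
    ∫⁻ x : Space d, g ‖x‖ = (volume : Measure (Space d)).toSphere Set.univ *
      ∫⁻ r in Set.Ioi (0 : ℝ), ENNReal.ofReal (r ^ (d - 1)) * g r := by
  have hdim : Module.finrank ℝ (Space d) = d := by simp
  calc ∫⁻ x : Space d, g ‖x‖
      = ∫⁻ x : ({0}ᶜ : Set (Space d)), g ‖x.1‖ ∂(volume.comap Subtype.val) := by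
        rw [lintegral_subtype_comap (measurableSet_singleton _).compl fun x => g ‖x‖,
          restrict_compl_singleton]
    _ = ∫⁻ x, g x.2 ∂(volume : Measure (Space d)).toSphere.prod (.volumeIoiPow (d - 1)) := by
        have := (volume : Measure (Space d)).measurePreserving_homeomorphUnitSphereProd
        rw [hdim] at this
        rw [← this.lintegral_comp_emb (Homeomorph.measurableEmbedding _)]
        simp
    _ = (volume : Measure (Space d)).toSphere Set.univ *
          ∫⁻ x : Set.Ioi (0 : ℝ), g x ∂.volumeIoiPow (d - 1) := by
        rw [lintegral_prod _ (by fun_prop)]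
        simp [mul_comm]
    _ = _ := by
        rw [Measure.volumeIoiPow, lintegral_withDensity_eq_lintegral_mul _ (by fun_prop)
          (by fun_prop)]
        simp only [Pi.mul_apply]
        rw [lintegral_subtype_comap measurableSet_Ioi
          fun r => ENNReal.ofReal (r ^ (d - 1)) * g r]

theorem toSphere_univ_pos [NeZero d] :
    (volume : Measure (Space d)).toSphere Set.univ ≠ 0 := by
  have : Nontrivial (Space d) := by
    have : 0 < Module.finrank ℝ (Space d) := by simpa using NeZero.pos d
    exact Module.nontrivial_of_finrank_pos this
  rw [Ne, Measure.measure_univ_eq_zero]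
  exact Measure.toSphere_ne_zero _

theorem measurable_comp_rot {ψ : Space d → ℝ≥0∞} (hψ : Measurable ψ) (x : Space d) :
    Measurable fun ρ : SO d => ψ (rot ρ x) :=
  hψ.comp (continuous_rot.comp (continuous_id.prodMk continuous_const)).measurable

/-- The rotation average of φ(x) + φ(-x) depends only on ‖x‖; symmetrizing takes care of the sign in
transitivity. What remains is a sum over norms of lattice points, at most (3r)^d of them up to r ≥
1, and polar coordinates return the integral of φ. -/
theorem lintegral_radial_lattice_le [NeZero d] {φ : Space d → ℝ≥0∞} (hφ : Measurable φ) :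
    ∫⁻ ρ, ∫⁻ v in Set.Ioc (1 : ℝ) 2, ∑' k : {k : Fin d → ℤ // k ≠ 0},
        φ (v • rot ρ (latticePoint k.1)) ∂volume ∂(haarSO d) ≤
      4 * 3 ^ d * ((volume : Measure (Space d)).toSphere Set.univ)⁻¹ * ∫⁻ x, φ x := by
  set ψ : Space d → ℝ≥0∞ := fun x => φ x + φ (-x) with hψ
  have hψm : Measurable ψ := hφ.add (hφ.comp measurable_neg)
  have hrotm : Measurable fun p : SO d × Space d => rot p.1 p.2 := continuous_rot.measurable
  set Φ : Space d → ℝ≥0∞ := fun x => ∫⁻ ρ, ψ (rot ρ x) ∂(haarSO d) with hΦ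
  have hΦm : Measurable Φ := (hψm.comp hrotm).lintegral_prod_left'
  have hΦneg : ∀ x, Φ (-x) = Φ x := by
    intro x
    refine lintegral_congr fun ρ => ?_
    simp only [hψ, map_neg, neg_neg]
    exact add_comm _ _
  have hΦrot : ∀ σ x, Φ (rot σ x) = Φ x := by
    intro σ x
    simp only [hΦ, ← rot_mul]
    exact lintegral_mul_right_eq_self (fun ρ => ψ (rot ρ x)) σ
  have hΦnorm : ∀ x y, ‖x‖ = ‖y‖ → Φ x = Φ y := by
    intro x y h
    obtain ⟨σ, h1 | h1⟩ := exists_rot_eq_or_eq_neg h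
    · rw [← hΦrot σ x, h1]
    · rw [← hΦrot σ x, h1, hΦneg]
  set e : Space d := EuclideanSpace.single 0 1 with he
  have hen : ‖e‖ = 1 := by simp [he]
  set g : ℝ → ℝ≥0∞ := fun r => Φ (r • e) with hg
  have hgm : Measurable g := hΦm.comp (by fun_prop)
  have hΦg : ∀ x, Φ x = g ‖x‖ := fun x => hΦnorm _ _ (by rw [norm_smul, hen]; simp)
  have hint : ∫⁻ x, Φ x = 2 * ∫⁻ x, φ x := by
    simp only [hΦ]
    rw [lintegral_lintegral_swap (by
      exact (hψm.comp (hrotm.comp measurable_swap)).aemeasurable)]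
    have : ∀ ρ : SO d, ∫⁻ x, ψ (rot ρ x) = 2 * ∫⁻ x, φ x := by
      intro ρ
      rw [(measurePreserving_rot ρ).lintegral_comp hψm, hψ, lintegral_add_left hφ,
        (Measure.measurePreserving_neg volume).lintegral_comp hφ, two_mul]
    simp [this]
  have hstep : ∫⁻ ρ, ∫⁻ v in Set.Ioc (1 : ℝ) 2, ∑' k : {k : Fin d → ℤ // k ≠ 0},
        φ (v • rot ρ (latticePoint k.1)) ∂volume ∂(haarSO d) ≤
      ∑' k : {k : Fin d → ℤ // k ≠ 0}, ∫⁻ v in Set.Ioc (1 : ℝ) 2, g (v * ‖latticePoint k.1‖) := by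
    have hm : ∀ k : {k : Fin d → ℤ // k ≠ 0}, Measurable fun p : SO d × ℝ =>
        ψ (rot p.1 (p.2 • latticePoint k.1)) := by
      intro k
      have h1 : Measurable fun p : SO d × ℝ => (p.1, p.2 • latticePoint k.1) :=
        measurable_fst.prodMk (measurable_snd.smul_const _)
      have h2 := (hψm.comp hrotm).comp h1
      exact h2
    have hsm : Measurable fun p : SO d × ℝ => ∑' k : {k : Fin d → ℤ // k ≠ 0},
        ψ (rot p.1 (p.2 • latticePoint k.1)) := Measurable.tsum hm
    calc _ ≤ ∫⁻ ρ, ∫⁻ v in Set.Ioc (1 : ℝ) 2, ∑' k : {k : Fin d → ℤ // k ≠ 0},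
        ψ (rot ρ (v • latticePoint k.1)) ∂volume ∂(haarSO d) := by
          gcongr with ρ v k
          rw [map_smul]
          exact le_self_add
      _ = ∫⁻ v in Set.Ioc (1 : ℝ) 2, ∫⁻ ρ, ∑' k : {k : Fin d → ℤ // k ≠ 0},
        ψ (rot ρ (v • latticePoint k.1)) ∂(haarSO d) := by
          exact lintegral_lintegral_swap (f := fun ρ v => ∑' k : {k : Fin d → ℤ // k ≠ 0},
            ψ (rot ρ (v • latticePoint k.1))) hsm.aemeasurable
      _ = ∫⁻ v in Set.Ioc (1 : ℝ) 2, ∑' k : {k : Fin d → ℤ // k ≠ 0},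
          g (v * ‖latticePoint k.1‖) := by
          refine setLIntegral_congr_fun measurableSet_Ioc fun v hv => ?_
          have hmv : ∀ k : {k : Fin d → ℤ // k ≠ 0}, Measurable fun ρ =>
              ψ (rot ρ (v • latticePoint k.1)) := fun k => measurable_comp_rot hψm _
          rw [lintegral_tsum fun k => (hmv k).aemeasurable]
          refine tsum_congr fun k => ?_
          change Φ _ = _
          rw [hΦg, norm_smul, Real.norm_of_nonneg (by linarith [hv.1])]
      _ = _ := lintegral_tsum fun k => (hgm.comp (measurable_mul_const _)).aemeasurable
  refine hstep.trans ?_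
  have hd : d - 1 + 1 = d := Nat.sub_add_cancel (NeZero.pos d)
  refine (tsum_lintegral_dilation_le (fun k : {k : Fin d → ℤ // k ≠ 0} => ‖latticePoint k.1‖)
    (fun k => one_le_norm_latticePoint k.2) (d - 1) (3 ^ d) (fun r hr => ?_) hgm).trans ?_
  · rw [hd]
    exact (ENNReal.tsum_comp_le_tsum_of_injective Subtype.val_injective
      fun k : Fin d → ℤ => if ‖latticePoint k‖ ≤ r then (1 : ℝ≥0∞) else 0).trans
      (tsum_norm_latticePoint_le hr)
  · have h1 := lintegral_fun_norm (d := d) hgm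
    simp_rw [← hΦg] at h1
    have hfin : (volume : Measure (Space d)).toSphere Set.univ ≠ ⊤ := measure_ne_top _ _
    rw [hint] at h1
    have h2 : ∫⁻ r in Set.Ioi (0 : ℝ), ENNReal.ofReal (r ^ (d - 1)) * g r =
        ((volume : Measure (Space d)).toSphere Set.univ)⁻¹ * (2 * ∫⁻ x, φ x) := by
      rw [h1, ← mul_assoc, ENNReal.inv_mul_cancel toSphere_univ_pos hfin, one_mul]
    rw [h2]
    refine le_of_eq ?_
    ring

end Averages

/-! ### Random lattices, projections and mean width -/

section Lattices

variable {d : ℕ}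

/-- The constant in the bound for the average of a function over the points of a random lattice. -/
noncomputable def latticeConst (d : ℕ) : ℝ≥0∞ :=
  4 * 3 ^ d * ((volume : Measure (Space d)).toSphere Set.univ)⁻¹

theorem latticeConst_ne_top [NeZero d] : latticeConst d ≠ ⊤ := by
  unfold latticeConst
  refine ENNReal.mul_ne_top (ENNReal.mul_ne_top (by simp) (by simp)) ?_
  exact ENNReal.inv_ne_top.mpr toSphere_univ_pos

theorem lintegral_comp_smul_space {a : ℝ} (ha : 0 < a) {φ : Space d → ℝ≥0∞} (hφ : Measurable φ) :
    ∫⁻ x, φ (a • x) = ENNReal.ofReal ((a ^ d)⁻¹) * ∫⁻ x, φ x := by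
  rw [← lintegral_map hφ (measurable_const_smul a),
    Measure.map_addHaar_smul volume ha.ne', lintegral_smul_measure]
  simp [abs_of_pos ha]

theorem lintegral_lattice_le [NeZero d] {a : ℝ} (ha : 0 < a) {φ : Space d → ℝ≥0∞}
    (hφ : Measurable φ) :
    ∫⁻ ρ, ∫⁻ v in Set.Ioc (1 : ℝ) 2, ∑' k : {k : Fin d → ℤ // k ≠ 0},
        φ ((a * v) • rot ρ (latticePoint k.1)) ∂volume ∂(haarSO d) ≤
      latticeConst d * ENNReal.ofReal ((a ^ d)⁻¹) * ∫⁻ x, φ x := by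
  have hm : Measurable fun x : Space d => φ (a • x) := hφ.comp (measurable_const_smul a)
  have := lintegral_radial_lattice_le hm
  rw [lintegral_comp_smul_space ha hφ, ← mul_assoc] at this
  simpa only [smul_smul, latticeConst] using this

/-- The coordinates of the points of a set on the axis `ρ(e_j)`. -/
def coordSet (E : Set (Space d)) (ρ : SO d) (j : Fin d) : Set ℝ :=
  (fun x => inner ℝ (rot ρ (EuclideanSpace.single j 1)) x) '' E

/-- It is a continuous image of the compact set SO(d) × E. The measurability in ρ of lengths and
coordinate counts rests on this. -/
theorem isClosed_coordSet {E : Set (Space d)} (hE : IsCompact E) (j : Fin d) :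
    IsClosed {p : SO d × ℝ | p.2 ∈ coordSet E p.1 j} := by
  have h : {p : SO d × ℝ | p.2 ∈ coordSet E p.1 j} =
      (fun q : SO d × Space d => (q.1, inner ℝ (rot q.1 (EuclideanSpace.single j 1)) q.2)) ''
        (Set.univ ×ˢ E) := by
    ext p
    constructor
    · rintro ⟨x, hx, hxp⟩
      exact ⟨(p.1, x), ⟨Set.mem_univ _, hx⟩, Prod.ext rfl hxp⟩
    · rintro ⟨q, ⟨-, hq⟩, rfl⟩
      exact ⟨q.2, hq, rfl⟩
  rw [h]
  refine ((isCompact_univ.prod hE).image ?_).isClosed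
  refine continuous_fst.prodMk (Continuous.inner ?_ continuous_snd)
  exact continuous_rot.comp (continuous_fst.prodMk continuous_const)

theorem volume_coordSet_eq_projLength [NeZero d] (E : Set (Space d)) (j : Fin d) :
    ∃ σ : SO d, ∀ ρ, volume (coordSet E ρ j) = projLength (ρ * σ) E := by
  obtain ⟨σ, hσ⟩ := exists_rot_eq_or_eq_neg
    (x := (EuclideanSpace.single 0 1 : Space d)) (y := EuclideanSpace.single j 1) (by simp)
  refine ⟨σ, fun ρ => ?_⟩
  have hax : axis (ρ * σ) = rot ρ (rot σ (EuclideanSpace.single 0 1)) := rot_mul _ _ _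
  unfold projLength coordSet
  rw [hax]
  rcases hσ with h | h
  · rw [h]
  · rw [h, map_neg]
    simp only [inner_neg_left]
    rw [← Measure.measure_neg]
    congr 1
    rw [← Set.image_neg_eq_neg, Set.image_image]

/-- Right invariance absorbs the fixed rotation that carries the first axis to ± the j-th one. -/
theorem lintegral_volume_coordSet [NeZero d] (E : Set (Space d)) (j : Fin d) :
    ∫⁻ ρ, volume (coordSet E ρ j) ∂(haarSO d) = meanWidth E := by
  obtain ⟨σ, hσ⟩ := volume_coordSet_eq_projLength E j
  simp_rw [hσ]
  exact lintegral_mul_right_eq_self (fun ρ => projLength ρ E) σ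

theorem measurable_indicator_coordSet {E : Set (Space d)} (hE : IsCompact E) (j : Fin d)
    {α : Type*} [MeasurableSpace α] {w : α → SO d} {u : α → ℝ} (hw : Measurable w)
    (hu : Measurable u) :
    Measurable fun p => (coordSet E (w p) j).indicator (1 : ℝ → ℝ≥0∞) (u p) := by
  have h : Measurable ({p : SO d × ℝ | p.2 ∈ coordSet E p.1 j}.indicator
      (1 : SO d × ℝ → ℝ≥0∞)) :=
    measurable_one.indicator (isClosed_coordSet hE j).measurableSet
  have h2 : (fun p => (coordSet E (w p) j).indicator (1 : ℝ → ℝ≥0∞) (u p)) =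
      fun p => {p : SO d × ℝ | p.2 ∈ coordSet E p.1 j}.indicator 1 (w p, u p) := by
    funext p
    simp only [Set.indicator, Set.mem_ofPred_eq, Pi.one_apply]
  rw [h2]
  exact h.comp (hw.prodMk hu)

/-- For fixed ρ each axis is a one-dimensional counting problem, so the scale enters as a⁻¹ and not
as its d-th power; averaging over ρ then turns lengths into mean width. -/
theorem lintegral_coord_le [NeZero d] {a : ℝ} (ha : 0 < a) {E : Set (Space d)}
    (hE : IsCompact E) :
    ∫⁻ ρ, ∫⁻ v in Set.Ioc (1 : ℝ) 2, ∑ j, ∑' m : {m : ℤ // m ≠ 0},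
        (coordSet E ρ j).indicator (1 : ℝ → ℝ≥0∞) (a * v * m.1) ∂volume ∂(haarSO d) ≤
      d * (12 * ENNReal.ofReal a⁻¹ * meanWidth E) := by
  have hmQ : ∀ ρ j, MeasurableSet (coordSet E ρ j) := fun ρ j =>
    (measurable_prodMk_left (isClosed_coordSet hE j).measurableSet : _)
  have h1 : ∀ ρ, ∫⁻ v in Set.Ioc (1 : ℝ) 2, ∑ j, ∑' m : {m : ℤ // m ≠ 0},
        (coordSet E ρ j).indicator (1 : ℝ → ℝ≥0∞) (a * v * m.1) ≤
      ∑ j, 12 * ENNReal.ofReal a⁻¹ * volume (coordSet E ρ j) := by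
    intro ρ
    have hmρ : ∀ (j : Fin d), Measurable fun v : ℝ => ∑' m : {m : ℤ // m ≠ 0},
        (coordSet E ρ j).indicator (1 : ℝ → ℝ≥0∞) (a * v * m.1) := fun j =>
      Measurable.tsum fun m => measurable_indicator_coordSet hE j measurable_const (by fun_prop)
    rw [lintegral_finsetSum _ fun j _ => hmρ j]
    refine Finset.sum_le_sum fun j _ => ?_
    have hi : Measurable ((coordSet E ρ j).indicator (1 : ℝ → ℝ≥0∞)) :=
      measurable_one.indicator (hmQ ρ j)
    have h2 := lintegral_tsum_int_dilation_le (hi.comp (measurable_const_mul a))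
    simp only [Function.comp_apply] at h2
    rw [← lintegral_map hi (measurable_const_mul a), Real.map_volume_mul_left ha.ne',
      lintegral_smul_measure, lintegral_indicator_one (hmQ ρ j),
      abs_of_pos (inv_pos.mpr ha), smul_eq_mul, ← mul_assoc] at h2
    simpa only [mul_assoc] using h2
  refine (lintegral_mono h1).trans ?_
  have hv : ∀ j, Measurable fun ρ => volume (coordSet E ρ j) := fun j =>
    measurable_measure_prodMk_left (isClosed_coordSet hE j).measurableSet
  rw [lintegral_finsetSum _ fun j _ => (hv j).const_mul _]
  simp_rw [lintegral_const_mul _ (hv _), lintegral_volume_coordSet]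
  simp

/-- A body is contained in the product of its projections to the axes. -/
theorem volume_le_prod_coordSet {E : Set (Space d)} (ρ : SO d) :
    volume E ≤ ∏ j, volume (coordSet E ρ j) := by
  have h1 : E ⊆ ((WithLp.ofLp : Space d → Fin d → ℝ) ∘ rotIso ρ⁻¹) ⁻¹'
      (Set.univ.pi fun j => coordSet E ρ j) := by
    intro x hx j _
    refine ⟨x, hx, ?_⟩
    have h2 : x = rot ρ (rot ρ⁻¹ x) := by rw [← rot_mul, mul_inv_cancel, rot_one]
    change inner ℝ (rot ρ (EuclideanSpace.single j 1)) x = (rot ρ⁻¹ x) j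
    conv_lhs => rw [h2]
    rw [inner_rot, EuclideanSpace.inner_single_left]
    simp
  have hmp : MeasurePreserving ((WithLp.ofLp : Space d → Fin d → ℝ) ∘ rotIso ρ⁻¹) :=
    (PiLp.volume_preserving_ofLp (Fin d)).comp (rotIso ρ⁻¹).measurePreserving
  calc volume E ≤ volume (((WithLp.ofLp : Space d → Fin d → ℝ) ∘ rotIso ρ⁻¹) ⁻¹'
      (Set.univ.pi fun j => coordSet E ρ j)) := measure_mono h1
    _ ≤ volume (Set.univ.pi fun j => coordSet E ρ j) := hmp.measure_preimage_le _
    _ = _ := by rw [volume_pi, Measure.pi_pi]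

/-- For some ρ the d projection lengths sum to at most their average d w(E), and E lies in the box
that they span. -/
theorem volume_le_meanWidth_pow [NeZero d] {E : Set (Space d)} (hE : IsCompact E) :
    volume E ≤ (d * meanWidth E) ^ d := by
  have hv : ∀ j, Measurable fun ρ => volume (coordSet E ρ j) := fun j =>
    measurable_measure_prodMk_left (isClosed_coordSet hE j).measurableSet
  obtain ⟨ρ, hρ⟩ := exists_le_lintegral (μ := haarSO d)
    (f := fun ρ => ∑ j, volume (coordSet E ρ j))
    (Finset.measurable_sum _ fun j _ => hv j).aemeasurable
  rw [lintegral_finsetSum _ fun j _ => hv j] at hρ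
  simp_rw [lintegral_volume_coordSet] at hρ
  rw [Finset.sum_const, Finset.card_univ, Fintype.card_fin, nsmul_eq_mul] at hρ
  refine (volume_le_prod_coordSet ρ).trans ?_
  calc ∏ j, volume (coordSet E ρ j) ≤ ∏ _j : Fin d, (d * meanWidth E) :=
        Finset.prod_le_prod' fun j _ => (Finset.single_le_sum (f := fun j =>
          volume (coordSet E ρ j)) (fun _ _ => zero_le) (Finset.mem_univ j)).trans hρ
    _ = _ := by simp

theorem projLength_sub [NeZero d] (y : Space d) (E : Set (Space d)) (ρ : SO d) :
    projLength ρ ((fun x => y - x) '' E) = projLength ρ E := by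
  unfold projLength
  rw [Set.image_image]
  simp only [inner_sub_right]
  rw [← Set.image_image (fun t => inner ℝ (axis ρ) y - t) (fun x => inner ℝ (axis ρ) x)]
  set c := inner ℝ (axis ρ) y
  rw [Set.image_eq_preimage_of_inverse (g := fun t : ℝ => c - t) (fun t => by simp)
    (fun t => by simp)]
  exact (volume.measurePreserving_sub_left c).measure_preimage_emb
    (Homeomorph.subLeft c).measurableEmbedding _

theorem meanWidth_sub [NeZero d] (y : Space d) (E : Set (Space d)) :
    meanWidth ((fun x => y - x) '' E) = meanWidth E := by
  unfold meanWidth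
  simp_rw [projLength_sub]

/-- A point where two functions of the random lattice are bounded by twice their averages. -/
theorem exists_rotation_dilation_le {F₁ F₂ : SO d × ℝ → ℝ≥0∞} (h₁ : Measurable F₁)
    (h₂ : Measurable F₂) {A₁ A₂ : ℝ≥0∞} (hA₁ : A₁ ≠ 0) (hA₂ : A₂ ≠ 0) (hA₁' : A₁ ≠ ⊤)
    (hA₂' : A₂ ≠ ⊤)
    (hi₁ : ∫⁻ ρ, ∫⁻ v in Set.Ioc (1 : ℝ) 2, F₁ (ρ, v) ∂volume ∂(haarSO d) ≤ A₁)
    (hi₂ : ∫⁻ ρ, ∫⁻ v in Set.Ioc (1 : ℝ) 2, F₂ (ρ, v) ∂volume ∂(haarSO d) ≤ A₂) :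
    ∃ (ρ : SO d) (v : ℝ), v ∈ Set.Ioc (1 : ℝ) 2 ∧ F₁ (ρ, v) ≤ 2 * A₁ ∧ F₂ (ρ, v) ≤ 2 * A₂ := by
  have hP : IsProbabilityMeasure (volume.restrict (Set.Ioc (1 : ℝ) 2)) :=
    ⟨by rw [Measure.restrict_apply_univ, Real.volume_Ioc]; norm_num⟩
  set μ := (haarSO d).prod (volume.restrict (Set.Ioc (1 : ℝ) 2)) with hμ
  have hnull : μ {p | p.2 ∉ Set.Ioc (1 : ℝ) 2} = 0 := by
    have h0 : {p : SO d × ℝ | p.2 ∉ Set.Ioc (1 : ℝ) 2} =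
        Set.univ ×ˢ (Set.Ioc (1 : ℝ) 2)ᶜ := by
      ext p; simp
    rw [h0, hμ, Measure.prod_prod, Measure.restrict_apply measurableSet_Ioc.compl]
    simp
  -- Each normalized function has mean at most 1, so at some point their sum is at most 2.
  obtain ⟨p, hp, hpF⟩ := exists_notMem_null_le_lintegral (μ := μ)
    (f := fun p => A₁⁻¹ * F₁ p + A₂⁻¹ * F₂ p)
    ((h₁.const_mul _).add (h₂.const_mul _)).aemeasurable hnull
  rw [lintegral_add_left (h₁.const_mul _), lintegral_const_mul _ h₁, lintegral_const_mul _ h₂,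
    hμ, lintegral_prod _ h₁.aemeasurable, lintegral_prod _ h₂.aemeasurable] at hpF
  have hpF2 : A₁⁻¹ * F₁ p + A₂⁻¹ * F₂ p ≤ 2 := by
    refine hpF.trans ?_
    calc _ ≤ A₁⁻¹ * A₁ + A₂⁻¹ * A₂ := by gcongr
      _ = 2 := by rw [ENNReal.inv_mul_cancel hA₁ hA₁', ENNReal.inv_mul_cancel hA₂ hA₂',
        one_add_one_eq_two]
  refine ⟨p.1, p.2, not_not.mp hp, ?_, ?_⟩
  · have := (le_add_right le_rfl).trans hpF2
    rwa [mul_comm, ← div_eq_mul_inv, ENNReal.div_le_iff hA₁ hA₁'] at this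
  · have := (le_add_left le_rfl).trans hpF2
    rwa [mul_comm, ← div_eq_mul_inv, ENNReal.div_le_iff hA₂ hA₂'] at this

end Lattices

/-! ### The pointwise bound for the transform -/

section Core

variable {d : ℕ}

/-- The Fourier integral with the kernel `e^{2πi⟨x, ξ⟩}`. -/
noncomputable def fourierInt (f : Space d → ℂ) (ξ : Space d) : ℂ :=
  ∫ x, cexp (inner ℝ x ξ) * f x

theorem continuous_fourierInt {f : Space d → ℂ} (hf : Integrable f) :
    Continuous (fourierInt f) := by
  have hc : ∀ ξ : Space d, Continuous fun x : Space d => cexp (inner ℝ x ξ) := fun ξ =>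
    continuous_cexp.comp (by fun_prop)
  refine continuous_of_dominated (bound := fun x => ‖f x‖)
    (fun ξ => (hc ξ).aestronglyMeasurable.mul hf.aestronglyMeasurable)
    (fun ξ => ae_of_all _ fun x => by simp) hf.norm (ae_of_all _ fun x => ?_)
  exact (continuous_cexp.comp (by fun_prop)).mul continuous_const

/-- The parametrization of `ℝ^d` by the coordinates with respect to a rotated and dilated
lattice. -/
noncomputable def latticeMap (c : ℝ) (ρ : SO d) (t : Fin d → ℝ) : Space d :=
  c⁻¹ • rot ρ (WithLp.toLp 2 t)

theorem continuous_latticeMap (c : ℝ) (ρ : SO d) : Continuous (latticeMap c ρ) := by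
  have h : Continuous fun t : Fin d → ℝ => rotIso ρ (WithLp.toLp 2 t) :=
    (rotIso ρ).continuous.comp (PiLp.continuous_toLp 2 _)
  exact h.const_smul c⁻¹

theorem measurableEmbedding_toLp :
    MeasurableEmbedding (WithLp.toLp 2 : (Fin d → ℝ) → Space d) :=
  (MeasurableEquiv.toLp 2 (Fin d → ℝ)).measurableEmbedding

theorem measurePreserving_rot_toLp (ρ : SO d) :
    MeasurePreserving fun t : Fin d → ℝ => rot ρ (WithLp.toLp 2 t) :=
  (measurePreserving_rot ρ).comp (PiLp.volume_preserving_toLp (Fin d))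

theorem measurableEmbedding_rot_toLp (ρ : SO d) :
    MeasurableEmbedding fun t : Fin d → ℝ => rot ρ (WithLp.toLp 2 t) :=
  (rotIso ρ).toHomeomorph.measurableEmbedding.comp measurableEmbedding_toLp

theorem integral_comp_latticeMap {c : ℝ} (hc : 0 < c) (ρ : SO d) (H : Space d → ℂ) :
    ∫ t, H (latticeMap c ρ t) = (c ^ d : ℝ) * ∫ x, H x := by
  have h1 := (measurePreserving_rot_toLp ρ).integral_comp (measurableEmbedding_rot_toLp ρ)
    fun x => H (c⁻¹ • x)
  unfold latticeMap
  rw [h1, Measure.integral_comp_smul]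
  simp [abs_of_pos hc]

theorem integrable_comp_latticeMap {E : Type*} [NormedAddCommGroup E] {c : ℝ} (hc : 0 < c)
    (ρ : SO d) {H : Space d → E} (hH : Integrable H) :
    Integrable fun t => H (latticeMap c ρ t) :=
  ((measurePreserving_rot_toLp ρ).integrable_comp_emb (measurableEmbedding_rot_toLp ρ)).mpr
    (hH.comp_smul (inv_ne_zero hc.ne'))

theorem volume_preimage_latticeMap {c : ℝ} (hc : 0 < c) (ρ : SO d) (S : Set (Space d)) :
    volume (latticeMap c ρ ⁻¹' S) = ENNReal.ofReal (c ^ d) * volume S := by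
  have h1 := (measurePreserving_rot_toLp ρ).measure_preimage_emb (measurableEmbedding_rot_toLp ρ)
    ((c⁻¹ • ·) ⁻¹' S)
  rw [Measure.addHaar_preimage_smul _ (inv_ne_zero hc.ne')] at h1
  have h2 : latticeMap c ρ ⁻¹' S =
      (fun t : Fin d → ℝ => rot ρ (WithLp.toLp 2 t)) ⁻¹' ((c⁻¹ • ·) ⁻¹' S) := rfl
  rw [h2, h1]
  simp [abs_of_pos hc]

theorem inner_latticeMap {c : ℝ} (hc : 0 < c) (ρ : SO d) (t : Fin d → ℝ) (k : Fin d → ℤ) :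
    inner ℝ (latticeMap c ρ t) (c • rot ρ (latticePoint k)) = ∑ i, k i * t i := by
  rw [latticeMap, inner_smul_left, inner_smul_right, inner_rot]
  simp only [conj_trivial]
  rw [← mul_assoc, inv_mul_cancel₀ hc.ne', one_mul]
  simp [PiLp.inner_apply, latticePoint, intVec]

theorem latticeCoeff_comp_latticeMap {c : ℝ} (hc : 0 < c) (ρ : SO d) (f : Space d → ℂ)
    (y : Space d) (k : Fin d → ℤ) :
    latticeCoeff (fun t => cexp (inner ℝ (latticeMap c ρ t) y) * f (latticeMap c ρ t)) k =
      (c ^ d : ℝ) * fourierInt f (y - c • rot ρ (latticePoint k)) := by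
  rw [fourierInt, ← integral_comp_latticeMap hc ρ, latticeCoeff]
  refine integral_congr_ae (ae_of_all _ fun t => ?_)
  simp only
  rw [inner_sub_right, inner_latticeMap hc, sub_eq_neg_add, cexp_add, mul_assoc]

theorem exists_finset_forall_notMem_eq_zero {c : ℝ} (hc : 0 < c) (ρ : SO d) {S : Set (Space d)}
    (hS : IsCompact S) : ∃ B : Finset (Fin d → ℤ), ∀ m ∉ B, ∀ x ∈ unitCube (Fin d),
      latticeMap c ρ (x + intVec m) ∉ S := by
  obtain ⟨R, hR⟩ := hS.isBounded.exists_norm_le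
  refine ⟨Fintype.piFinset fun _ => Finset.Icc (-⌊c * R + 1⌋) ⌊c * R + 1⌋,
    fun m hm x hx hmem => hm (Fintype.mem_piFinset.mpr fun i => mem_Icc_floor_of_abs_le ?_)⟩
  have h1 := hR _ hmem
  rw [latticeMap, norm_smul, norm_rot, norm_inv, Real.norm_of_nonneg hc.le,
    inv_mul_le_iff₀ hc] at h1
  have h2 := (PiLp.norm_apply_le (WithLp.toLp 2 (x + intVec m)) i).trans h1
  simp only [Pi.add_apply, intVec, Real.norm_eq_abs] at h2
  have h3 := hx i
  rw [zero_add] at h3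
  rw [abs_le] at h2 ⊢
  constructor <;> linarith [h3.1, h3.2, h2.1, h2.2]

theorem finite_setOf_lattice_mem {c : ℝ} (hc : 0 < c) (ρ : SO d) (y : Space d)
    {T : Set (Space d)} (hT : IsCompact T) :
    {k : Fin d → ℤ | y - c • rot ρ (latticePoint k) ∈ T}.Finite := by
  obtain ⟨R, hR⟩ := hT.isBounded.exists_norm_le
  refine (Finset.finite_toSet (Fintype.piFinset fun _ : Fin d =>
    Finset.Icc (-⌊c⁻¹ * (‖y‖ + R)⌋) ⌊c⁻¹ * (‖y‖ + R)⌋)).subset fun k hk => ?_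
  rw [Finset.mem_coe, Fintype.mem_piFinset]
  refine fun i => mem_Icc_floor_of_abs_le ((abs_le_norm_latticePoint k i).trans ?_)
  have h1 := hR _ hk
  have h2 : ‖c • rot ρ (latticePoint k)‖ ≤ ‖y‖ + R := by
    calc ‖c • rot ρ (latticePoint k)‖ = ‖y - (y - c • rot ρ (latticePoint k))‖ := by
          rw [sub_sub_cancel]
      _ ≤ _ := (norm_sub_le _ _).trans (by gcongr)
  rw [norm_smul, norm_rot, Real.norm_of_nonneg hc.le] at h2
  rwa [le_inv_mul_iff₀ hc]

/-- Modulating by y moves the value at y to the coefficient k = 0. The Jacobian c^d multiplies all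
coefficients alike and cancels. -/
theorem norm_fourierInt_le_of_lattice {f : Space d → ℂ} (hfm : Measurable f)
    (hf1 : Integrable f) (hf2 : MemLp f 2) {S : Set (Space d)} (hS : IsCompact S)
    (hfS : ∀ x ∉ S, f x = 0) {c : ℝ} (hc : 0 < c)
    (hcS : ENNReal.ofReal (c ^ d) * volume S ≤ 1 / 2) (ρ : SO d) (y : Space d)
    {r : Finset (Fin d → ℤ) → ℕ} (hr : IsSliceRank r) (s : Finset (Fin d → ℤ)) (h0 : 0 ∈ s)
    {M : ℝ} (hM : 0 < M)
    (hsum : ∑' k : Fin d → ℤ, (if k ∈ s then 0 else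
      ‖fourierInt f (y - c • rot ρ (latticePoint k))‖ₑ ^ 2) ≤ ENNReal.ofReal (M ^ 2)) :
    ‖fourierInt f y‖ ≤ 16 ^ r s * (2 * M) := by
  have hcd : 0 < c ^ d := pow_pos hc d
  set H : Space d → ℂ := fun x => cexp (inner ℝ x y) * f x with hH
  have hphase : Continuous fun x : Space d => cexp (inner ℝ x y) :=
    continuous_cexp.comp (by fun_prop)
  have hHm : Measurable H := hphase.measurable.mul hfm
  have hH1 : Integrable H := hf1.bdd_mul (c := 1) hphase.aestronglyMeasurable
    (ae_of_all _ fun x => by simp)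
  have hHsq : Integrable fun x => ‖H x‖ ^ 2 := by
    have h1 := hf2.integrable_norm_pow (by norm_num)
    refine h1.congr (ae_of_all _ fun x => ?_)
    simp [hH]
  obtain ⟨B, hB⟩ := exists_finset_forall_notMem_eq_zero hc ρ hS
  set g : (Fin d → ℝ) → ℂ := fun t => H (latticeMap c ρ t) with hg
  have hgm : Measurable g := hHm.comp (continuous_latticeMap c ρ).measurable
  have hg2 : MemLp g 2 := by
    rw [memLp_two_iff_integrable_sq_norm hgm.aestronglyMeasurable]
    exact integrable_comp_latticeMap hc ρ hHsq
  have hgz : ∀ t, latticeMap c ρ t ∉ S → g t = 0 := by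
    intro t ht
    simp [hg, hH, hfS _ ht]
  have hcoef : ∀ k, latticeCoeff g k =
      (c ^ d : ℝ) * fourierInt f (y - c • rot ρ (latticePoint k)) :=
    latticeCoeff_comp_latticeMap hc ρ f y
  have hnorm : ∀ k, ‖latticeCoeff g k‖ =
      c ^ d * ‖fourierInt f (y - c • rot ρ (latticePoint k))‖ := by
    intro k
    rw [hcoef, norm_mul, Complex.norm_real, Real.norm_of_nonneg hcd.le]
  have key := norm_latticeCoeff_zero_le hr hgm (integrable_comp_latticeMap hc ρ hH1) hg2
    (K := latticeMap c ρ ⁻¹' S) ((continuous_latticeMap c ρ).measurable hS.measurableSet)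
    (by rwa [volume_preimage_latticeMap hc]) hgz B (fun m hm x hx => hgz _ (hB m hm x hx)) s h0
    (M := c ^ d * M) (by positivity) ?_
  · rw [hnorm] at key
    have hz : latticePoint (0 : Fin d → ℤ) = 0 := by
      ext i; simp [latticePoint, intVec]
    rw [hz, map_zero, smul_zero, sub_zero] at key
    refine le_of_mul_le_mul_left (key.trans_eq ?_) hcd
    ring
  · rw [mul_pow, ENNReal.ofReal_mul (by positivity)]
    refine le_trans (le_of_eq ?_) (mul_le_mul_right hsum _)
    rw [← ENNReal.tsum_mul_left]
    refine tsum_congr fun k => ?_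
    split_ifs
    · simp
    · rw [← ofReal_norm, hnorm, ENNReal.ofReal_mul hcd.le, mul_pow,
        ENNReal.ofReal_pow hcd.le, ofReal_norm]

theorem measurable_comp_smul_rot (a : ℝ) {φ : Space d → ℝ≥0∞} (hφ : Measurable φ) (x : Space d) :
    Measurable fun p : SO d × ℝ => φ ((a * p.2) • rot p.1 x) := by
  have h1 : Measurable fun p : SO d × ℝ => (a * p.2) • rot p.1 x :=
    ((continuous_const.mul continuous_snd).smul
      (continuous_rot.comp (continuous_fst.prodMk continuous_const))).measurable
  exact hφ.comp h1

theorem measurable_tsum_lattice (a : ℝ) {φ : Space d → ℝ≥0∞} (hφ : Measurable φ) :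
    Measurable fun p : SO d × ℝ => ∑' k : {k : Fin d → ℤ // k ≠ 0},
      φ ((a * p.2) • rot p.1 (latticePoint k.1)) :=
  Measurable.tsum fun k => measurable_comp_smul_rot a hφ (latticePoint k.1)

/-- One lattice is chosen for which both the rank, through its majorant N, and the sum of the
squared samples off T are at most twice their mean bounds. Keeping r and N abstract serves both
exponents; 2a in `haS` is the largest possible scale. -/
theorem norm_fourierInt_sq_le [NeZero d] {f : Space d → ℂ} (hfm : Measurable f)
    (hf1 : Integrable f) (hf2 : MemLp f 2) {S : Set (Space d)} (hS : IsCompact S)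
    (hfS : ∀ x ∉ S, f x = 0) {T : Set (Space d)} (hT : IsCompact T) {a : ℝ} (ha : 0 < a)
    (haS : ENNReal.ofReal ((2 * a) ^ d) * volume S ≤ 1 / 2) {R : ℝ} (hR : 0 < R)
    (hFT : ∫⁻ ξ in Tᶜ, ‖fourierInt f ξ‖ₑ ^ 2 ≤ ENNReal.ofReal R) (y : Space d)
    {r : Finset (Fin d → ℤ) → ℕ} (hr : IsSliceRank r) {N : SO d × ℝ → ℝ≥0∞} (hNm : Measurable N)
    {X : ℝ} (hX : 0 ≤ X)
    (hN : ∫⁻ ρ, ∫⁻ v in Set.Ioc (1 : ℝ) 2, N (ρ, v) ∂volume ∂(haarSO d) ≤ ENNReal.ofReal X)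
    (hrN : ∀ ρ v, 0 < v → ∀ s : Finset (Fin d → ℤ),
      (∀ k, k ∈ s ↔ k = 0 ∨ y - (a * v) • rot ρ (latticePoint k) ∈ T) → r s ≤ N (ρ, v)) :
    ‖fourierInt f y‖ ^ 2 ≤
      8 * Real.exp (12 * (X + 1)) * ((latticeConst d).toReal * (a ^ d)⁻¹ * R) := by
  have hFc := continuous_fourierInt hf1
  set φ : Space d → ℝ≥0∞ := fun ξ => Tᶜ.indicator (fun ξ => ‖fourierInt f ξ‖ₑ ^ 2) (y - ξ)
    with hφ
  have hφ0 : Measurable (Tᶜ.indicator fun ξ => ‖fourierInt f ξ‖ₑ ^ 2) :=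
    (hFc.measurable.enorm.pow_const 2).indicator hT.measurableSet.compl
  have hφm : Measurable φ := hφ0.comp (measurable_const.sub measurable_id)
  have hφi : ∫⁻ ξ, φ ξ ≤ ENNReal.ofReal R := by
    rw [(volume.measurePreserving_sub_left y).lintegral_comp hφ0,
      lintegral_indicator hT.measurableSet.compl]
    exact hFT
  have hLC0 : latticeConst d ≠ 0 := by
    unfold latticeConst
    refine mul_ne_zero (by simp) (ENNReal.inv_ne_zero.mpr (measure_ne_top _ _))
  set LC := (latticeConst d).toReal with hLC
  have hLCpos : 0 < LC := ENNReal.toReal_pos hLC0 latticeConst_ne_top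
  have hLCe : latticeConst d = ENNReal.ofReal LC :=
    (ENNReal.ofReal_toReal latticeConst_ne_top).symm
  have had : 0 < (a ^ d)⁻¹ := by positivity
  have hF₂ : ∫⁻ ρ, ∫⁻ v in Set.Ioc (1 : ℝ) 2, ∑' k : {k : Fin d → ℤ // k ≠ 0},
      φ ((a * v) • rot ρ (latticePoint k.1)) ∂volume ∂(haarSO d) ≤
      ENNReal.ofReal (LC * (a ^ d)⁻¹ * R) := by
    refine (lintegral_lattice_le ha hφm).trans ?_
    rw [hLCe, ← ENNReal.ofReal_mul hLCpos.le,
      ENNReal.ofReal_mul (p := LC * (a ^ d)⁻¹) (by positivity)]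
    exact mul_le_mul_right hφi _
  -- `X + 1` keeps the first bound nonzero when X = 0.
  obtain ⟨ρ, v, hv, h1, h2⟩ := exists_rotation_dilation_le hNm (measurable_tsum_lattice a hφm)
    (A₁ := ENNReal.ofReal (X + 1)) (A₂ := ENNReal.ofReal (LC * (a ^ d)⁻¹ * R))
    (by simp; linarith) (by simp; positivity) ENNReal.ofReal_ne_top ENNReal.ofReal_ne_top
    (hN.trans (ENNReal.ofReal_le_ofReal (by linarith))) hF₂
  have hv0 : 0 < v := one_pos.trans hv.1
  have hc : 0 < a * v := by positivity
  classical
  set s : Finset (Fin d → ℤ) := insert 0 (finite_setOf_lattice_mem hc ρ y hT).toFinset with hs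
  have hmem : ∀ k, k ∈ s ↔ k = 0 ∨ y - (a * v) • rot ρ (latticePoint k) ∈ T := by
    intro k; simp [hs]
  have hrs : (r s : ℝ) ≤ 2 * (X + 1) := by
    have h3 := (hrN ρ v hv0 s hmem).trans h1
    rw [show (2 : ℝ≥0∞) = ENNReal.ofReal 2 by simp, ← ENNReal.ofReal_mul (by norm_num),
      ← ENNReal.ofReal_natCast, ENNReal.ofReal_le_ofReal_iff (by positivity)] at h3
    exact h3
  set M := Real.sqrt (2 * (LC * (a ^ d)⁻¹ * R)) with hMdef
  have hMsq : M ^ 2 = 2 * (LC * (a ^ d)⁻¹ * R) := Real.sq_sqrt (by positivity)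
  have hM : 0 < M := Real.sqrt_pos.mpr (by positivity)
  have hcS : ENNReal.ofReal ((a * v) ^ d) * volume S ≤ 1 / 2 := by
    refine le_trans ?_ haS
    have h3 : a * v ≤ 2 * a := by nlinarith [hv.2]
    exact mul_le_mul_left (ENNReal.ofReal_le_ofReal (pow_le_pow_left₀ hc.le h3 d)) _
  have key := norm_fourierInt_le_of_lattice hfm hf1 hf2 hS hfS hc hcS ρ y hr s
    ((hmem 0).mpr (Or.inl rfl)) hM (by
      rw [hMsq, ENNReal.ofReal_mul (by norm_num), ENNReal.ofReal_ofNat]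
      refine le_trans ?_ h2
      rw [← tsum_subtype_eq_of_support_subset (s := {k : Fin d → ℤ | k ≠ 0})]
      · refine ENNReal.tsum_le_tsum fun k => ?_
        split_ifs with hk
        · exact zero_le
        · rw [hφ]
          simp only
          rw [Set.indicator_of_mem]
          exact fun h => hk ((hmem _).mpr (Or.inr h))
      · intro k hk h
        apply hk
        exact if_pos ((hmem k).mpr (Or.inl h)))
  -- 16 ≤ e³ and r ≤ 2(X + 1); squaring later doubles the exponent to 12(X + 1).
  have h16 : (16 : ℝ) ^ r s ≤ Real.exp (6 * (X + 1)) := by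
    have h3 : (16 : ℝ) ≤ Real.exp 3 := by
      have := Real.exp_one_gt_d9
      have h4 : Real.exp 3 = Real.exp 1 ^ 3 := by rw [← Real.exp_nat_mul]; norm_num
      rw [h4]
      calc (16 : ℝ) ≤ 2.7 ^ 3 := by norm_num
        _ ≤ _ := pow_le_pow_left₀ (by norm_num) (by linarith) 3
    calc (16 : ℝ) ^ r s ≤ Real.exp 3 ^ r s := pow_le_pow_left₀ (by norm_num) h3 _
      _ = Real.exp (r s * 3) := by rw [← Real.exp_nat_mul]
      _ ≤ _ := Real.exp_le_exp.mpr (by linarith)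
  calc ‖fourierInt f y‖ ^ 2 ≤ (Real.exp (6 * (X + 1)) * (2 * M)) ^ 2 := by
        refine pow_le_pow_left₀ (norm_nonneg _) (key.trans ?_) 2
        gcongr
    _ = 4 * Real.exp (6 * (X + 1)) ^ 2 * M ^ 2 := by ring
    _ = _ := by
        rw [hMsq, ← Real.exp_nat_mul]
        push_cast
        rw [show 2 * (6 * (X + 1)) = 12 * (X + 1) by ring]
        ring

end Core

/-! ### Functions supported in S: integrating over T -/

section Support

variable {d : ℕ}

/-- The largest scale for which the dilations by v ≤ 2 still fill at most half of the cell. The 4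
bounds 2^((d+1)/d). -/
theorem exists_dilation [NeZero d] {s : ℝ} (hs : 0 < s) :
    ∃ a : ℝ, 0 < a ∧ (2 * a) ^ d * s = 1 / 2 ∧ (a ^ d)⁻¹ = 2 ^ (d + 1) * s ∧
      a⁻¹ ≤ 4 * s ^ (1 / (d : ℝ)) := by
  have hd : (d : ℝ) ≠ 0 := Nat.cast_ne_zero.mpr (NeZero.ne d)
  have hp : 0 < 2 ^ (d + 1) * s := by positivity
  have h1 : (((2 ^ (d + 1) * s) ^ (1 / (d : ℝ)))⁻¹ ^ d)⁻¹ = 2 ^ (d + 1) * s := by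
    rw [inv_pow, inv_inv, one_div, Real.rpow_inv_natCast_pow hp.le (NeZero.ne d)]
  refine ⟨((2 ^ (d + 1) * s) ^ (1 / (d : ℝ)))⁻¹, by positivity, ?_, h1, ?_⟩
  · have h2 := inv_eq_iff_eq_inv.mp h1
    rw [mul_pow, h2]
    field_simp
    ring
  · rw [inv_inv, Real.mul_rpow (by positivity) hs.le]
    gcongr
    calc ((2 : ℝ) ^ (d + 1)) ^ (1 / (d : ℝ)) ≤ (4 ^ d) ^ (1 / (d : ℝ)) := by
          gcongr
          rw [show (4 : ℝ) = 2 ^ 2 by norm_num, ← pow_mul]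
          exact pow_le_pow_right₀ one_le_two (by have := NeZero.pos d; omega)
      _ = 4 := by
          rw [one_div, Real.pow_rpow_inv_natCast (by norm_num) (NeZero.ne d)]

/-- Integrating the uniform bound over T costs K |T| ≤ D. Since `h` needs R > 0, the tail integral,
possibly zero, is approached from above. -/
theorem lintegral_sq_le_of_forall_le {F : Space d → ℂ} {T : Set (Space d)}
    (hT : MeasurableSet T) (hTf : volume T ≠ ⊤) {K D : ℝ} (hK : 0 ≤ K)
    (hKD : K * (volume T).toReal ≤ D)
    (h : ∀ R, 0 < R → ∫⁻ ξ in Tᶜ, ‖F ξ‖ₑ ^ 2 ≤ ENNReal.ofReal R → ∀ y, ‖F y‖ ^ 2 ≤ K * R) :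
    ∫⁻ ξ, ‖F ξ‖ₑ ^ 2 ≤ ENNReal.ofReal (1 + D) * ∫⁻ ξ in Tᶜ, ‖F ξ‖ₑ ^ 2 := by
  have hD : 0 ≤ D := (mul_nonneg hK ENNReal.toReal_nonneg).trans hKD
  rcases eq_or_ne (∫⁻ ξ in Tᶜ, ‖F ξ‖ₑ ^ 2) ⊤ with htop | htop
  · rw [htop, ENNReal.mul_top (by simp; linarith)]
    exact le_top
  set I := (∫⁻ ξ in Tᶜ, ‖F ξ‖ₑ ^ 2).toReal with hI
  have hI0 : 0 ≤ I := ENNReal.toReal_nonneg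
  have hIe : ∫⁻ ξ in Tᶜ, ‖F ξ‖ₑ ^ 2 = ENNReal.ofReal I := (ENNReal.ofReal_toReal htop).symm
  have h1 : ∀ y, ‖F y‖ ^ 2 ≤ K * I := by
    intro y
    refine le_of_forall_pos_le_add fun ε hε => ?_
    have h2 := h (I + ε / (K + 1)) (by positivity)
      (hIe.trans_le (ENNReal.ofReal_le_ofReal (by linarith [show 0 < ε / (K + 1) by positivity]))) y
    refine h2.trans ?_
    rw [mul_add]
    gcongr
    rw [mul_div_assoc', div_le_iff₀ (by positivity)]
    nlinarith
  have h2 : ∫⁻ ξ in T, ‖F ξ‖ₑ ^ 2 ≤ ENNReal.ofReal (D * I) := by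
    calc ∫⁻ ξ in T, ‖F ξ‖ₑ ^ 2 ≤ ∫⁻ _ in T, ENNReal.ofReal (K * I) := by
          refine lintegral_mono fun y => ?_
          rw [← ofReal_norm, ← ENNReal.ofReal_pow (norm_nonneg _)]
          exact ENNReal.ofReal_le_ofReal (h1 y)
      _ = ENNReal.ofReal (K * (volume T).toReal * I) := by
          rw [setLIntegral_const, mul_right_comm, ENNReal.ofReal_mul (p := K * I) (by positivity),
            ENNReal.ofReal_toReal hTf]
      _ ≤ _ := ENNReal.ofReal_le_ofReal (by gcongr)
  rw [← lintegral_add_compl _ hT, hIe, ← ENNReal.ofReal_mul (by positivity), add_mul, one_mul,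
    add_comm I, ENNReal.ofReal_add (by positivity) hI0]
  gcongr

theorem card_sub_one_le_tsum {α : Type*} [DecidableEq α] (s : Finset α) (z : α)
    (h : α → ℝ≥0∞) (hs : ∀ k ∈ s, k ≠ z → 1 ≤ h k) :
    ((s.card - 1 : ℕ) : ℝ≥0∞) ≤ ∑' k : {k : α // k ≠ z}, h k.1 := by
  have h1 : s.card - 1 ≤ (s.subtype fun k => k ≠ z).card := by
    rw [Finset.card_subtype, Finset.filter_ne']
    exact Finset.pred_card_le_card_erase
  calc ((s.card - 1 : ℕ) : ℝ≥0∞) ≤ ((s.subtype fun k => k ≠ z).card : ℝ≥0∞) := by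
        exact_mod_cast h1
    _ = ∑ k ∈ s.subtype fun k => k ≠ z, 1 := by simp
    _ ≤ ∑ k ∈ s.subtype fun k => k ≠ z, h k.1 := Finset.sum_le_sum fun k hk =>
        hs _ (Finset.mem_subtype.mp hk) k.2
    _ ≤ _ := ENNReal.sum_le_tsum _

theorem meanWidth_ne_top [NeZero d] {T : Set (Space d)} (hT : IsCompact T) :
    meanWidth T ≠ ⊤ := by
  obtain ⟨R, hR⟩ := hT.isBounded.exists_norm_le
  have h : ∀ ρ, projLength ρ T ≤ volume (Set.Icc (-R) R) := by
    intro ρ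
    refine measure_mono ?_
    rintro _ ⟨x, hx, rfl⟩
    have h1 := abs_real_inner_le_norm (axis ρ) x
    have h2 : ‖axis ρ‖ = 1 := (norm_rot ρ _).trans (by simp)
    rw [h2, one_mul] at h1
    exact abs_le.mp (h1.trans (hR x hx))
  refine ((lintegral_mono h).trans_lt ?_).ne
  rw [lintegral_const, measure_univ, mul_one]
  exact measure_Icc_lt_top

/-- A constant that serves for both exponents. -/
noncomputable def supportConst (d : ℕ) : ℝ :=
  1 + 8 * Real.exp 12 * ((latticeConst d).toReal * 2 ^ (d + 1) * d.factorial + 1) +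
    13 * ((latticeConst d).toReal * 2 ^ (d + 1) + 48 * d)

theorem supportConst_pos (d : ℕ) : 0 < supportConst d := by
  have : 0 ≤ (latticeConst d).toReal := ENNReal.toReal_nonneg
  unfold supportConst
  positivity

variable [NeZero d] {f : Space d → ℂ} {S T : Set (Space d)}

/-- The rank card - 1 is at most the number of nonzero lattice points in y - T, with mean at most X.
The factor K |T| is 8 X e^(12(X+1)), and X ≤ e^X raises 12X to 13X. -/
theorem lintegral_fourierInt_le_volume (hfm : Measurable f)
    (hf1 : Integrable f) (hf2 : MemLp f 2) (hS : IsCompact S)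
    (hfS : ∀ x ∉ S, f x = 0) (hS0 : volume S ≠ 0) (hT : IsCompact T) {P : ℝ}
    (hP : P = (volume S).toReal * (volume T).toReal) :
    ∫⁻ ξ, ‖fourierInt f ξ‖ₑ ^ 2 ≤ ENNReal.ofReal (supportConst d * Real.exp (supportConst d * P)) *
      ∫⁻ ξ in Tᶜ, ‖fourierInt f ξ‖ₑ ^ 2 := by
  have hSf : volume S ≠ ⊤ := hS.measure_ne_top
  have hTf : volume T ≠ ⊤ := hT.measure_ne_top
  have hs : 0 < (volume S).toReal := ENNReal.toReal_pos hS0 hSf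
  obtain ⟨a, ha, ha1, ha2, -⟩ := exists_dilation (d := d) hs
  set LC := (latticeConst d).toReal with hLC
  have hLC0 : 0 ≤ LC := ENNReal.toReal_nonneg
  set X := LC * 2 ^ (d + 1) * P with hX
  have hP0 : 0 ≤ P := by rw [hP]; positivity
  have hX0 : 0 ≤ X := by positivity
  have haS : ENNReal.ofReal ((2 * a) ^ d) * volume S ≤ 1 / 2 := by
    rw [← ENNReal.ofReal_toReal hSf, ← ENNReal.ofReal_mul (by positivity), ha1]
    simp [ENNReal.ofReal_inv_of_pos]
  have hfac : (1 : ℝ) ≤ d.factorial := by exact_mod_cast d.factorial_pos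
  have key := lintegral_sq_le_of_forall_le (F := fourierInt f) hT.measurableSet hTf
    (K := 8 * Real.exp (12 * (X + 1)) * (LC * (2 ^ (d + 1) * (volume S).toReal)))
    (D := 8 * Real.exp 12 * Real.exp (13 * X)) (by positivity) ?_ ?_
  · refine key.trans ?_
    gcongr
    have h1 : 1 ≤ Real.exp (13 * X) := Real.one_le_exp (by positivity)
    have h2 : 13 * X ≤ supportConst d * P := by
      rw [hX, ← mul_assoc]
      gcongr
      rw [supportConst, ← hLC]
      have : 0 ≤ 1 + 8 * Real.exp 12 * (LC * 2 ^ (d + 1) * d.factorial + 1) := by positivity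
      have : (0 : ℝ) ≤ d := by positivity
      linarith
    have h3 : 1 + 8 * Real.exp 12 ≤ supportConst d := by
      rw [supportConst, ← hLC]
      have : 0 ≤ 8 * Real.exp 12 * (LC * 2 ^ (d + 1) * d.factorial) := by positivity
      have : 0 ≤ 13 * (LC * 2 ^ (d + 1) + 48 * d) := by positivity
      linarith
    calc 1 + 8 * Real.exp 12 * Real.exp (13 * X)
        ≤ (1 + 8 * Real.exp 12) * Real.exp (13 * X) := by linarith
      _ ≤ supportConst d * Real.exp (supportConst d * P) :=
          mul_le_mul h3 (Real.exp_le_exp.mpr h2) (Real.exp_nonneg _) (supportConst_pos d).le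
  · have h1 : X ≤ Real.exp X := by linarith [Real.add_one_le_exp X]
    calc _ = 8 * (Real.exp 12 * Real.exp (12 * X)) * X := by
          rw [← Real.exp_add, hX, hP]; ring_nf
      _ ≤ 8 * (Real.exp 12 * Real.exp (12 * X)) * Real.exp X := by gcongr
      _ = 8 * Real.exp 12 * (Real.exp (12 * X) * Real.exp X) := by ring
      _ = _ := by rw [← Real.exp_add]; ring_nf
  · intro R hR hFT y
    set φ : Space d → ℝ≥0∞ := ((fun ξ => y - ξ) ⁻¹' T).indicator 1 with hφ
    have hEm : MeasurableSet ((fun ξ => y - ξ) ⁻¹' T) :=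
      (measurable_const.sub measurable_id) hT.measurableSet
    have hφm : Measurable φ := measurable_one.indicator hEm
    have hφi : ∫⁻ ξ, φ ξ = volume T := by
      rw [hφ, lintegral_indicator_one hEm]
      exact (volume.measurePreserving_sub_left y).measure_preimage hT.measurableSet.nullMeasurableSet
    have h1 := norm_fourierInt_sq_le hfm hf1 hf2 hS hfS hT ha haS hR hFT y
      isSliceRank_card_sub_one (measurable_tsum_lattice a hφm) hX0 (by
        refine (lintegral_lattice_le ha hφm).trans (le_of_eq ?_)
        rw [hφi, ha2, hX, hP, ← ENNReal.ofReal_toReal (latticeConst_ne_top (d := d)),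
          ← ENNReal.ofReal_mul (by positivity)]
        conv_lhs => rw [← ENNReal.ofReal_toReal hTf]
        rw [← ENNReal.ofReal_mul (by positivity), ← hLC]
        ring_nf) (by
        intro ρ v hv s hs
        refine card_sub_one_le_tsum s 0 (fun k => φ ((a * v) • rot ρ (latticePoint k)))
          fun k hk hk0 => ?_
        have h2 : y - (a * v) • rot ρ (latticePoint k) ∈ T := ((hs k).mp hk).resolve_left hk0
        exact (Set.indicator_of_mem (s := (fun ξ => y - ξ) ⁻¹' T) h2 (1 : Space d → ℝ≥0∞)).ge)
    rw [ha2, ← hLC] at h1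
    refine h1.trans_eq ?_
    ring

/-- The coordinate rank is at most the number of nonzero integers m, over all axes, with a v m in
the projection of y - T. In 48 = 12 · 4, the 12 is from the line and the 4 from a⁻¹ ≤ 4 |S|^(1/d).
The factor |S||T| is at most (dP)^d ≤ d! e^X. -/
theorem lintegral_fourierInt_le_meanWidth (hfm : Measurable f)
    (hf1 : Integrable f) (hf2 : MemLp f 2) (hS : IsCompact S)
    (hfS : ∀ x ∉ S, f x = 0) (hS0 : volume S ≠ 0) (hT : IsCompact T) {P : ℝ}
    (hP : P = (volume S).toReal ^ (1 / (d : ℝ)) * (meanWidth T).toReal) :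
    ∫⁻ ξ, ‖fourierInt f ξ‖ₑ ^ 2 ≤ ENNReal.ofReal (supportConst d * Real.exp (supportConst d * P)) *
      ∫⁻ ξ in Tᶜ, ‖fourierInt f ξ‖ₑ ^ 2 := by
  have hSf : volume S ≠ ⊤ := hS.measure_ne_top
  have hTf : volume T ≠ ⊤ := hT.measure_ne_top
  have hwf := meanWidth_ne_top hT
  have hs : 0 < (volume S).toReal := ENNReal.toReal_pos hS0 hSf
  obtain ⟨a, ha, ha1, ha2, ha3⟩ := exists_dilation (d := d) hs
  set LC := (latticeConst d).toReal with hLC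
  set s := (volume S).toReal with hsdef
  set w := (meanWidth T).toReal with hw
  have hLC0 : 0 ≤ LC := ENNReal.toReal_nonneg
  have hw0 : 0 ≤ w := ENNReal.toReal_nonneg
  have hd1 : (1 : ℝ) ≤ d := by exact_mod_cast NeZero.one_le (n := d)
  set X := 48 * d * P with hX
  have hP0 : 0 ≤ P := by rw [hP]; positivity
  have hX0 : 0 ≤ X := by positivity
  have haS : ENNReal.ofReal ((2 * a) ^ d) * volume S ≤ 1 / 2 := by
    rw [← ENNReal.ofReal_toReal hSf, ← ENNReal.ofReal_mul (by positivity), ha1]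
    simp [ENNReal.ofReal_inv_of_pos]
  have hTw : (volume T).toReal ≤ (d * w) ^ d := by
    have h1 := ENNReal.toReal_mono (by finiteness) (volume_le_meanWidth_pow hT)
    simpa [ENNReal.toReal_pow, ENNReal.toReal_mul] using h1
  have key := lintegral_sq_le_of_forall_le (F := fourierInt f) hT.measurableSet hTf
    (K := 8 * Real.exp (12 * (X + 1)) * (LC * (2 ^ (d + 1) * s)))
    (D := 8 * Real.exp 12 * (LC * 2 ^ (d + 1) * d.factorial) * Real.exp (13 * X))
    (by positivity) ?_ ?_
  · refine key.trans ?_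
    gcongr
    have h1 : 1 ≤ Real.exp (13 * X) := Real.one_le_exp (by positivity)
    have h2 : 13 * X ≤ supportConst d * P := by
      rw [hX, ← mul_assoc]
      gcongr
      rw [supportConst, ← hLC]
      have : 0 ≤ 1 + 8 * Real.exp 12 * (LC * 2 ^ (d + 1) * d.factorial + 1) := by positivity
      have : 0 ≤ LC * 2 ^ (d + 1) := by positivity
      linarith
    have h3 : 1 + 8 * Real.exp 12 * (LC * 2 ^ (d + 1) * d.factorial) ≤ supportConst d := by
      rw [supportConst, ← hLC]
      have : 0 ≤ 8 * Real.exp 12 := by positivity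
      have : 0 ≤ 13 * (LC * 2 ^ (d + 1) + 48 * d) := by positivity
      linarith
    calc 1 + 8 * Real.exp 12 * (LC * 2 ^ (d + 1) * d.factorial) * Real.exp (13 * X)
        ≤ (1 + 8 * Real.exp 12 * (LC * 2 ^ (d + 1) * d.factorial)) * Real.exp (13 * X) := by
          linarith
      _ ≤ supportConst d * Real.exp (supportConst d * P) :=
          mul_le_mul h3 (Real.exp_le_exp.mpr h2) (Real.exp_nonneg _) (supportConst_pos d).le
  · have h0 : (d * P) ^ d ≤ d.factorial * Real.exp X := by
      have h1 := Real.pow_div_factorial_le_exp (d * P) (by positivity) d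
      rw [div_le_iff₀ (by positivity)] at h1
      refine h1.trans ?_
      rw [mul_comm]
      gcongr
      rw [hX]
      nlinarith [mul_nonneg (zero_le_one.trans hd1) hP0]
    have h2 : s * (d * w) ^ d = (d * P) ^ d := by
      have h3 : (s ^ (1 / (d : ℝ))) ^ d = s := by
        rw [one_div, Real.rpow_inv_natCast_pow hs.le (NeZero.ne d)]
      calc s * (d * w) ^ d = (s ^ (1 / (d : ℝ))) ^ d * (d * w) ^ d := by rw [h3]
        _ = _ := by rw [← mul_pow, hP]; ring
    calc _ ≤ 8 * Real.exp (12 * (X + 1)) * (LC * (2 ^ (d + 1) * s)) * (d * w) ^ d := by gcongr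
      _ = 8 * (Real.exp 12 * Real.exp (12 * X)) * (LC * 2 ^ (d + 1)) * (s * (d * w) ^ d) := by
          rw [← Real.exp_add]; ring_nf
      _ ≤ 8 * (Real.exp 12 * Real.exp (12 * X)) * (LC * 2 ^ (d + 1)) *
          (d.factorial * Real.exp X) := by
          rw [h2]; gcongr
      _ = 8 * Real.exp 12 * (LC * 2 ^ (d + 1) * d.factorial) *
          (Real.exp (12 * X) * Real.exp X) := by ring
      _ = _ := by rw [← Real.exp_add]; ring_nf
  · intro R hR hFT y
    set E : Set (Space d) := (fun x => y - x) '' T with hE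
    have hEc : IsCompact E := hT.image (continuous_const.sub continuous_id)
    have hEw : meanWidth E = meanWidth T := meanWidth_sub y T
    have hNm : Measurable fun p : SO d × ℝ => ∑ j, ∑' m : {m : ℤ // m ≠ 0},
        (coordSet E p.1 j).indicator (1 : ℝ → ℝ≥0∞) (a * p.2 * m.1) :=
      Finset.measurable_sum _ fun j _ => Measurable.tsum fun m =>
        measurable_indicator_coordSet hEc j measurable_fst
          ((measurable_const.mul measurable_snd).mul_const _)
    have h1 := norm_fourierInt_sq_le hfm hf1 hf2 hS hfS hT ha haS hR hFT y
      isSliceRank_sum_card_image_sub_one hNm hX0 (by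
        refine (lintegral_coord_le ha hEc).trans ?_
        rw [hEw, ← ENNReal.ofReal_toReal hwf, ← hw, ← ENNReal.ofReal_natCast,
          ← ENNReal.ofReal_ofNat 12, ← ENNReal.ofReal_mul (by positivity),
          ← ENNReal.ofReal_mul (by positivity), ← ENNReal.ofReal_mul (by positivity)]
        refine ENNReal.ofReal_le_ofReal ?_
        calc (d : ℝ) * (12 * a⁻¹ * w) ≤ d * (12 * (4 * s ^ (1 / (d : ℝ))) * w) := by gcongr
          _ = X := by rw [hX, hP]; ring) (by
        intro ρ v hv s hs
        rw [Nat.cast_sum]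
        change _ ≤ ∑ j, ∑' m : {m : ℤ // m ≠ 0},
          (coordSet E ρ j).indicator (1 : ℝ → ℝ≥0∞) (a * v * m.1)
        refine Finset.sum_le_sum fun j _ => ?_
        refine card_sub_one_le_tsum _ 0
          (fun m : ℤ => (coordSet E ρ j).indicator (1 : ℝ → ℝ≥0∞) (a * v * m)) fun m hm hm0 => ?_
        obtain ⟨k, hk, rfl⟩ := Finset.mem_image.mp hm
        have hk0 : k ≠ 0 := fun h => hm0 (by rw [h]; rfl)
        have h2 : y - (a * v) • rot ρ (latticePoint k) ∈ T := ((hs k).mp hk).resolve_left hk0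
        have h3 : a * v * (k j : ℝ) ∈ coordSet E ρ j := by
          refine ⟨(a * v) • rot ρ (latticePoint k), ⟨_, h2, sub_sub_cancel _ _⟩, ?_⟩
          simp only
          rw [inner_smul_right, inner_rot]
          simp [EuclideanSpace.inner_single_left, latticePoint, intVec]
        exact (Set.indicator_of_mem h3 (1 : ℝ → ℝ≥0∞)).ge)
    rw [ha2, ← hLC] at h1
    refine h1.trans_eq ?_
    ring

end Support

/-! ### The transform on L² and its integral formula -/

section Transform

open SchwartzMap

variable {d : ℕ}

/-- Fubini; ε = 1 and ε = -1 serve the two signs in the exponential. -/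
theorem integral_mul_fourierInt {f g : Space d → ℂ} (hf : Integrable f) (hg : Integrable g)
    (ε : ℝ) : ∫ ξ, g ξ * fourierInt f (ε • ξ) = ∫ x, fourierInt g (ε • x) * f x := by
  have hc : Continuous fun p : Space d × Space d => cexp (inner ℝ p.2 (ε • p.1)) :=
    continuous_cexp.comp (by fun_prop)
  have hint : Integrable (Function.uncurry fun ξ x => g ξ * (cexp (inner ℝ x (ε • ξ)) * f x))
      (volume.prod volume) := by
    refine ((hg.mul_prod hf).bdd_mul (c := 1) hc.aestronglyMeasurable
      (ae_of_all _ fun p => by simp)).congr (ae_of_all _ fun p => ?_)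
    simp only [Function.uncurry]
    ring
  calc ∫ ξ, g ξ * fourierInt f (ε • ξ)
      = ∫ ξ, ∫ x, g ξ * (cexp (inner ℝ x (ε • ξ)) * f x) := by
        refine integral_congr_ae (ae_of_all _ fun ξ => ?_)
        simp only [fourierInt]
        rw [integral_const_mul]
    _ = ∫ x, ∫ ξ, g ξ * (cexp (inner ℝ x (ε • ξ)) * f x) := integral_integral_swap hint
    _ = _ := by
        refine integral_congr_ae (ae_of_all _ fun x => ?_)
        simp only [fourierInt]
        rw [← integral_mul_const]
        refine integral_congr_ae (ae_of_all _ fun ξ => ?_)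
        simp only [inner_smul_right, real_inner_comm x ξ]
        ring

theorem norm_fourierInt_neg (f : Space d → ℂ) (ξ : Space d) :
    ‖fourierInt f (-ξ)‖ = ‖fourierInt (fun x => starRingEnd ℂ (f x)) ξ‖ := by
  have h : fourierInt (fun x => starRingEnd ℂ (f x)) ξ = starRingEnd ℂ (fourierInt f (-ξ)) := by
    rw [fourierInt, fourierInt, ← integral_conj]
    refine integral_congr_ae (ae_of_all _ fun x => ?_)
    simp only [map_mul, inner_neg_right, cexp_neg, Complex.conj_conj]
  rw [h, RCLike.norm_conj]

theorem fourierInv_eq_fourierInt (g : Space d → ℂ) (x : Space d) : 𝓕⁻ g x = fourierInt g x := by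
  rw [Real.fourierInv_eq', fourierInt]
  refine integral_congr_ae (ae_of_all _ fun v => ?_)
  simp only [cexp, smul_eq_mul]
  congr 2
  push_cast
  ring

theorem fourier_eq_fourierInt (g : Space d → ℂ) (x : Space d) : 𝓕 g x = fourierInt g (-x) := by
  rw [Real.fourier_eq', fourierInt]
  refine integral_congr_ae (ae_of_all _ fun v => ?_)
  simp only [cexp, smul_eq_mul, inner_neg_right]
  congr 2
  push_cast
  ring

theorem ae_eq_of_forall_schwartz {u : Lp ℂ 2 (volume : Measure (Space d))} {F : Space d → ℂ}
    (hF : Continuous F) (h : ∀ g : 𝓢(Space d, ℂ), ∫ x, g x * u x = ∫ x, g x * F x) :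
    u =ᵐ[volume] F := by
  refine ae_eq_of_integral_contDiff_smul_eq ((Lp.memLp u).locallyIntegrable one_le_two)
    hF.locallyIntegrable fun g g_smooth g_cpt => ?_
  have hg₁ : HasCompactSupport (Complex.ofRealCLM ∘ g) := g_cpt.comp_left rfl
  have hg₂ : ContDiff ℝ ((⊤ : ℕ∞) : WithTop ℕ∞) (Complex.ofRealCLM ∘ g) := by fun_prop
  simpa using h (hg₁.toSchwartzMap hg₂)

/-- Both sides pair alike with Schwartz functions: on L² by the duality defining the distributional
transform, on the integral by Fubini. -/
theorem fourierInv_toLp_ae_eq {f : Space d → ℂ} (hf : Integrable f) (hf2 : MemLp f 2) :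
    (𝓕⁻ (hf2.toLp f) : Lp ℂ 2 (volume : Measure (Space d))) =ᵐ[volume] fourierInt f := by
  refine ae_eq_of_forall_schwartz (continuous_fourierInt hf) fun g => ?_
  have h1 := congrArg (fun u : 𝓢'(Space d, ℂ) => u g)
    (Lp.fourierInv_toTemperedDistribution_eq (hf2.toLp f))
  simp only [TemperedDistribution.fourierInv_apply, Lp.toTemperedDistribution_apply,
    smul_eq_mul] at h1
  rw [← h1]
  have h2 := integral_mul_fourierInt hf g.integrable 1
  simp only [one_smul] at h2
  rw [h2]
  refine integral_congr_ae ?_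
  filter_upwards [hf2.coeFn_toLp] with x hx
  rw [hx, fourierInv_coe, fourierInv_eq_fourierInt]

theorem fourier_toLp_ae_eq {f : Space d → ℂ} (hf : Integrable f) (hf2 : MemLp f 2) :
    (𝓕 (hf2.toLp f) : Lp ℂ 2 (volume : Measure (Space d))) =ᵐ[volume]
      fun ξ => fourierInt f (-ξ) := by
  refine ae_eq_of_forall_schwartz ((continuous_fourierInt hf).comp continuous_neg) fun g => ?_
  have h1 := congrArg (fun u : 𝓢'(Space d, ℂ) => u g)
    (Lp.fourier_toTemperedDistribution_eq (hf2.toLp f))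
  simp only [TemperedDistribution.fourier_apply, Lp.toTemperedDistribution_apply,
    smul_eq_mul] at h1
  rw [← h1]
  have h2 := integral_mul_fourierInt hf g.integrable (-1)
  simp only [neg_smul, one_smul] at h2
  rw [h2]
  refine integral_congr_ae ?_
  filter_upwards [hf2.coeFn_toLp] with x hx
  rw [hx, fourier_coe, fourier_eq_fourierInt]

theorem lintegral_sq_enorm_eq (f : Lp ℂ 2 (volume : Measure (Space d))) :
    ∫⁻ x, ‖f x‖ₑ ^ 2 = ‖f‖ₑ ^ 2 := by
  rw [Lp.enorm_def, eLpNorm_eq_lintegral_rpow_enorm_toReal (by simp) (by simp)]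
  simp only [ENNReal.toReal_ofNat, ENNReal.rpow_ofNat, one_div]
  rw [← ENNReal.rpow_natCast, ← ENNReal.rpow_mul]
  simp

/-- The exponential factor, as a function of the exponent. -/
noncomputable def expFactor (d : ℕ) (P : ℝ≥0∞) : ℝ≥0∞ :=
  ENNReal.ofReal (supportConst d * Real.exp (supportConst d * P.toReal))

theorem expFactor_ne_top (P : ℝ≥0∞) : expFactor d P ≠ ⊤ := ENNReal.ofReal_ne_top

theorem toReal_expFactor (P : ℝ≥0∞) :
    (expFactor d P).toReal = supportConst d * Real.exp (supportConst d * P.toReal) :=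
  ENNReal.toReal_ofReal (mul_nonneg (supportConst_pos d).le (Real.exp_nonneg _))

theorem one_le_expFactor (P : ℝ≥0∞) : 1 ≤ expFactor d P := by
  have h0 : 1 ≤ supportConst d := by
    have : 0 ≤ (latticeConst d).toReal := ENNReal.toReal_nonneg
    rw [supportConst, add_assoc, le_add_iff_nonneg_right]
    positivity
  have h1 : 1 ≤ Real.exp (supportConst d * P.toReal) :=
    Real.one_le_exp (mul_nonneg (supportConst_pos d).le ENNReal.toReal_nonneg)
  rw [expFactor, ENNReal.one_le_ofReal]
  nlinarith

/-- Functions supported in `S` are controlled by their transform outside `T`. -/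
def IsSupportBound (U : Lp ℂ 2 (volume : Measure (Space d)) → Lp ℂ 2 (volume : Measure (Space d)))
    (S T : Set (Space d)) (A : ℝ≥0∞) : Prop :=
  ∀ (f : Space d → ℂ) (hf2 : MemLp f 2), Measurable f → Integrable f → (∀ x ∉ S, f x = 0) →
    ∫⁻ ξ, ‖U (hf2.toLp f) ξ‖ₑ ^ 2 ≤ A * ∫⁻ ξ in Tᶜ, ‖U (hf2.toLp f) ξ‖ₑ ^ 2

theorem isSupportBound_of_volume_eq_zero {S T : Set (Space d)}
    (U : Lp ℂ 2 (volume : Measure (Space d)) ≃ₗᵢ[ℂ] Lp ℂ 2 (volume : Measure (Space d)))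
    (hS0 : volume S = 0) (A : ℝ≥0∞) : IsSupportBound U S T A := by
  intro f hf2 _ _ hfS
  have h1 : hf2.toLp f = 0 := by
    rw [Lp.eq_zero_iff_ae_eq_zero]
    refine hf2.coeFn_toLp.trans (measure_mono_null (fun x hx => ?_) hS0)
    by_contra h
    exact hx (hfS x h)
  rw [h1, map_zero, lintegral_sq_enorm_eq]
  simp

variable [NeZero d] {S T : Set (Space d)}

theorem lintegral_fourierInt_le (hS : IsCompact S) (hT : IsCompact T) (hS0 : volume S ≠ 0)
    {P : ℝ≥0∞}
    (hP : P = volume S * volume T ∨ P = volume S ^ (1 / (d : ℝ)) * meanWidth T)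
    {f : Space d → ℂ} (hfm : Measurable f) (hf1 : Integrable f) (hf2 : MemLp f 2)
    (hfS : ∀ x ∉ S, f x = 0) :
    ∫⁻ ξ, ‖fourierInt f ξ‖ₑ ^ 2 ≤ expFactor d P * ∫⁻ ξ in Tᶜ, ‖fourierInt f ξ‖ₑ ^ 2 := by
  rcases hP with hP | hP
  · exact lintegral_fourierInt_le_volume hfm hf1 hf2 hS hfS hS0 hT
      (by rw [hP, ENNReal.toReal_mul])
  · exact lintegral_fourierInt_le_meanWidth hfm hf1 hf2 hS hfS hS0 hT
      (by rw [hP, ENNReal.toReal_mul, ← ENNReal.toReal_rpow])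

theorem isSupportBound_fourierInv (hS : IsCompact S) (hT : IsCompact T) {P : ℝ≥0∞}
    (hP : P = volume S * volume T ∨ P = volume S ^ (1 / (d : ℝ)) * meanWidth T) :
    IsSupportBound (Lp.fourierTransformₗᵢ (Space d) ℂ).symm S T (expFactor d P) := by
  rcases eq_or_ne (volume S) 0 with hS0 | hS0
  · exact isSupportBound_of_volume_eq_zero _ hS0 _
  intro f hf2 hfm hf1 hfS
  have h1 : (Lp.fourierTransformₗᵢ (Space d) ℂ).symm (hf2.toLp f) =ᵐ[volume] fourierInt f :=
    fourierInv_toLp_ae_eq hf1 hf2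
  have h2 : (fun ξ => ‖(Lp.fourierTransformₗᵢ (Space d) ℂ).symm (hf2.toLp f) ξ‖ₑ ^ 2)
      =ᵐ[volume] fun ξ => ‖fourierInt f ξ‖ₑ ^ 2 := by
    filter_upwards [h1] with ξ hξ
    rw [hξ]
  rw [lintegral_congr_ae h2, lintegral_congr_ae (ae_restrict_of_ae h2)]
  exact lintegral_fourierInt_le hS hT hS0 hP hfm hf1 hf2 hfS

/-- Changing the sign of the exponential amounts, in modulus, to conjugating f, which keeps its
support. -/
theorem isSupportBound_fourier (hS : IsCompact S) (hT : IsCompact T) {P : ℝ≥0∞}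
    (hP : P = volume S * volume T ∨ P = volume S ^ (1 / (d : ℝ)) * meanWidth T) :
    IsSupportBound (Lp.fourierTransformₗᵢ (Space d) ℂ) S T (expFactor d P) := by
  rcases eq_or_ne (volume S) 0 with hS0 | hS0
  · exact isSupportBound_of_volume_eq_zero _ hS0 _
  intro f hf2 hfm hf1 hfS
  have h1 : Lp.fourierTransformₗᵢ (Space d) ℂ (hf2.toLp f) =ᵐ[volume]
      fun ξ => fourierInt f (-ξ) := fourier_toLp_ae_eq hf1 hf2
  have h2 : (fun ξ => ‖Lp.fourierTransformₗᵢ (Space d) ℂ (hf2.toLp f) ξ‖ₑ ^ 2)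
      =ᵐ[volume] fun ξ => ‖fourierInt (fun x => starRingEnd ℂ (f x)) ξ‖ₑ ^ 2 := by
    filter_upwards [h1] with ξ hξ
    rw [hξ, ← ofReal_norm, norm_fourierInt_neg, ofReal_norm]
  rw [lintegral_congr_ae h2, lintegral_congr_ae (ae_restrict_of_ae h2)]
  have hcm : Measurable fun x => starRingEnd ℂ (f x) :=
    Complex.continuous_conj.measurable.comp hfm
  have hn : ∀ᵐ x, ‖starRingEnd ℂ (f x)‖ = ‖f x‖ := ae_of_all _ fun x => RCLike.norm_conj _
  exact lintegral_fourierInt_le hS hT hS0 hP hcm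
    (hf1.congr' hcm.aestronglyMeasurable (hn.mono fun _ => Eq.symm))
    ((memLp_congr_norm hcm.aestronglyMeasurable hf2.1 hn).mpr hf2)
    fun x hx => by rw [hfS x hx, map_zero]

end Transform

/-! ### General functions and general sets -/

section Reduction

variable {d : ℕ}

theorem enorm_sub_sq_le (a b : ℂ) : ‖a - b‖ₑ ^ 2 ≤ 2 * ‖a‖ₑ ^ 2 + 2 * ‖b‖ₑ ^ 2 := by
  rw [← ofReal_norm, ← ofReal_norm a, ← ofReal_norm b, ← ENNReal.ofReal_pow (norm_nonneg _),
    ← ENNReal.ofReal_pow (norm_nonneg _), ← ENNReal.ofReal_pow (norm_nonneg _),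
    ← ENNReal.ofReal_ofNat 2, ← ENNReal.ofReal_mul (by norm_num),
    ← ENNReal.ofReal_mul (by norm_num), ← ENNReal.ofReal_add (by positivity) (by positivity)]
  refine ENNReal.ofReal_le_ofReal ?_
  have h := norm_sub_le a b
  nlinarith [sq_nonneg (‖a‖ - ‖b‖), norm_nonneg (a - b), norm_nonneg a, norm_nonneg b]

/-- Cut f along S. Off T the transform of the inner part is that of f minus that of the outer part,
and the latter has norm at most that of f off S by Plancherel. The 3 is 2 from squaring a difference
plus 1 for the outer part. -/
theorem IsSupportBound.lintegral_le
    {U : Lp ℂ 2 (volume : Measure (Space d)) ≃ₗᵢ[ℂ] Lp ℂ 2 (volume : Measure (Space d))}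
    {S T : Set (Space d)} {A : ℝ≥0∞} (h : IsSupportBound U S T A) (hA : 1 ≤ A)
    (hS : MeasurableSet S) (hSf : volume S ≠ ⊤)
    (f : Lp ℂ 2 (volume : Measure (Space d))) :
    ∫⁻ x, ‖f x‖ₑ ^ 2 ≤ 3 * A * ((∫⁻ x in Sᶜ, ‖f x‖ₑ ^ 2) + ∫⁻ ξ in Tᶜ, ‖U f ξ‖ₑ ^ 2) := by
  have hm : MemLp (S.indicator f) 2 := (Lp.memLp f).indicator hS
  have hm' : MemLp (Sᶜ.indicator f) 2 := (Lp.memLp f).indicator hS.compl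
  have hmeas : Measurable f := (Lp.stronglyMeasurable f).measurable
  have hi : Integrable (S.indicator f) := by
    rw [integrable_indicator_iff hS]
    have : IsFiniteMeasure (volume.restrict S) := ⟨by simpa using hSf.lt_top⟩
    exact ((Lp.memLp f).restrict S).integrable one_le_two
  have hsum : f = hm.toLp _ + hm'.toLp _ := by
    rw [← MemLp.toLp_add]
    simp only [Set.indicator_self_add_compl]
    exact (Lp.toLp_coeFn f (Lp.memLp f)).symm
  have hsq : ∀ {E : Set (Space d)} (hE : MeasurableSet E) (hmE : MemLp (E.indicator f) 2),
      ∫⁻ x, ‖hmE.toLp _ x‖ₑ ^ 2 = ∫⁻ x in E, ‖f x‖ₑ ^ 2 := by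
    intro E hE hmE
    rw [← lintegral_indicator hE]
    refine lintegral_congr_ae ?_
    filter_upwards [hmE.coeFn_toLp] with x hx
    rw [hx]
    by_cases hxE : x ∈ E <;> simp [hxE]
  have hU : ∀ u : Lp ℂ 2 (volume : Measure (Space d)),
      ∫⁻ ξ, ‖U u ξ‖ₑ ^ 2 = ∫⁻ x, ‖u x‖ₑ ^ 2 := by
    intro u
    rw [lintegral_sq_enorm_eq, lintegral_sq_enorm_eq, LinearIsometryEquiv.enorm_map]
  set a := ∫⁻ x in Sᶜ, ‖f x‖ₑ ^ 2 with ha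
  set b := ∫⁻ ξ in Tᶜ, ‖U f ξ‖ₑ ^ 2 with hb
  have hdiff : U (hm.toLp _) = U f - U (hm'.toLp _) := by
    rw [← map_sub]
    congr 1
    exact eq_sub_of_add_eq hsum.symm
  have h1 : ∫⁻ ξ in Tᶜ, ‖U (hm.toLp _) ξ‖ₑ ^ 2 ≤ 2 * b + 2 * a := by
    calc ∫⁻ ξ in Tᶜ, ‖U (hm.toLp _) ξ‖ₑ ^ 2
        ≤ ∫⁻ ξ in Tᶜ, (2 * ‖U f ξ‖ₑ ^ 2 + 2 * ‖U (hm'.toLp _) ξ‖ₑ ^ 2) := by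
          refine lintegral_mono_ae (ae_restrict_of_ae ?_)
          filter_upwards [Lp.coeFn_sub (U f) (U (hm'.toLp _))] with ξ hξ
          rw [hdiff, hξ]
          exact enorm_sub_sq_le _ _
      _ = 2 * b + 2 * ∫⁻ ξ in Tᶜ, ‖U (hm'.toLp _) ξ‖ₑ ^ 2 := by
          rw [lintegral_add_left, lintegral_const_mul, lintegral_const_mul]
          · exact (Lp.stronglyMeasurable _).measurable.enorm.pow_const 2
          · exact (Lp.stronglyMeasurable _).measurable.enorm.pow_const 2
          · exact ((Lp.stronglyMeasurable _).measurable.enorm.pow_const 2).const_mul 2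
      _ ≤ 2 * b + 2 * a := by
          gcongr
          rw [ha, ← hsq hS.compl hm', ← hU]
          exact setLIntegral_le_lintegral _ _
  have h2 := h _ hm (hmeas.indicator hS) hi fun x hx => Set.indicator_of_notMem hx _
  rw [hU, hsq hS hm] at h2
  calc ∫⁻ x, ‖f x‖ₑ ^ 2 = (∫⁻ x in S, ‖f x‖ₑ ^ 2) + a := (lintegral_add_compl _ hS).symm
    _ ≤ A * (2 * b + 2 * a) + A * (a + b) := by
        refine add_le_add (h2.trans (mul_le_mul_right h1 _)) ?_
        exact le_self_add.trans (le_mul_of_one_le_left zero_le hA)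
    _ = _ := by ring

theorem integral_sq_norm_eq_toReal (f : Lp ℂ 2 (volume : Measure (Space d))) (E : Set (Space d)) :
    ∫ x in E, ‖f x‖ ^ 2 = (∫⁻ x in E, ‖f x‖ₑ ^ 2).toReal := by
  rw [integral_eq_lintegral_of_nonneg_ae (ae_of_all _ fun x => by positivity)
    ((continuous_pow 2).comp_stronglyMeasurable (Lp.stronglyMeasurable f).norm).aestronglyMeasurable]
  simp only [ENNReal.ofReal_pow (norm_nonneg _), ofReal_norm]

theorem expFactor_mono {P Q : ℝ≥0∞} (h : P ≤ Q) (hQ : Q ≠ ⊤) : expFactor d P ≤ expFactor d Q := by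
  have h0 := supportConst_pos d
  have h1 := ENNReal.toReal_mono hQ h
  unfold expFactor
  gcongr

/-- Inner regularity of the finite measure |f|² dx, on a measurable subset of S of full measure. -/
theorem exists_isCompact_subset_lintegral_compl_le {S : Set (Space d)}
    (hS : NullMeasurableSet S volume)
    (f : Lp ℂ 2 (volume : Measure (Space d))) {ε : ℝ≥0∞} (hε : ε ≠ 0) :
    ∃ K ⊆ S, IsCompact K ∧ ∫⁻ x in Kᶜ, ‖f x‖ₑ ^ 2 ≤ (∫⁻ x in Sᶜ, ‖f x‖ₑ ^ 2) + ε := by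
  obtain ⟨S', hS', hS'm, hae⟩ := hS.exists_measurable_subset_ae_eq
  have hfin : ∫⁻ x, ‖f x‖ₑ ^ 2 ≠ ⊤ := by
    rw [lintegral_sq_enorm_eq]
    finiteness
  have : IsFiniteMeasure (volume.withDensity fun x => ‖f x‖ₑ ^ 2) :=
    isFiniteMeasure_withDensity hfin
  obtain ⟨K, hK, hKc, hlt⟩ := hS'm.exists_isCompact_lt_add
    (μ := volume.withDensity fun x => ‖f x‖ₑ ^ 2) (measure_ne_top _ _) hε
  refine ⟨K, hK.trans hS', hKc, ?_⟩
  rw [withDensity_apply _ hS'm, withDensity_apply _ hKc.measurableSet] at hlt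
  have h0 : ∫⁻ x in S'ᶜ, ‖f x‖ₑ ^ 2 = ∫⁻ x in Sᶜ, ‖f x‖ₑ ^ 2 :=
    setLIntegral_congr (ae_eq_set_compl_compl.mpr hae)
  rw [← h0]
  have h1 := lintegral_add_compl (μ := volume) (fun x => ‖f x‖ₑ ^ 2) hS'm
  have h2 := lintegral_add_compl (μ := volume) (fun x => ‖f x‖ₑ ^ 2) hKc.measurableSet
  have h3 : ∫⁻ x in K, ‖f x‖ₑ ^ 2 ≠ ⊤ :=
    ((setLIntegral_le_lintegral _ _).trans_lt hfin.lt_top).ne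
  rw [← ENNReal.add_le_add_iff_left h3, h2, ← h1]
  calc _ ≤ ((∫⁻ x in K, ‖f x‖ₑ ^ 2) + ε) + ∫⁻ x in S'ᶜ, ‖f x‖ₑ ^ 2 := by gcongr
    _ = _ := by ring

variable [NeZero d] {S T : Set (Space d)}

theorem lintegral_le_of_isCompact (hS : IsCompact S) (hT : IsCompact T)
    (f : Lp ℂ 2 (volume : Measure (Space d))) :
    ∫⁻ x, ‖f x‖ₑ ^ 2 ≤ 3 * expFactor d (exponent S T) *
      ((∫⁻ x in Sᶜ, ‖f x‖ₑ ^ 2) + ∫⁻ ξ in Tᶜ, ‖fourierL2 f ξ‖ₑ ^ 2) := by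
  have key : ∀ P, (P = volume S * volume T ∨ P = volume S ^ (1 / (d : ℝ)) * meanWidth T) →
      ∫⁻ x, ‖f x‖ₑ ^ 2 ≤ 3 * expFactor d P *
      ((∫⁻ x in Sᶜ, ‖f x‖ₑ ^ 2) + ∫⁻ ξ in Tᶜ, ‖fourierL2 f ξ‖ₑ ^ 2) := fun P hP =>
    (isSupportBound_fourierInv hS hT hP).lintegral_le (one_le_expFactor P) hS.measurableSet
      hS.measure_ne_top f
  unfold exponent
  rcases min_choice (volume S * volume T) (min (volume S ^ (1 / (d : ℝ)) * meanWidth T)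
    (meanWidth S * volume T ^ (1 / (d : ℝ)))) with h | h
  · rw [h]
    exact key _ (Or.inl rfl)
  rw [h]
  rcases min_choice (volume S ^ (1 / (d : ℝ)) * meanWidth T)
    (meanWidth S * volume T ^ (1 / (d : ℝ))) with h' | h'
  · rw [h']
    exact key _ (Or.inr rfl)
  rw [h']
  -- The roles of S and T are exchanged: the bound is applied to `fourierL2 f`, whose forward
  -- transform is f.
  have h1 := (isSupportBound_fourier hT hS (P := meanWidth S * volume T ^ (1 / (d : ℝ)))
    (Or.inr (mul_comm _ _))).lintegral_le (one_le_expFactor _) hT.measurableSet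
      hT.measure_ne_top (fourierL2 f)
  have h2 : Lp.fourierTransformₗᵢ (Space d) ℂ (fourierL2 f) = f :=
    (Lp.fourierTransformₗᵢ (Space d) ℂ).apply_symm_apply f
  have h3 : ∫⁻ x, ‖fourierL2 f x‖ₑ ^ 2 = ∫⁻ x, ‖f x‖ₑ ^ 2 := by
    rw [lintegral_sq_enorm_eq, lintegral_sq_enorm_eq]
    congr 1
    exact (Lp.fourierTransformₗᵢ (Space d) ℂ).symm.enorm_map f
  rw [h2, h3, add_comm] at h1
  exact h1

theorem exponent_mono {S' T' : Set (Space d)} (hS : S' ⊆ S) (hT : T' ⊆ T) :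
    exponent S' T' ≤ exponent S T := by
  have hw : ∀ {E' E : Set (Space d)}, E' ⊆ E → meanWidth E' ≤ meanWidth E := fun h =>
    lintegral_mono fun ρ => measure_mono (Set.image_mono h)
  unfold exponent
  have h1 := hw hS
  have h2 := hw hT
  gcongr

theorem exponent_ne_top (hS : volume S ≠ ⊤) (hT : volume T ≠ ⊤) : exponent S T ≠ ⊤ :=
  ((min_le_left _ _).trans_lt (ENNReal.mul_lt_top hS.lt_top hT.lt_top)).ne

/-- The exponent of compact subsets is no larger than that of S and T, so no measurability of their
projections is needed. Each approximation error ε/2/A is multiplied by A. -/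
theorem lintegral_le_of_nullMeasurableSet (hS : NullMeasurableSet S volume)
    (hT : NullMeasurableSet T volume) (hSf : volume S ≠ ⊤) (hTf : volume T ≠ ⊤)
    (f : Lp ℂ 2 (volume : Measure (Space d))) :
    ∫⁻ x, ‖f x‖ₑ ^ 2 ≤ 3 * expFactor d (exponent S T) *
      ((∫⁻ x in Sᶜ, ‖f x‖ₑ ^ 2) + ∫⁻ ξ in Tᶜ, ‖fourierL2 f ξ‖ₑ ^ 2) := by
  set A := 3 * expFactor d (exponent S T) with hA
  have hAtop : A ≠ ⊤ := ENNReal.mul_ne_top (by simp) (expFactor_ne_top _)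
  have hA0 : A ≠ 0 := mul_ne_zero (by simp) (zero_lt_one.trans_le (one_le_expFactor _)).ne'
  refine ENNReal.le_of_forall_pos_le_add fun ε hε _ => ?_
  have hδ : (ε : ℝ≥0∞) / 2 / A ≠ 0 := by
    refine ENNReal.div_ne_zero.mpr ⟨?_, hAtop⟩
    exact ENNReal.div_ne_zero.mpr ⟨by exact_mod_cast hε.ne', by simp⟩
  obtain ⟨K, hKS, hK, hKi⟩ := exists_isCompact_subset_lintegral_compl_le hS f hδ
  obtain ⟨L, hLT, hL, hLi⟩ := exists_isCompact_subset_lintegral_compl_le hT (fourierL2 f) hδ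
  calc ∫⁻ x, ‖f x‖ₑ ^ 2 ≤ 3 * expFactor d (exponent K L) *
        ((∫⁻ x in Kᶜ, ‖f x‖ₑ ^ 2) + ∫⁻ ξ in Lᶜ, ‖fourierL2 f ξ‖ₑ ^ 2) :=
        lintegral_le_of_isCompact hK hL f
    _ ≤ A * (((∫⁻ x in Sᶜ, ‖f x‖ₑ ^ 2) + ε / 2 / A) +
        ((∫⁻ ξ in Tᶜ, ‖fourierL2 f ξ‖ₑ ^ 2) + ε / 2 / A)) := by
        refine mul_le_mul' (mul_le_mul_right ?_ _) (add_le_add hKi hLi)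
        exact expFactor_mono (exponent_mono hKS hLT) (exponent_ne_top hSf hTf)
    _ = A * ((∫⁻ x in Sᶜ, ‖f x‖ₑ ^ 2) + ∫⁻ ξ in Tᶜ, ‖fourierL2 f ξ‖ₑ ^ 2) +
        (A * (ε / 2 / A) + A * (ε / 2 / A)) := by ring
    _ = _ := by rw [ENNReal.mul_div_cancel hA0 hAtop, ENNReal.add_halves]

end Reduction

end MeanWidth

theorem mainTheorem1 (d : ℕ) [NeZero d] :
    ∃ C : ℝ, 0 < C ∧
      ∀ S T : Set (EuclideanSpace ℝ (Fin d)),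
        NullMeasurableSet S volume → NullMeasurableSet T volume →
        volume S < ∞ → volume T < ∞ →
        ∀ f : Lp ℂ 2 (volume : Measure (EuclideanSpace ℝ (Fin d))),
          ∫ x, ‖f x‖ ^ 2 ≤
            C * Real.exp (C * (MeanWidth.exponent S T).toReal) *
              ((∫ x in Sᶜ, ‖f x‖ ^ 2) + ∫ ξ in Tᶜ, ‖MeanWidth.fourierL2 f ξ‖ ^ 2) := by
  have hpos := MeanWidth.supportConst_pos d
  -- The 3 is needed only in front; in the exponent it is harmless because the exponent is
  -- nonnegative.
  refine ⟨3 * MeanWidth.supportConst d, by positivity, fun S T hS hT hSf hTf f => ?_⟩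
  have h := MeanWidth.lintegral_le_of_nullMeasurableSet hS hT hSf.ne hTf.ne f
  have hfin : ∀ (u : Lp ℂ 2 (volume : Measure (EuclideanSpace ℝ (Fin d)))) E,
      ∫⁻ x in E, ‖u x‖ₑ ^ 2 ≠ ∞ := fun u E => by
    refine ((setLIntegral_le_lintegral _ _).trans_lt ?_).ne
    rw [MeanWidth.lintegral_sq_enorm_eq]
    finiteness
  have h1 := ENNReal.toReal_mono (ENNReal.mul_ne_top
    (ENNReal.mul_ne_top (by simp) (MeanWidth.expFactor_ne_top _))
    (ENNReal.add_ne_top.mpr ⟨hfin _ _, hfin _ _⟩)) h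
  rw [ENNReal.toReal_mul, ENNReal.toReal_mul, ENNReal.toReal_add (hfin _ _) (hfin _ _),
    MeanWidth.toReal_expFactor] at h1
  rw [← setIntegral_univ, MeanWidth.integral_sq_norm_eq_toReal,
    MeanWidth.integral_sq_norm_eq_toReal, MeanWidth.integral_sq_norm_eq_toReal, setLIntegral_univ]
  refine h1.trans ?_
  rw [ENNReal.toReal_ofNat, ← mul_assoc]
  refine mul_le_mul_of_nonneg_right (mul_le_mul_of_nonneg_left (Real.exp_le_exp.mpr ?_)
    (by positivity)) (by positivity)
  exact mul_le_mul_of_nonneg_right (by linarith) ENNReal.toReal_nonneg
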